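/- Let $G$ be a finitely generated group and $H \le G$ a subgroup of finite index. Then $H$ is finitely generated, and the power word problem of $G$ is $\mathsf{NC}^1$-many-one reducible to the power word problem of $H$, for every choice of finite generating sets of $G$ and $H$. Here the notions are as follows. *Power word problem.* Let $X$ be a finite set and $\varphi\colon F(X)\to G$ a surjective homomorphism from the free group on $X$; let $\Sigma = X\cup X^{-1}$. A power word is a tuple $(u_1,x_1,\dots,u_n,x_n)$ with $n\ge 0$, words $u_i\in\Sigma^*$ and integers $x_i\in\mathbb Z$ given in binary (a sign and a non-empty string of bits, most significant bit first; leading zeros are allowed). It is written as the string that concatenates, for $i=1,\dots,n$, the word $u_i$, the sign of $x_i$ and the bits of $x_i$, and this string is turned into a bit string by replacing every symbol by its codeword under a fixed injective map into $\{0,1\}^\ell$ for some $\ell$. $\mathrm{PowWP}(G)\subseteq\{0,1\}^*$ is the language of the encodings of all power words with $u_1^{x_1}\cdots u_n^{x_n}=1$ in $G$; bit strings that do not encode a power word do not belong to it. The theorem holds for all finite $X$, $Y$, all surjective $\varphi\colon F(X)\to G$ and $\psi\colon F(Y)\to H$, and all such symbol encodings. *Reducibility.* A language $L\subseteq\{0,1\}^*$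 is $\mathsf{NC}^1$-many-one reducible to $K\subseteq\{0,1\}^*$ if there is an $\mathsf{NC}^1$-computable $f\colon\{0,1\}^*\to\{0,1\}^*$ with $x\in L\iff f(x)\in K$ for all $x$. The function $f$ is $\mathsf{NC}^1$-computable if it is computed by a $\mathsf{DLOGTIME}$-uniform family $(C_n)_{n\ge 0}$ of Boolean circuits of fan-in at most two, polynomial size and depth $O(\log n)$, where $C_n$ has $n$ input bits and $m(n)$ output bits and outputs $f(x)$ on every $x\in\{0,1\}^n$. The family is $\mathsf{DLOGTIME}$-uniform if the gates of $C_n$ are named by bit strings of length $O(\log n)$ and there are deterministic multi-tape Turing machines that, with numbers given in binary and in time $O(\log n)$, (i) compute, given $n$ and a gate $u$ of $C_n$, the type of $u$ (which input bit, constant, not, and, or); (ii) decide, given $n$, gates $u,v$ of $C_n$ and a number $i$ with $O(\log n)$ bits, whether $u$ is the $i$-th input gate of $v$; (iii) decide, given $n$, a gate $u$ of $C_n$ and a number $j$ with $O(\log n)$ bits, whether $u$ is the $j$-th output gate of $C_n$. -/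

import Mathlib

/-! ### Boolean circuits with fan-in at most two -/

/-- The label of a gate in a Boolean circuit with `n` input bits, together with the ordered list of
the gates that feed it; gates are named by elements of `α`. -/
inductive GateLabel (n : ℕ) (α : Type) where
  | input (i : Fin n)
  | const (b : Bool)
  | not (u : α)
  | and (u v : α)
  | or (u v : α)

/-- The ordered list of the gates that feed a gate. -/
def GateLabel.preds {n : ℕ} {α : Type} : GateLabel n α → List α
  | .input _ => []
  | .const _ => []
  | .not u => [u]
  | .and u v => [u, v]
  | .or u v => [u, v]

/-- A binary name of the type of a gate (which input bit, which constant, or which connective).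
It does not mention the gates that feed it. -/
def GateLabel.typeCode {n : ℕ} {α : Type} : GateLabel n α → List Bool
  | .input i => false :: Nat.bits i
  | .const false => [true, false, false, false]
  | .const true => [true, false, false, true]
  | .not _ => [true, false, true]
  | .and _ _ => [true, true, false]
  | .or _ _ => [true, true, true]

/-- A Boolean circuit with `n` input bits and `m` (ordered) output gates whose gates are the
elements of `α`. All wires go from a gate of smaller level to a gate of larger level, so the circuit
is acyclic, and a path that ends in `v` has length at most `level v`. -/
structure Circuit (n m : ℕ) (α : Type) where
  label : α → GateLabel n α
  level : α → ℕ
  level_lt : ∀ v, ∀ u ∈ (label v).preds, level u < level v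
  out : Fin m → α

/-- The value of the gate `v` on the input `x`. -/
def Circuit.eval {n m : ℕ} {α : Type} (C : Circuit n m α) (x : Fin n → Bool) (v : α) : Bool :=
  match _h : C.label v with
  | .input i => x i
  | .const b => b
  | .not u => !(C.eval x u)
  | .and u w => C.eval x u && C.eval x w
  | .or u w => C.eval x u || C.eval x w
termination_by C.level v
decreasing_by
  all_goals exact C.level_lt v _ (by rw [_h]; simp [GateLabel.preds])

/-! ### Circuit families, `DLOGTIME`-uniformity and `NC¹` -/

/-- Logarithmic bound: `Nat.size n` is the length of the binary representation of `n`, so this is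
`c · Θ(log n)`, made positive for small `n`. -/
def logBound (c n : ℕ) : ℕ := c * (Nat.size n + 1)

/-- Gates are named by bit strings of length `O(log n)`. (Names that are not needed are given to
dummy gates that carry a constant.) -/
abbrev GateName (c n : ℕ) : Type := {u : List Bool // u.length ≤ logBound c n}

/-- A family `(Cₙ)` of Boolean circuits of fan-in at most two; `Cₙ` has `n` input bits and
`outLen n` output bits. Since the gates and the indices of the outputs are written with `O(log n)`
bits, the size of `Cₙ` is polynomial in `n` (see `CircuitFamily.card_gates_le`). -/
structure CircuitFamily where
  nameConst : ℕ
  outLen : ℕ → ℕ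
  size_outLen_le : ∀ n, Nat.size (outLen n) ≤ logBound nameConst n
  circuit : ∀ n, Circuit n (outLen n) (GateName nameConst n)

/-- The number of gates is at most a polynomial in `n`. -/
theorem CircuitFamily.card_gates_le (F : CircuitFamily) (n : ℕ) :
    Nat.card (GateName F.nameConst n) ≤ 2 * (4 * (n + 1)) ^ F.nameConst := by
  set w := logBound F.nameConst n with hw
  have h1 : Nat.card (GateName F.nameConst n) ≤ 2 ^ (w + 1) := by
    let g : GateName F.nameConst n → Σ i : Fin (w + 1), List.Vector Bool i :=
      fun u => ⟨⟨u.1.length, Nat.lt_succ_of_le u.2⟩, ⟨u.1, rfl⟩⟩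
    have hg : Function.Injective g := by
      intro u v huv
      have h2 : (g u).2.1 = (g v).2.1 := by rw [huv]
      exact Subtype.ext h2
    refine (Nat.card_le_card_of_injective g hg).trans ?_
    rw [Nat.card_eq_fintype_card, Fintype.card_sigma]
    simp only [card_vector, Fintype.card_bool]
    rw [Fin.sum_univ_eq_sum_range (fun i => 2 ^ i)]
    exact (Nat.geomSum_lt le_rfl (fun k hk => Finset.mem_range.1 hk)).le
  refine h1.trans ?_
  have h3 : 2 ^ Nat.size n ≤ 2 * (n + 1) := by
    rcases Nat.eq_zero_or_pos n with rfl | hn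
    · simp
    · have h4 : Nat.size n ≠ 0 := (Nat.size_pos.2 hn).ne'
      obtain ⟨k, hk⟩ := Nat.exists_eq_succ_of_ne_zero h4
      have h5 : 2 ^ k ≤ n := Nat.lt_size.1 (by omega)
      rw [hk, pow_succ]
      omega
  rw [hw, logBound, pow_succ, mul_comm F.nameConst, pow_mul, mul_comm]
  refine Nat.mul_le_mul_left _ (Nat.pow_le_pow_left ?_ _)
  rw [pow_succ]
  omega

/-- The function on bit strings that is computed by a circuit family. -/
def CircuitFamily.run (F : CircuitFamily) (x : List Bool) : List Bool :=
  List.ofFn fun j => (F.circuit x.length).eval x.get ((F.circuit x.length).out j)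

/-- The circuits have depth `O(log n)`. -/
def CircuitFamily.LogDepth (F : CircuitFamily) : Prop :=
  ∃ d : ℕ, ∀ n v, (F.circuit n).level v ≤ logBound d n

/-- A tuple of bit strings as one string; `none` ends each component. -/
def tupleCode (l : List (List Bool)) : List (Option Bool) :=
  l.flatMap fun w => w.map some ++ [none]

/-- A deterministic Turing machine that takes a tuple of bit strings as its input and returns a bit
string. The model is the machine with several stacks, which is a multi-tape machine (a tape is a
pair of stacks) up to a constant factor in the running time. -/
abbrev TupleMachine : Type 1 := Turing.TM2ComputableAux (Option Bool) Bool

/-- On the tuple `l`, the machine `M` returns `y` after at most `t` steps. -/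
def TupleMachine.OutputsWithin (M : TupleMachine) (l : List (List Bool)) (y : List Bool) (t : ℕ) :
    Prop :=
  Nonempty (Turing.TM2OutputsInTime M.tm ((tupleCode l).map M.inputAlphabet.invFun)
    (some (y.map M.outputAlphabet.invFun)) t)

/-- `DLOGTIME`-uniformity. Numbers are given in binary, and all machines run in time `O(log n)`:
* one machine computes the type of the gate `u` of `Cₙ`;
* one machine decides whether the gate `u` is the `i`-th input of the gate `v` of `Cₙ`;
* one machine decides whether the gate `u` is the `j`-th output gate of `Cₙ` (in particular it
  rejects if there is no `j`-th output gate). -/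
def CircuitFamily.DLogTimeUniform (F : CircuitFamily) : Prop :=
  ∃ (t : ℕ) (M₁ M₂ M₃ : TupleMachine),
    (∀ n (u : GateName F.nameConst n),
      M₁.OutputsWithin [Nat.bits n, u] ((F.circuit n).label u).typeCode (logBound t n)) ∧
    (∀ n (u v : GateName F.nameConst n) (i : ℕ), Nat.size i ≤ logBound F.nameConst n →
      M₂.OutputsWithin [Nat.bits n, u, v, Nat.bits i]
        [decide (((F.circuit n).label v).preds[i]? = some u)] (logBound t n)) ∧
    (∀ n (u : GateName F.nameConst n) (j : ℕ), Nat.size j ≤ logBound F.nameConst n →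
      M₃.OutputsWithin [Nat.bits n, u, Nat.bits j]
        [decide (∃ h : j < F.outLen n, (F.circuit n).out ⟨j, h⟩ = u)] (logBound t n))

/-- `f` is computed by a `DLOGTIME`-uniform family of Boolean circuits of bounded fan-in, polynomial
size and logarithmic depth. -/
def NC1Computable (f : List Bool → List Bool) : Prop :=
  ∃ F : CircuitFamily, F.LogDepth ∧ F.DLogTimeUniform ∧ ∀ x, f x = F.run x

/-- `NC¹`-many-one reducibility of languages over the binary alphabet. -/
def NC1ManyOneReducible (L K : Language Bool) : Prop :=
  ∃ f : List Bool → List Bool, NC1Computable f ∧ ∀ x, x ∈ L ↔ f x ∈ K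

/-! ### The power word problem -/

/-- The letters of the alphabet over which power words are written: `letter (a, true)` is the
generator `a`, `letter (a, false)` its formal inverse, and a sign and bits make up an exponent. -/
inductive PowerSymbol (X : Type*) where
  | letter (a : X × Bool)
  | sign (neg : Bool)
  | bit (b : Bool)

/-- A pair `(u, x)` of a word `u` over the generators and their inverses and an integer `x` in
binary (a sign and a non-empty string of bits, the most significant one first; leading zeros are
allowed). -/
structure PowerFactor (X : Type*) where
  base : List (X × Bool)
  neg : Bool
  digits : List Bool
  digits_ne_nil : digits ≠ []

/-- The number with a given binary representation, the most significant bit first. -/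
def binaryValue (l : List Bool) : ℕ := l.foldl (fun a b => 2 * a + b.toNat) 0

/-- The integer `x` of the pair `(u, x)`. -/
def PowerFactor.exponent {X : Type*} (p : PowerFactor X) : ℤ :=
  if p.neg then -(binaryValue p.digits : ℤ) else (binaryValue p.digits : ℤ)

/-- The pair `(u, x)` as a string: the word `u`, the sign of `x`, the bits of `x`. -/
def PowerFactor.symbols {X : Type*} (p : PowerFactor X) : List (PowerSymbol X) :=
  p.base.map PowerSymbol.letter ++ PowerSymbol.sign p.neg :: p.digits.map PowerSymbol.bit

/-- The group element `u₁ ^ x₁ ⋯ uₙ ^ xₙ` that is represented by the power word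
`(u₁, x₁, …, uₙ, xₙ)`, for generators given by `φ : F(X) → G`. -/
def powerWordValue {X G : Type*} [Group G] (φ : FreeGroup X →* G) (P : List (PowerFactor X)) : G :=
  (P.map fun p => φ (FreeGroup.mk p.base) ^ p.exponent).prod

/-- A binary encoding of an alphabet: distinct letters have distinct codes of the same length. -/
structure BlockCode (A : Type*) where
  len : ℕ
  code : A → List Bool
  length_code : ∀ a, (code a).length = len
  code_injective : Function.Injective code

/-- The power word problem of `G` with respect to the generators given by `φ`, as a language over
the binary alphabet: the encodings of the power words that represent `1`. (A bit string that does not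
encode a power word is not in the language.) -/
def PowWP {X G : Type*} [Group G] (φ : FreeGroup X →* G) (c : BlockCode (PowerSymbol X)) :
    Language Bool :=
  {w | ∃ P : List (PowerFactor X),
    w = (P.flatMap PowerFactor.symbols).flatMap c.code ∧ powerWordValue φ P = 1}

/-! ### Synchronous multi-stack machines -/

/-! The algebra is Schreier rewriting. Choose a normal subgroup `N` of finite index in `G` with `N ≤
H`, put `Γ = G / N` and `K = |Γ|`, and fix coset representatives `rep γ`. For a letter `a` the
element `rep γ * a * (rep (γ * a))⁻¹` lies in `N`, so it is the value of a word over the generators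
of `H`. Along a word `u` that is read from the coset `γ` on, these words multiply to `rep γ * u *
(rep (γ * u))⁻¹`. Since `u ^ K` is trivial in `Γ`, `K` successive copies of `u` yield a word with
the value `rep γ * u ^ K * (rep γ)⁻¹`, and powers of a conjugate are conjugates of powers. With `|x|
= K * q + ρ`, a factor `u ^ x` with `x ≥ 0` becomes this word to the power `q`, followed by `ρ`
single copies of `u`; for a negative sign it becomes the word to the power `-q`, then to the power
`-1`, followed by `K - ρ` single copies (`value_block_some`). The factors telescope once more, so a
power word with value `1` in `Γ` is translated into a power word over `H` for a conjugate of its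
value (`exists_powerWord_layout`). All other strings are sent to strings that begin with a bit and
therefore are not power words.

To make the translation computable in `NC¹`, its output has a rigid shape (`layout`): one block for
every position `e` at which a pair might end, a constant number of rows in a block, one slot for
every position `s` of the input, a constant number of places in a slot. Blocks without a pair and
slots without a letter have the value `1`. This requires rewriting words of one common length;
padding with `y y⁻¹` preserves parity, so `N` is chosen among the values of words of even length
(`exists_even_words`, `exists_cosetWords`).

Every symbol of the output then depends only on the final state of a finite automaton on the input
that is told which positions satisfy certain linear equations in `s`, `e` and the place
(`run_powerWord`). Cosets are products in `Γ`, and the digits of `q` come from long division, which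
needs only remainders modulo `K`. The equations are decided by another automaton that reads the
binary representations in parallel and keeps clamped values of linear forms (`clamp_step`).

A finite automaton is evaluated in logarithmic depth by halving the range of positions, with one
gate for each block and each pair of states (`gateValue_block`). A gate is named by a header from a
finite set and one column for each bit of an address. Its label is determined by a finite automaton
on the columns, so three machines that run in time linear in the names give uniformity
(`family_dLogTimeUniform`).

If `H` is given by no generators, it is trivial and `G` is finite; then the automaton decides the
problem itself. -/

/-- An operation on a single stack. -/
inductive StackOp (α : Type) where
  | keep
  | pop
  | push (a : α)

/-- The effect of an operation on a stack. -/
def StackOp.apply {α : Type} : StackOp α → List α → List α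
  | .keep, l => l
  | .pop, l => l.tail
  | .push a, l => a :: l

/-- A machine with finitely many stacks that in every step reads the tops of all stacks, performs
one operation on every stack, and changes its state or halts (`none`). -/
structure StackMachine (K : Type) (Γ : K → Type) where
  State : Type
  start : State
  next : State → (∀ k, Option (Γ k)) → Option State
  op : State → (∀ k, Option (Γ k)) → ∀ k, StackOp (Γ k)

namespace StackMachine

variable {K : Type} {Γ : K → Type}

/-- A configuration; the state `none` is the halted one. -/
abbrev Config (M : StackMachine K Γ) : Type := Option M.State × (∀ k, List (Γ k))

/-- One step of the machine, from a state that is not halted. -/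
def step (M : StackMachine K Γ) (q : M.State) (S : ∀ k, List (Γ k)) : M.Config :=
  (M.next q fun k => (S k).head?, fun k => (M.op q (fun k => (S k).head?) k).apply (S k))

/-- `M.Reach t c c'`: the machine gets from `c` to `c'` in at most `t` steps. -/
inductive Reach (M : StackMachine K Γ) : ℕ → M.Config → M.Config → Prop
  | refl (t c) : Reach M t c c
  | head {t q S c} : Reach M t (M.step q S) c → Reach M (t + 1) (some q, S) c

theorem Reach.mono {M : StackMachine K Γ} {t t' : ℕ} {a b : M.Config} (h : M.Reach t a b)
    (ht : t ≤ t') : M.Reach t' a b := by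
  induction h generalizing t' with
  | refl => exact .refl _ _
  | head _ ih =>
    obtain ⟨k, rfl⟩ := Nat.exists_eq_add_of_le' (Nat.le_of_add_left_le ht)
    exact .head (ih (Nat.le_of_add_le_add_right ht))

/-! ### Simulation of a stack machine by a Turing machine -/

variable [DecidableEq K]

open Turing TM2 Stmt

/-- Read the tops of the listed stacks into the second component of the internal state. -/
def peekAll {σ : Type} (ks : List K) (rest : Stmt Γ Unit (σ × ∀ k, Option (Γ k))) :
    Stmt Γ Unit (σ × ∀ k, Option (Γ k)) :=
  ks.foldr (fun k st => peek k (fun v o => (v.1, Function.update v.2 k o)) st) rest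

/-- Peeking changes no stack, so the tops can be read one after another, all within a single
statement. -/
theorem stepAux_peekAll {σ : Type} (ks : List K) (rest : Stmt Γ Unit (σ × ∀ k, Option (Γ k)))
    (q : σ) (T : ∀ k, Option (Γ k)) (S : ∀ k, List (Γ k)) :
    stepAux (peekAll ks rest) (q, T) S =
      stepAux rest (q, fun k => if k ∈ ks then (S k).head? else T k) S := by
  induction ks generalizing T with
  | nil => simp [peekAll]
  | cons a ks ih =>
    change stepAux (peekAll ks rest) _ S = _
    rw [ih]
    congr 2
    funext k
    by_cases h : k ∈ ks
    · simp [h]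
    · by_cases hk : k = a
      · subst hk; simp [h]
      · simp [h, hk]

/-- Perform the operations that the internal state prescribes on the listed stacks. -/
def applyAll {σ : Type} [∀ k, Inhabited (Γ k)] (op : σ → ∀ k, StackOp (Γ k)) (ks : List K)
    (rest : Stmt Γ Unit σ) : Stmt Γ Unit σ :=
  ks.foldr (fun k st =>
    branch (fun v => match op v k with | .pop => true | _ => false)
      (pop k (fun v _ => v) st)
      (branch (fun v => match op v k with | .push _ => true | _ => false)
        (push k (fun v => match op v k with | .push a => a | _ => default) st) st)) rest

/-- No stack is listed twice and the internal state `v` is left alone, so every operation acts on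
the original contents of its stack. -/
theorem stepAux_applyAll {σ : Type} [∀ k, Inhabited (Γ k)] (op : σ → ∀ k, StackOp (Γ k))
    (ks : List K) (hks : ks.Nodup) (rest : Stmt Γ Unit σ) (v : σ) (S : ∀ k, List (Γ k)) :
    stepAux (applyAll op ks rest) v S =
      stepAux rest v (fun k => if k ∈ ks then (op v k).apply (S k) else S k) := by
  induction ks generalizing S with
  | nil => simp [applyAll]
  | cons a ks ih =>
    obtain ⟨ha, hks⟩ := List.nodup_cons.1 hks
    have key : ∀ l, l = (op v a).apply (S a) →
        stepAux (applyAll op ks rest) v (Function.update S a l) =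
          stepAux rest v (fun k => if k ∈ a :: ks then (op v k).apply (S k) else S k) := by
      intro l hl
      rw [ih hks]
      congr 1
      funext k
      by_cases hk : k = a
      · subst hk; simp [ha, hl]
      · simp [hk]
    change stepAux (branch _ (pop a _ (applyAll op ks rest)) (branch _
      (push a _ (applyAll op ks rest)) (applyAll op ks rest))) v S = _
    simp only [stepAux]
    rcases hop : op v a with _ | _ | x
    · have := key (S a) (by rw [hop]; rfl)
      rw [Function.update_eq_self] at this
      simpa using this
    · simpa using key (S a).tail (by rw [hop]; rfl)
    · simpa using key (x :: S a) (by rw [hop]; rfl)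

variable [Fintype K] [∀ k, Inhabited (Γ k)]

/-- The program of the Turing machine that simulates a stack machine. -/
noncomputable def program (M : StackMachine K Γ) :
    Stmt Γ Unit (M.State × ∀ k, Option (Γ k)) :=
  peekAll Finset.univ.toList <|
    applyAll (fun v => M.op v.1 v.2) Finset.univ.toList <|
      branch (fun v => (M.next v.1 v.2).isSome)
        (load (fun v => ((M.next v.1 v.2).getD M.start, fun _ => none)) (goto fun _ => ()))
        -- `Turing.haltList` carries the initial internal state, which is therefore restored before
        -- halting.
        (load (fun _ => (M.start, fun _ => none)) halt)

/-- The Turing machine that simulates a stack machine. -/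
noncomputable def toTM (M : StackMachine K Γ) [Finite M.State] [∀ k, Finite (Γ k)] (k₀ k₁ : K) :
    FinTM2 :=
  letI : Fintype (Γ k₀) := Fintype.ofFinite _
  letI : Fintype (M.State × ∀ k, Option (Γ k)) := Fintype.ofFinite _
  { K := K
    k₀ := k₀
    k₁ := k₁
    Γ := Γ
    Λ := Unit
    main := ()
    σ := M.State × ∀ k, Option (Γ k)
    initialState := (M.start, fun _ => none)
    m := fun _ => M.program }

/-- The configuration of the Turing machine that corresponds to one of the stack machine. -/
def toCfg (M : StackMachine K Γ) (c : M.Config) :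
    Cfg Γ Unit (M.State × ∀ k, Option (Γ k)) :=
  ⟨c.1.map fun _ => (), (c.1.getD M.start, fun _ => none), c.2⟩

/-- The whole program is one statement, so a step is simulated by exactly one step and time bounds
carry over unchanged. -/
theorem step_program (M : StackMachine K Γ) (q : M.State) (S : ∀ k, List (Γ k)) :
    TM2.step (fun _ => M.program) (M.toCfg (some q, S)) = some (M.toCfg (M.step q S)) := by
  change some (stepAux M.program (q, fun _ => none) S) = _
  rw [program, stepAux_peekAll, stepAux_applyAll _ _ (Finset.nodup_toList _)]
  simp only [Finset.mem_toList, Finset.mem_univ, if_true, stepAux, toCfg, step]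
  cases M.next q (fun k => (S k).head?) <;> simp

theorem Reach.iterate {M : StackMachine K Γ} {t : ℕ} {c c' : M.Config} (h : M.Reach t c c') :
    ∃ s ≤ t, (flip bind (TM2.step fun _ => M.program))^[s] (some (M.toCfg c)) =
      some (M.toCfg c') := by
  induction h with
  | refl => exact ⟨0, Nat.zero_le _, rfl⟩
  | head _ ih =>
    obtain ⟨s, hs, ih⟩ := ih
    refine ⟨s + 1, Nat.succ_le_succ hs, ?_⟩
    rw [Function.iterate_succ_apply, ← ih]
    congr 1
    exact M.step_program _ _

end StackMachine

/-! ### Machines with an input tape, an output tape and five work stacks -/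

/-- The stacks of a column machine. -/
inductive Tape where
  | inp
  | out
  | a
  | b
  | c
  | d
  | e
  deriving DecidableEq

instance : Fintype Tape :=
  ⟨{.inp, .out, .a, .b, .c, .d, .e}, fun k => by cases k <;> simp⟩

/-- A column of a gate name: one bit of each of two addresses, and one bit (`none` if it is not
determined) of a third one. -/
abbrev Column : Type := Bool × Bool × Option Bool

/-- The alphabets of the stacks of a column machine. -/
abbrev Tape.Alphabet : Tape → Type
  | .inp => Option Bool
  | .out => Bool
  | .a => Bool
  | .b => Column
  | .c => Column
  | .d => Bool
  | .e => Option Bool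

instance Tape.finite_alphabet : ∀ k : Tape, Finite k.Alphabet
  | .inp => inferInstanceAs (Finite (Option Bool))
  | .out => inferInstanceAs (Finite Bool)
  | .a => inferInstanceAs (Finite Bool)
  | .b => inferInstanceAs (Finite Column)
  | .c => inferInstanceAs (Finite Column)
  | .d => inferInstanceAs (Finite Bool)
  | .e => inferInstanceAs (Finite (Option Bool))

instance Tape.inhabited_alphabet : ∀ k : Tape, Inhabited k.Alphabet
  | .inp => inferInstanceAs (Inhabited (Option Bool))
  | .out => inferInstanceAs (Inhabited Bool)
  | .a => inferInstanceAs (Inhabited Bool)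
  | .b => inferInstanceAs (Inhabited Column)
  | .c => inferInstanceAs (Inhabited Column)
  | .d => inferInstanceAs (Inhabited Bool)
  | .e => inferInstanceAs (Inhabited (Option Bool))

/-- A stack machine with the stacks `Tape`. -/
abbrev ColumnMachine : Type 1 := StackMachine Tape Tape.Alphabet

/-- The contents of the seven stacks. -/
def tapes (i : List (Option Bool)) (o : List Bool) (a : List Bool) (b c : List Column)
    (d : List Bool) (e : List (Option Bool)) : ∀ k : Tape, List k.Alphabet
  | .inp => i
  | .out => o
  | .a => a
  | .b => b
  | .c => c
  | .d => d
  | .e => e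

/-- One step in a form where, for a concrete machine, `hn` and the seven cases of `ho` usually hold
by `rfl`. -/
theorem ColumnMachine.reach_head {M : ColumnMachine} {q q' i o a b c d e i' o' a' b' c' d' e' t z}
    (hn : M.next q (fun k => (tapes i o a b c d e k).head?) = q')
    (ho : ∀ k, (M.op q (fun k => (tapes i o a b c d e k).head?) k).apply (tapes i o a b c d e k) =
      tapes i' o' a' b' c' d' e' k)
    (h : M.Reach t (q', tapes i' o' a' b' c' d' e') z) :
    M.Reach (t + 1) (some q, tapes i o a b c d e) z := by
  refine .head ?_
  rwa [StackMachine.step, hn, funext ho]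

/-- The machine with tuples as inputs that simulates a column machine. -/
noncomputable def ColumnMachine.toTupleMachine (M : ColumnMachine) [Finite M.State] :
    TupleMachine where
  tm := M.toTM .inp .out
  inputAlphabet := Equiv.refl _
  outputAlphabet := Equiv.refl _

/-- In `Turing.haltList` all stacks except the output stack are empty. For this reason the machines
below keep popping after an error instead of stopping at once. -/
theorem ColumnMachine.outputsWithin (M : ColumnMachine) [Finite M.State] {l : List (List Bool)}
    {y : List Bool} {t : ℕ}
    (h : M.Reach t (some M.start, tapes (tupleCode l) [] [] [] [] [] [])
      (none, tapes [] y [] [] [] [] [])) :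
    (M.toTupleMachine).OutputsWithin l y t := by
  obtain ⟨s, hs, h1⟩ := h.iterate
  refine ⟨⟨⟨s, ?_⟩, hs⟩⟩
  have hi : Turing.initList M.toTupleMachine.tm
      ((tupleCode l).map M.toTupleMachine.inputAlphabet.invFun) =
      M.toCfg (some M.start, tapes (tupleCode l) [] [] [] [] [] []) := by
    simp only [Turing.initList, StackMachine.toCfg]
    congr 1
    funext k
    cases k <;> first | rfl | exact List.map_id _
  have ho : Turing.haltList M.toTupleMachine.tm (y.map M.toTupleMachine.outputAlphabet.invFun) =
      M.toCfg (none, tapes [] y [] [] [] [] []) := by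
    simp only [Turing.haltList, StackMachine.toCfg]
    congr 1
    funext k
    cases k <;> first | rfl | exact List.map_id _
  rw [hi]
  simp only [Option.map_some]
  rw [ho]
  exact h1

/-! ### Names of gates -/

/-- The code of a symbol with the number `k` is `1 ^ k 0`. -/
def symbolCode {A : Type} {b : ℕ} (E : A ≃ Fin (b + 1)) (a : A) : List Bool :=
  List.replicate (E a) true ++ [false]

theorem length_symbolCode_le {A : Type} {b : ℕ} (E : A ≃ Fin (b + 1)) (a : A) :
    (symbolCode E a).length ≤ b + 1 := by
  have := (E a).2
  simp [symbolCode]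
  omega

section Codec

variable {H : Type} {b : ℕ} (E : H ⊕ Column ≃ Fin (b + 1))

/-- The name of the gate with header `h` and columns `cols`. -/
def gateCode (h : H) (cols : List Column) : List Bool :=
  -- The reversal puts the first column, which is the most significant one, on top of a stack onto
  -- which a parser pushes the columns.
  symbolCode E (.inl h) ++ cols.reverse.flatMap fun c => symbolCode E (.inr c)

theorem gateCode_cons (h : H) (c : Column) (cols : List Column) :
    gateCode E h (c :: cols) = gateCode E h cols ++ symbolCode E (.inr c) := by
  simp [gateCode]

theorem length_gateCode_le (h : H) (cols : List Column) :
    (gateCode E h cols).length ≤ (b + 1) * (cols.length + 1) := by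
  induction cols with
  | nil => simpa [gateCode] using length_symbolCode_le E (.inl h)
  | cons c cols ih =>
    have := length_symbolCode_le E (.inr c)
    rw [gateCode_cons, List.length_append, List.length_cons, mul_add]
    omega

/-- The state of a parser of gate names: `none` after an error, otherwise the number of ones that
have been read since the last zero, and the header (if it has been read). -/
abbrev ParseState (H : Type) (b : ℕ) : Type := Option (Fin (b + 1) × Option H)

/-- A step of the parser; it may return a column. -/
def parseStep : ParseState H b → Bool → ParseState H b × Option Column
  | none, _ => (none, none)
  | some (k, h), true => (if hk : k.1 + 1 < b + 1 then some (⟨k + 1, hk⟩, h) else none, none)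
  | some (k, h), false =>
    match E.symm k, h with
    | .inl h', none => (some (0, some h'), none)
    | .inr c, some h => (some (0, some h), some c)
    | _, _ => (none, none)

/-- A step of the parser that pushes the columns on a stack. -/
def parsePush (P : ParseState H b × List Column) (x : Bool) : ParseState H b × List Column :=
  ((parseStep E P.1 x).1, (parseStep E P.1 x).2.toList ++ P.2)

/-- The state of the parser and the stack after a string has been read. -/
def parse (u : List Bool) : ParseState H b × List Column :=
  u.foldl (parsePush E) (some (0, none), [])

/-- The header, if the parser accepts. -/
def ParseState.done : ParseState H b → Option H
  | some (k, h) => if k = 0 then h else none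
  | none => none

/-- The header and the columns of a gate name. -/
def decodeGate (u : List Bool) : Option (H × List Column) :=
  (parse E u).1.done.map fun h => (h, (parse E u).2)

theorem foldl_parsePush_replicate (k : ℕ) (hk : k < b + 1) (h : Option H) (S : List Column) :
    (List.replicate k true).foldl (parsePush E) (some (0, h), S) = (some (⟨k, hk⟩, h), S) := by
  induction k with
  | zero => rfl
  | succ k ih =>
    rw [List.replicate_succ', List.foldl_append, ih (by omega)]
    simp [parsePush, parseStep, show k < b by omega]

theorem parse_gateCode (h : H) (cols : List Column) :
    parse E (gateCode E h cols) = (some (0, some h), cols) := by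
  induction cols with
  | nil =>
    simp only [parse, gateCode, symbolCode, List.reverse_nil, List.flatMap_nil, List.append_nil,
      List.foldl_append, foldl_parsePush_replicate E _ (E (.inl h)).2]
    simp [parsePush, parseStep]
  | cons c cols ih =>
    rw [parse] at ih ⊢
    simp only [gateCode_cons, List.foldl_append, ih, symbolCode,
      foldl_parsePush_replicate E _ (E (.inr c)).2]
    simp [parsePush, parseStep]

theorem decodeGate_gateCode (h : H) (cols : List Column) :
    decodeGate E (gateCode E h cols) = some (h, cols) := by
  simp [decodeGate, parse_gateCode, ParseState.done]

/-- The parser forgets nothing: what is not on the stack is the header and the current run of ones,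
and both are in its state. -/
theorem eq_of_parse (u : List Bool) (k : Fin (b + 1)) (h : Option H) (S : List Column)
    (hu : parse E u = (some (k, h), S)) :
    match h with
    | none => u = List.replicate k true ∧ S = []
    | some h => u = gateCode E h S ++ List.replicate k true := by
  induction u using List.reverseRecOn generalizing k h S with
  | nil =>
    simp only [parse, List.foldl_nil, Prod.mk.injEq, Option.some.injEq] at hu
    obtain ⟨⟨rfl, rfl⟩, rfl⟩ := hu
    simp
  | append_singleton u x ih =>
    rw [parse, List.foldl_append, ← parse] at hu
    rcases hP : parse E u with ⟨_ | ⟨k', h'⟩, S'⟩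
    · rw [hP] at hu
      simp [parsePush, parseStep] at hu
    · have ih := ih _ _ _ hP
      rw [hP] at hu
      rcases x with _ | _
      · rcases hE : E.symm k' with g | c
        · have hk : k' = E (.inl g) := by rw [← hE, Equiv.apply_symm_apply]
          rcases h' with _ | h'
          · simp [parsePush, parseStep, hE] at hu
            obtain ⟨⟨rfl, rfl⟩, rfl⟩ := hu
            simp only at ih ⊢
            obtain ⟨rfl, rfl⟩ := ih
            simp [gateCode, symbolCode, hk]
          · simp [parsePush, parseStep, hE] at hu
        · have hk : k' = E (.inr c) := by rw [← hE, Equiv.apply_symm_apply]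
          rcases h' with _ | h'
          · simp [parsePush, parseStep, hE] at hu
          · simp [parsePush, parseStep, hE] at hu
            obtain ⟨⟨rfl, rfl⟩, rfl⟩ := hu
            simp only at ih ⊢
            rw [ih, gateCode_cons]
            simp [symbolCode, hk]
      · simp only [List.foldl_cons, List.foldl_nil, parsePush, parseStep] at hu
        split_ifs at hu with hlt
        · simp at hu
          obtain ⟨⟨rfl, rfl⟩, rfl⟩ := hu
          rcases h' with _ | h'
          · simp only at ih ⊢
            rw [ih.1]
            exact ⟨List.replicate_succ'.symm, ih.2⟩
          · simp only at ih ⊢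
            rw [ih, List.append_assoc]
            exact congrArg _ List.replicate_succ'.symm
        · simp at hu

/-- Names are unique, so the machines may compare headers and columns instead of strings. -/
theorem decodeGate_eq_some_iff (u : List Bool) (h : H) (cols : List Column) :
    decodeGate E u = some (h, cols) ↔ u = gateCode E h cols := by
  refine ⟨fun hu => ?_, fun hu => hu ▸ decodeGate_gateCode E h cols⟩
  rcases hP : parse E u with ⟨_ | ⟨k, h'⟩, S⟩
  · simp [decodeGate, hP, ParseState.done] at hu
  · simp only [decodeGate, hP, ParseState.done, Option.map_eq_some_iff] at hu
    obtain ⟨g, hg, hgS⟩ := hu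
    split_ifs at hg with hk
    simp only [Prod.mk.injEq] at hgS
    obtain ⟨rfl, rfl⟩ := hgS
    subst hg hk
    simpa using eq_of_parse E u _ _ _ hP

end Codec

/-! ### Circuits that are described by automata -/

/-- The most significant bit first. -/
def msb (n : ℕ) : List Bool := (Nat.bits n).reverse

theorem length_msb (n : ℕ) : (msb n).length = Nat.size n := by
  simp [msb, Nat.size_eq_bits_len]

/-- The third address in a list of columns. -/
def Column.address (cols : List Column) : ℕ := binaryValue (cols.map fun c => c.2.2.getD false)

/-- The way from the columns of a gate to those of a gate that feeds it. -/
inductive Move where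
  | same
  | child (b : Bool)

/-- Fix the first bit of the third address that is not determined. -/
def Column.child (b : Bool) : List Column → List Column
  | [] => []
  | (s, e, none) :: l => (s, e, some b) :: l
  | (s, e, some a) :: l => (s, e, some a) :: Column.child b l

theorem Column.length_child (b : Bool) (l : List Column) : (Column.child b l).length = l.length := by
  induction l with
  | nil => rfl
  | cons c l ih => rcases c with ⟨s, e, _ | a⟩ <;> simp [Column.child, ih]

/-- The columns after a move. -/
def Move.apply : Move → List Column → List Column
  | .same, l => l
  | .child b, l => Column.child b l

theorem Move.length_apply (m : Move) (l : List Column) : (m.apply l).length = l.length := by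
  cases m
  · rfl
  · exact Column.length_child _ _

/-- The label of a gate, where gates are described relative to the columns of this gate. -/
inductive Shape (H : Type) where
  | const (b : Bool)
  | inp
  | not (u : H × Move)
  | and (u v : H × Move)
  | or (u v : H × Move)

/-- The gates that feed a gate. -/
def Shape.preds {H : Type} : Shape H → List (H × Move)
  | .const _ => []
  | .inp => []
  | .not u => [u]
  | .and u v => [u, v]
  | .or u v => [u, v]

/-- The `w` least significant bits of `m`, the most significant one first. -/
def fixedBits : ℕ → ℕ → List Bool
  | 0, _ => []
  | w + 1, m => fixedBits w (m / 2) ++ [m.bodd]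

theorem length_fixedBits (w m : ℕ) : (fixedBits w m).length = w := by
  induction w generalizing m with
  | zero => rfl
  | succ w ih => simp [fixedBits, ih]

theorem binaryValue_concat (l : List Bool) (b : Bool) :
    binaryValue (l ++ [b]) = 2 * binaryValue l + b.toNat := by
  simp [binaryValue]

theorem binaryValue_fixedBits (w m : ℕ) : binaryValue (fixedBits w m) = m % 2 ^ w := by
  induction w generalizing m with
  | zero => simp [fixedBits, binaryValue, Nat.mod_one]
  | succ w ih =>
    rw [fixedBits, binaryValue_concat, ih, pow_succ', Nat.mod_mul, Nat.mod_two_of_bodd]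
    ring

theorem fixedBits_binaryValue (l : List Bool) : fixedBits l.length (binaryValue l) = l := by
  induction l using List.reverseRecOn with
  | nil => rfl
  | append_singleton l b ih =>
    rw [List.length_append, List.length_singleton, fixedBits, binaryValue_concat]
    have h1 : (2 * binaryValue l + b.toNat) / 2 = binaryValue l := by cases b <;> simp; omega
    have h2 : (2 * binaryValue l + b.toNat).bodd = b := by cases b <;> simp
    rw [h1, h2, ih]

/-- Columns with given first and second addresses, whose third address is not determined. -/
def rootCols (w s e : ℕ) : List Column :=
  List.zipWith (fun a b => (a, b, none)) (fixedBits w s) (fixedBits w e)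

theorem length_rootCols (w s e : ℕ) : (rootCols w s e).length = w := by
  simp [rootCols, length_fixedBits]

/-- A family of circuits whose gates consist of a header and of columns, where the label of a gate
is determined by its header and by the state in which a finite automaton is after it has read the
columns together with the binary representation of the number of inputs. -/
structure Blueprint where
  Header : Type
  Class : Type
  [finite_header : Finite Header]
  [finite_class : Finite Class]
  start : Class
  next : Class → Bool → Column → Class
  shape : Header → Class → Shape Header
  level : Header → List Column → ℕ
  inp_lt : ∀ (n : ℕ) (h : Header) (cols : List Column), cols.length = Nat.size n →
    shape h (((msb n).zip cols).foldl (fun q x => next q x.1 x.2) start) = .inp →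
      Column.address cols < n
  level_lt : ∀ (n : ℕ) (h : Header) (cols : List Column), cols.length = Nat.size n → ∀ u ∈
    (shape h (((msb n).zip cols).foldl (fun q x => next q x.1 x.2) start)).preds,
      level u.1 (u.2.apply cols) < level h cols
  levelConst : ℕ
  level_le : ∀ h cols, level h cols ≤ levelConst * (cols.length + 1)
  rows : ℕ
  digits : ℕ
  rows_pos : 0 < rows
  digits_pos : 0 < digits
  root : Fin rows × Fin digits → Header
  root_injective : Function.Injective root

namespace Blueprint

attribute [instance] finite_header finite_class

variable (B : Blueprint)

/-- The class of the columns of a gate. -/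
def cls (n : ℕ) (cols : List Column) : B.Class :=
  ((msb n).zip cols).foldl (fun q x => B.next q x.1 x.2) B.start

variable {b : ℕ} (E : B.Header ⊕ Column ≃ Fin (b + 1))

/-- The number of output bits. -/
def outLen (n : ℕ) : ℕ := B.digits * (2 ^ Nat.size n * (B.rows * 2 ^ Nat.size n))

theorem size_outLen_le (n : ℕ) :
    Nat.size (B.outLen n) ≤ logBound (Nat.size B.digits + Nat.size B.rows + 2) n := by
  have h1 : B.outLen n <
      2 ^ (Nat.size B.digits + (Nat.size n + (Nat.size B.rows + Nat.size n))) := by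
    simp only [outLen, pow_add]
    have := Nat.lt_size_self B.digits
    have := Nat.lt_size_self B.rows
    gcongr
  refine (Nat.size_le.2 h1).trans ?_
  rw [logBound]
  nlinarith [Nat.zero_le (Nat.size B.digits * Nat.size n), Nat.zero_le (Nat.size B.rows * Nat.size n)]

/-- The header of the `j`-th output gate. -/
def outHeader (n j : ℕ) : B.Header :=
  B.root (⟨j / B.digits / 2 ^ Nat.size n % B.rows, Nat.mod_lt _ B.rows_pos⟩,
    ⟨j % B.digits, Nat.mod_lt _ B.digits_pos⟩)

/-- The columns of the `j`-th output gate. -/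
def outCols (n j : ℕ) : List Column :=
  rootCols (Nat.size n) (j / B.digits % 2 ^ Nat.size n)
    (j / B.digits / 2 ^ Nat.size n / B.rows)

/-- The constant in the bound for the length of the names. -/
def nameConst (_ : B.Header ⊕ Column ≃ Fin (b + 1)) : ℕ :=
  max (b + 1) (Nat.size B.digits + Nat.size B.rows + 2)

theorem length_gateCode_le_logBound {n : ℕ} {h : B.Header} {cols : List Column}
    (hl : cols.length = Nat.size n) :
    (gateCode E h cols).length ≤ logBound (B.nameConst E) n := by
  refine (length_gateCode_le E h cols).trans ?_
  rw [hl]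
  exact Nat.mul_le_mul_right _ (le_max_left _ _)

/-- The gate with a given header and given columns. -/
def gate (n : ℕ) (h : B.Header) (cols : List Column) : GateName (B.nameConst E) n :=
  if hl : (gateCode E h cols).length ≤ logBound (B.nameConst E) n then ⟨gateCode E h cols, hl⟩
  -- A dummy value that does not occur if the number of columns is right, by `gate_val`.
  else ⟨[], Nat.zero_le _⟩

theorem gate_val {n : ℕ} {h : B.Header} {cols : List Column} (hl : cols.length = Nat.size n) :
    (B.gate E n h cols).1 = gateCode E h cols := by
  rw [gate, dif_pos (B.length_gateCode_le_logBound E hl)]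

/-- The label that is described by a shape. -/
def realize (n : ℕ) (cols : List Column) :
    Shape B.Header → GateLabel n (GateName (B.nameConst E) n)
  | .const b => .const b
  -- For the columns of a decoded gate, `inp_lt` rules out the second alternative.
  | .inp => if h : Column.address cols < n then .input ⟨_, h⟩ else .const false
  | .not u => .not (B.gate E n u.1 (u.2.apply cols))
  | .and u v => .and (B.gate E n u.1 (u.2.apply cols)) (B.gate E n v.1 (v.2.apply cols))
  | .or u v => .or (B.gate E n u.1 (u.2.apply cols)) (B.gate E n v.1 (v.2.apply cols))

theorem realize_preds (n : ℕ) (cols : List Column) (s : Shape B.Header) :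
    (B.realize E n cols s).preds = s.preds.map fun u => B.gate E n u.1 (u.2.apply cols) := by
  cases s <;> simp [realize, GateLabel.preds, Shape.preds]
  split_ifs <;> rfl

/-- The header and the columns of a gate, if the number of columns is right. -/
def decode (n : ℕ) (u : List Bool) : Option (B.Header × List Column) :=
  (decodeGate E u).filter fun g => g.2.length = Nat.size n

theorem decode_eq_some_iff (n : ℕ) (u : List Bool) (h : B.Header) (cols : List Column) :
    B.decode E n u = some (h, cols) ↔ u = gateCode E h cols ∧ cols.length = Nat.size n := by
  simp [decode, Option.filter_eq_some_iff, decodeGate_eq_some_iff]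

theorem decode_gate {n : ℕ} (h : B.Header) {cols : List Column}
    (hl : cols.length = Nat.size n) : B.decode E n (B.gate E n h cols).1 = some (h, cols) :=
  (B.decode_eq_some_iff E _ _ _ _).2 ⟨B.gate_val E hl, hl⟩

/-- The label of a gate. -/
def label (n : ℕ) (u : List Bool) : GateLabel n (GateName (B.nameConst E) n) :=
  match B.decode E n u with
  | none => .const false
  | some g => B.realize E n g.2 (B.shape g.1 (B.cls n g.2))

/-- The level of a gate. -/
def gateLevel (n : ℕ) (u : List Bool) : ℕ :=
  match B.decode E n u with
  | none => 0
  | some g => B.level g.1 g.2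

/-- The circuit family that is described by a blueprint. -/
def family : CircuitFamily where
  nameConst := B.nameConst E
  outLen n := B.outLen n
  size_outLen_le n :=
    (B.size_outLen_le n).trans (Nat.mul_le_mul_right _ (le_max_right _ _))
  circuit n :=
    { label := fun u => B.label E n u
      level := fun u => B.gateLevel E n u
      level_lt := by
        intro v u hu
        rw [label] at hu
        rw [gateLevel.eq_1 _ _ _ v.1]
        rcases hd : B.decode E n v with _ | ⟨h, cols⟩
        · simp [hd, GateLabel.preds] at hu
        · simp only [hd, realize_preds, List.mem_map] at hu
          obtain ⟨⟨h', m⟩, hm, rfl⟩ := hu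
          have hl := ((B.decode_eq_some_iff E _ _ _ _).1 hd).2
          rw [gateLevel, B.decode_gate E _ ((m.length_apply cols).trans hl)]
          exact B.level_lt n h cols hl _ hm
      out := fun j => B.gate E n (B.outHeader n j) (B.outCols n j) }

theorem family_logDepth : (B.family E).LogDepth := by
  refine ⟨B.levelConst, fun n v => ?_⟩
  change B.gateLevel E n v ≤ _
  rw [gateLevel]
  rcases hd : B.decode E n v with _ | ⟨h, cols⟩
  · exact Nat.zero_le _
  · have hl := ((B.decode_eq_some_iff E _ _ _ _).1 hd).2
    simpa [logBound, hl] using B.level_le h cols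

end Blueprint

/-! ### The machine that computes the types of gates -/

theorem tupleCode_cons (w : List Bool) (l : List (List Bool)) :
    tupleCode (w :: l) = w.map some ++ none :: tupleCode l := by
  simp [tupleCode]

/-- Put a bit in front of a list of bits, unless this produces a leading zero at the end. -/
def trimPush (l : List Bool) (x : Bool) : List Bool := if l = [] ∧ x = false then [] else x :: l

/-- Addresses have a fixed width, whereas `Nat.bits` has no leading zeros. Pushing the digits from
the top reverses them, and zeros are dropped as long as the stack is empty. -/
theorem foldl_trimPush (l : List Bool) : l.foldl trimPush [] = Nat.bits (binaryValue l) := by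
  induction l using List.reverseRecOn with
  | nil => simp [binaryValue]
  | append_singleton l b ih =>
    rw [List.foldl_append, ih, binaryValue_concat]
    rcases Nat.eq_zero_or_pos (binaryValue l) with h | h
    · cases b <;> simp [h, trimPush]
    · have h1 : Nat.bits (binaryValue l) ≠ [] := by
        rw [← List.length_pos_iff, Nat.size_eq_bits_len]
        exact Nat.size_pos.2 h
      cases b
      · simp [trimPush, h1, Nat.bit0_bits _ h.ne']
      · simp [trimPush, Nat.bit1_bits]

namespace Blueprint

variable (B : Blueprint) {b : ℕ} (E : B.Header ⊕ Column ≃ Fin (b + 1))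

/-- The states of the machine that computes the types of gates. -/
inductive TypeState : Type where
  | readNum
  | readGate (P : ParseState B.Header b)
  | scan (h : Option B.Header) (c : Option B.Class)
  | copy (h : Option B.Header) (c : Option B.Class)
  | emit (h : Option B.Header) (c : Option B.Class)
  | write (l : {l : List Bool // l.length ≤ 4})

instance : Finite (B.TypeState (b := b)) := by
  have : Finite {l : List Bool // l.length ≤ 4} := List.finite_length_le Bool 4
  refine Finite.of_surjective (α := Unit ⊕ ParseState B.Header b ⊕
    (Option B.Header × Option B.Class) ⊕ (Option B.Header × Option B.Class) ⊕
    (Option B.Header × Option B.Class) ⊕ {l : List Bool // l.length ≤ 4})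
    (fun
      | .inl _ => .readNum
      | .inr (.inl P) => .readGate P
      | .inr (.inr (.inl x)) => .scan x.1 x.2
      | .inr (.inr (.inr (.inl x))) => .copy x.1 x.2
      | .inr (.inr (.inr (.inr (.inl x)))) => .emit x.1 x.2
      | .inr (.inr (.inr (.inr (.inr l)))) => .write l) ?_
  rintro (_ | P | ⟨h, c⟩ | ⟨h, c⟩ | ⟨h, c⟩ | l)
  exacts [⟨.inl (), rfl⟩, ⟨.inr (.inl P), rfl⟩, ⟨.inr (.inr (.inl (h, c))), rfl⟩,
    ⟨.inr (.inr (.inr (.inl (h, c)))), rfl⟩, ⟨.inr (.inr (.inr (.inr (.inl (h, c))))), rfl⟩,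
    ⟨.inr (.inr (.inr (.inr (.inr l)))), rfl⟩]

/-- The shape of a gate, given its header and the class of its columns. -/
def shapeOf : Option B.Header → Option B.Class → Shape B.Header
  | some h, some c => B.shape h c
  | _, _ => .const false

/-- The part of the type code of a gate that does not depend on the number of the input bit. -/
def Shape.tag {H : Type} : Shape H → {l : List Bool // l.length ≤ 4}
  | .const c => ⟨[true, false, false, c], by simp⟩
  | .inp => ⟨[false], by simp⟩
  | .not _ => ⟨[true, false, true], by simp⟩
  | .and _ _ => ⟨[true, true, false], by simp⟩
  | .or _ _ => ⟨[true, true, true], by simp⟩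

/-- The tag in reverse order. -/
def Shape.revTag {H : Type} (s : Shape H) : {l : List Bool // l.length ≤ 4} :=
  ⟨(Shape.tag s).1.reverse, by simpa using (Shape.tag s).2⟩

/-- Whether the gate is an input gate. -/
def Shape.isInp {H : Type} : Shape H → Bool
  | .inp => true
  | _ => false

/-- The machine that computes the types of gates. -/
def typeMachine : ColumnMachine where
  State := B.TypeState (b := b)
  start := .readNum
  next
    | .readNum, T => match T .inp with
      | some (some _) => some .readNum
      | _ => some (.readGate (some (0, none)))
    | .readGate P, T => match T .inp with
      | some (some x) => some (.readGate (parseStep E P x).1)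
      | _ => some (.scan P.done (some B.start))
    | .scan h c, T => match T .a, T .b with
      | some x, some y => some (.scan h (c.map fun q => B.next q x y))
      | none, none => some (.copy h c)
      -- The number of columns is wrong; the class is lost, but both stacks are still emptied.
      | _, _ => some (.scan h none)
    | .copy h c, T => match T .d with
      | some _ => some (.copy h c)
      | none => some (.emit h c)
    | .emit h c, T => match T .a with
      | some _ => some (.emit h c)
      | none => some (.write (Shape.revTag (B.shapeOf h c)))
    | .write ⟨[], _⟩, _ => none
    | .write ⟨_ :: l, hl⟩, _ => some (.write ⟨l, Nat.le_of_succ_le hl⟩)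
  op
    | .readNum, T, k => match k, T .inp with
      | .inp, _ => .pop
      | .a, some (some x) => .push x
      | _, _ => .keep
    | .readGate P, T, k => match k, T .inp with
      | .inp, _ => .pop
      | .b, some (some x) => match (parseStep E P x).2 with
        | some y => .push y
        | none => .keep
      | _, _ => .keep
    | .scan _ _, T, k => match k, T .a, T .b with
      | .a, _, _ => .pop
      | .b, _, _ => .pop
      | .d, some _, some y => .push (y.2.2.getD false)
      | _, _, _ => .keep
    | .copy _ _, T, k => match k, T .d with
      | .d, _ => .pop
      | .a, some x => .push x
      | _, _ => .keep
    | .emit h c, T, k => match k, T .a with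
      | .a, _ => .pop
      | .out, some x =>
        if Shape.isInp (B.shapeOf h c) = true ∧ ¬(T .out = none ∧ x = false) then .push x else .keep
      | _, _ => .keep
    | .write ⟨[], _⟩, _, _ => .keep
    | .write ⟨x :: _, _⟩, _, k => match k with
      | .out => .push x
      | _ => .keep

open ColumnMachine

section TypeMachine

variable {B} {z : (B.typeMachine E).Config} {t : ℕ}

theorem typeMachine_readNum (l : List Bool) (r o a b c d e)
    (h : (B.typeMachine E).Reach t (some (.readGate (some (0, none))),
      tapes r o (l.reverse ++ a) b c d e) z) :
    (B.typeMachine E).Reach (t + (l.length + 1))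
      (some .readNum, tapes (l.map some ++ none :: r) o a b c d e) z := by
  induction l generalizing a with
  | nil => exact reach_head rfl (by rintro ⟨⟩ <;> rfl) h
  | cons x l ih =>
    exact reach_head rfl (by rintro ⟨⟩ <;> rfl) (ih (x :: a) (by simpa using h))

theorem typeMachine_readGate (l : List Bool) (P : ParseState B.Header b) (S r o a c d e)
    (h : (B.typeMachine E).Reach t (some (.scan (l.foldl (parsePush E) (P, S)).1.done
      (some B.start)), tapes r o a (l.foldl (parsePush E) (P, S)).2 c d e) z) :
    (B.typeMachine E).Reach (t + (l.length + 1))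
      (some (.readGate P), tapes (l.map some ++ none :: r) o a S c d e) z := by
  induction l generalizing P S with
  | nil => exact reach_head rfl (by rintro ⟨⟩ <;> rfl) h
  | cons x l ih =>
    refine reach_head rfl (b' := (parsePush E (P, S) x).2) ?_ (ih _ _ h)
    rintro ⟨⟩ <;> try rfl
    simp only [typeMachine, tapes, parsePush, List.map_cons, List.cons_append, List.head?_cons]
    cases (parseStep E P x).2 <;> rfl

/-- The class of columns, or `none` if their number is not the right one. -/
def scanClass (c : Option B.Class) (A : List Bool) (S : List Column) : Option B.Class :=
  if A.length = S.length then c.map fun q => (A.zip S).foldl (fun q x => B.next q x.1 x.2) q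
  else none

/-- If the lengths differ, the class is `none` and the contents of `d'` are irrelevant; only the
bound on its length is kept, for the running time. -/
theorem typeMachine_scan (h : Option B.Header) (c : Option B.Class) (A : List Bool)
    (S : List Column) (r o c' d e)
    (H : ∀ d', (A.length = S.length →
        d' = (S.map fun y => y.2.2.getD false).reverse ++ d) →
      d'.length ≤ d.length + S.length →
      (B.typeMachine E).Reach t (some (.copy h (scanClass c A S)), tapes r o [] [] c' d' e) z) :
    (B.typeMachine E).Reach (t + (A.length + S.length + 1))
      (some (.scan h c), tapes r o A S c' d e) z := by
  induction A generalizing S c d with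
  | nil =>
    induction S generalizing c with
    | nil =>
      have := H d (by simp) le_rfl
      simp only [scanClass, List.zip_nil_left, List.foldl_nil, Option.map_id'] at this
      exact reach_head rfl (by rintro ⟨⟩ <;> rfl) this
    | cons y S ih =>
      refine reach_head rfl (by rintro ⟨⟩ <;> rfl) (ih none fun d' _ h2 => ?_)
      have := H d' (by simp) (h2.trans (by simp))
      simpa [scanClass] using this
  | cons x A ih =>
    cases S with
    | nil =>
      refine (reach_head rfl (by rintro ⟨⟩ <;> rfl) (ih none [] d fun d' _ h2 => ?_)).mono
        (by simp only [List.length_cons, List.length_nil]; omega)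
      have := H d' (by simp) h2
      simpa [scanClass] using this
    | cons y S =>
      refine (reach_head rfl (by rintro ⟨⟩ <;> rfl) (ih (c.map fun q => B.next q x y) S
        (y.2.2.getD false :: d) fun d' h1 h2 => ?_)).mono (by simp; omega)
      have := H d' (fun hl => by
        rw [h1 (by simpa using hl)]; simp) (by simp at h2 ⊢; omega)
      simpa [scanClass, Function.comp_def] using this

theorem typeMachine_copy (h : Option B.Header) (c : Option B.Class) (r o a b' c' d e)
    (H : (B.typeMachine E).Reach t (some (.emit h c), tapes r o (d.reverse ++ a) b' c' [] e) z) :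
    (B.typeMachine E).Reach (t + (d.length + 1)) (some (.copy h c), tapes r o a b' c' d e) z := by
  induction d generalizing a with
  | nil => exact reach_head rfl (by rintro ⟨⟩ <;> rfl) H
  | cons x l ih =>
    exact reach_head rfl (by rintro ⟨⟩ <;> rfl) (ih (x :: a) (by simpa using H))

theorem typeMachine_emit (h : Option B.Header) (c : Option B.Class) (r o a b' c' d e)
    (H : (B.typeMachine E).Reach t (some (.write (Shape.revTag (B.shapeOf h c))),
      tapes r (if Shape.isInp (B.shapeOf h c) then a.foldl trimPush o else o) [] b' c' d e) z) :
    (B.typeMachine E).Reach (t + (a.length + 1)) (some (.emit h c), tapes r o a b' c' d e) z := by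
  induction a generalizing o with
  | nil =>
    rw [List.foldl_nil, ite_self] at H
    exact reach_head rfl (by rintro ⟨⟩ <;> rfl) H
  | cons x l ih =>
    refine reach_head rfl (o' := if Shape.isInp (B.shapeOf h c) then trimPush o x else o) ?_
      (ih _ ?_)
    · rintro ⟨⟩ <;> try rfl
      rcases o with _ | ⟨y, o⟩ <;> rcases x with _ | _ <;>
      by_cases hs : Shape.isInp (B.shapeOf h c) = true <;>
      simp [typeMachine, tapes, hs, trimPush, StackOp.apply]
    · by_cases hs : Shape.isInp (B.shapeOf h c) = true <;> simpa [hs] using H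

theorem typeMachine_write (l : List Bool) (hl : l.length ≤ 4) (r o a b' c' d e)
    (H : (B.typeMachine E).Reach t (none, tapes r (l.reverse ++ o) a b' c' d e) z) :
    (B.typeMachine E).Reach (t + (l.length + 1))
      (some (.write ⟨l, hl⟩), tapes r o a b' c' d e) z := by
  induction l generalizing o with
  | nil => exact reach_head rfl (by rintro ⟨⟩ <;> rfl) H
  | cons x l ih =>
    exact reach_head rfl (by rintro ⟨⟩ <;> rfl) (ih _ (x :: o) (by simpa using H))

theorem length_parse_le (u : List Bool) : (parse E u).2.length ≤ u.length := by
  induction u using List.reverseRecOn with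
  | nil => simp [parse]
  | append_singleton u x ih =>
    rw [parse, List.foldl_append, ← parse]
    simp only [List.foldl_cons, List.foldl_nil, parsePush, List.length_append,
      List.length_singleton]
    have : (parseStep E (parse E u).1 x).2.toList.length ≤ 1 := by
      cases (parseStep E (parse E u).1 x).2 <;> simp
    omega

end TypeMachine

/-- A missing header or class signals an invalid name, and such names belong to dummy gates with the
constant `false`. -/
theorem shapeOf_eq (n : ℕ) (u : List Bool) :
    B.shapeOf (parse E u).1.done (scanClass (some B.start) (msb n) (parse E u).2) =
      match B.decode E n u with
      | none => .const false
      | some g => B.shape g.1 (B.cls n g.2) := by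
  rw [decode, decodeGate]
  rcases (parse E u).1.done with _ | h
  · rfl
  · rw [scanClass, length_msb]
    by_cases hl : (parse E u).2.length = Nat.size n
    · simp [hl, shapeOf, cls, Option.filter]
    · simp [hl, Ne.symm hl, shapeOf, Option.filter]

/-- Splits the type code into a tag from a finite set, which the machine holds in its state, and the
number of an input bit, which it copies from the third address. -/
theorem typeCode_label (n : ℕ) (u : List Bool) :
    (B.label E n u).typeCode =
      (Shape.tag (B.shapeOf (parse E u).1.done
        (scanClass (some B.start) (msb n) (parse E u).2))).1 ++
      if Shape.isInp (B.shapeOf (parse E u).1.done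
        (scanClass (some B.start) (msb n) (parse E u).2)) then
          Nat.bits (Column.address (parse E u).2) else [] := by
  rw [shapeOf_eq, label]
  rcases hd : B.decode E n u with _ | ⟨h, cols⟩
  · simp [GateLabel.typeCode, Shape.tag, Shape.isInp]
  · have hd' := (B.decode_eq_some_iff E _ _ _ _).1 hd
    have hinp := B.inp_lt n h cols hd'.2
    change B.shape h (B.cls n cols) = .inp → _ at hinp
    simp only [hd'.1, parse_gateCode]
    generalize B.shape h (B.cls n cols) = s at hinp ⊢
    rcases s with c | _ | _ | _ | _
    · cases c <;> simp [realize, GateLabel.typeCode, Shape.tag, Shape.isInp]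
    · simp [realize, hinp rfl, GateLabel.typeCode, Shape.tag, Shape.isInp]
    all_goals simp [realize, GateLabel.typeCode, Shape.tag, Shape.isInp]

theorem typeMachine_outputsWithin (n : ℕ) (u : List Bool) :
    (B.typeMachine E).Reach (4 * (Nat.size n + u.length) + 15)
      (some (B.typeMachine E).start, tapes (tupleCode [Nat.bits n, u]) [] [] [] [] [] [])
      (none, tapes [] (B.label E n u).typeCode [] [] [] [] []) := by
  have key : ∀ d', ((Nat.bits n).reverse.length = (parse E u).2.length →
        d' = ((parse E u).2.map fun y => y.2.2.getD false).reverse) →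
      d'.length ≤ (parse E u).2.length →
      (B.typeMachine E).Reach (u.length + u.length + 8) (some (.copy (parse E u).1.done
        (scanClass (some B.start) (msb n) (parse E u).2)), tapes [] [] [] [] [] d' [])
      (none, tapes [] (B.label E n u).typeCode [] [] [] [] []) := by
    intro d' h1 h2
    have hl := length_parse_le E u
    refine (typeMachine_copy E _ _ _ _ _ _ _ _ _ <| typeMachine_emit E _ _ _ _ _ _ _ _ _ <|
      typeMachine_write E _ (Shape.revTag _).2 _ _ _ _ _ _ _ ?_).mono
        (t := 0 + ((Shape.revTag (B.shapeOf (parse E u).1.done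
          (scanClass (some B.start) (msb n) (parse E u).2))).1.length + 1) +
          ((d'.reverse ++ []).length + 1) + (d'.length + 1)) ?_
    · rw [typeCode_label]
      have : ∀ s : Shape B.Header, (Shape.revTag s).1.reverse = (Shape.tag s).1 := fun s => by
        simp [Shape.revTag]
      rw [this]
      split_ifs with hs
      · have hlen : (Nat.bits n).reverse.length = (parse E u).2.length := by
          by_contra hne
          have h0 : scanClass (some B.start) (msb n) (parse E u).2 = none := if_neg hne
          rw [h0] at hs
          cases hh : (parse E u).1.done <;> simp [hh, shapeOf, Shape.isInp] at hs
        rw [h1 hlen, List.reverse_reverse, List.append_nil, foldl_trimPush, ← Column.address]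
        exact .refl _ _
      · exact .refl _ _
    · have := (Shape.revTag (B.shapeOf (parse E u).1.done
          (scanClass (some B.start) (msb n) (parse E u).2))).2
      simp
      omega
  rw [tupleCode_cons, tupleCode_cons]
  rw [msb, ← List.append_nil (Nat.bits n).reverse] at key
  refine (typeMachine_readNum E _ _ _ _ _ _ _ _ <| typeMachine_readGate E _ _ _ _ _ _ _ _ _ <|
    typeMachine_scan E _ _ _ _ _ _ _ _ _ fun d' h1 h2 => key d' (by simpa [parse] using h1)
      (by simpa [parse] using h2)).mono ?_
  have := length_parse_le E u
  simp only [parse] at this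
  simp [Nat.size_eq_bits_len]
  omega

end Blueprint

/-! ### The machine that decides which gates feed a gate -/

/-- A step of the comparison of the columns of two gates. The states are `some true` (the columns
are equal so far and the next bit that is not determined has to be fixed to be `b`), `some false`
(the remaining columns have to be equal), and `none` (failure). -/
def trackStep (b : Bool) : Option Bool → Column → Column → Option Bool
  | none, _, _ => none
  | some false, u, v => if u = v then some false else none
  | some true, u, (s, e, none) => if u = (s, e, some b) then some false else none
  | some true, u, (s, e, some a) => if u = (s, e, some a) then some true else none

theorem foldl_trackStep_none (b : Bool) (l : List (Column × Column)) :
    l.foldl (fun q x => trackStep b q x.1 x.2) none = none := by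
  induction l with
  | nil => rfl
  | cons x l ih => simpa [trackStep] using ih

theorem foldl_trackStep_false (b : Bool) (U V : List Column) (h : U.length = V.length) :
    ((U.zip V).foldl (fun q x => trackStep b q x.1 x.2) (some false)).isSome ↔ U = V := by
  induction U generalizing V with
  | nil => cases V <;> simp_all
  | cons u U ih =>
    cases V with
    | nil => simp at h
    | cons v V =>
      rw [List.zip_cons_cons, List.foldl_cons, List.cons.injEq]
      change (List.foldl _ (if u = v then some false else none) _).isSome = true ↔ _
      split_ifs with huv
      · simpa [huv] using ih V (by simpa using h)
      · simp [huv, foldl_trackStep_none]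

/-- Once the open bit has been fixed, the remaining columns must agree, which is the state `some
false`. A run that ends in `some true` has met no open bit, and then `Column.child` changes nothing.
-/
theorem foldl_trackStep_true (b : Bool) (U V : List Column) (h : U.length = V.length) :
    ((U.zip V).foldl (fun q x => trackStep b q x.1 x.2) (some true)).isSome ↔
      U = Column.child b V := by
  induction U generalizing V with
  | nil => cases V <;> simp_all [Column.child]
  | cons u U ih =>
    rcases V with _ | ⟨⟨s, e, _ | a⟩, V⟩
    · simp at h
    · rw [List.zip_cons_cons, List.foldl_cons, Column.child, List.cons.injEq]
      change (List.foldl _ (if u = (s, e, some b) then some false else none) _).isSome = true ↔ _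
      split_ifs with huv
      · simpa [huv] using foldl_trackStep_false b U V (by simpa using h)
      · simp [huv, foldl_trackStep_none]
    · rw [List.zip_cons_cons, List.foldl_cons, Column.child, List.cons.injEq]
      change (List.foldl _ (if u = (s, e, some a) then some true else none) _).isSome = true ↔ _
      split_ifs with huv
      · simpa [huv] using ih V (by simpa using h)
      · simp [huv, foldl_trackStep_none]

namespace Blueprint

variable (B : Blueprint) {b : ℕ} (E : B.Header ⊕ Column ≃ Fin (b + 1))

/-- The class of the columns of a gate, and the states of the comparisons of its columns with those
of another gate for the three moves. -/
abbrev Tracks : Type := B.Class × Option Bool × Option Bool × Option Bool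

/-- The states of the machine that decides which gates feed a gate. -/
inductive PredState : Type where
  | readNum
  | readFst (P : ParseState B.Header b)
  | readSnd (hu : Option B.Header) (P : ParseState B.Header b)
  | readIdx (hu hv : Option B.Header) (i : Option Bool)
  | scan (hu hv : Option B.Header) (i : Option Bool) (c : Option B.Tracks)

instance : Finite (B.PredState (b := b)) := by
  refine Finite.of_surjective (α := Unit ⊕ ParseState B.Header b ⊕
    (Option B.Header × ParseState B.Header b) ⊕
    (Option B.Header × Option B.Header × Option Bool) ⊕
    (Option B.Header × Option B.Header × Option Bool × Option B.Tracks))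
    (fun
      | .inl _ => .readNum
      | .inr (.inl P) => .readFst P
      | .inr (.inr (.inl x)) => .readSnd x.1 x.2
      | .inr (.inr (.inr (.inl x))) => .readIdx x.1 x.2.1 x.2.2
      | .inr (.inr (.inr (.inr x))) => .scan x.1 x.2.1 x.2.2.1 x.2.2.2) ?_
  rintro (_ | P | ⟨hu, P⟩ | ⟨hu, hv, i⟩ | ⟨hu, hv, i, c⟩)
  exacts [⟨.inl (), rfl⟩, ⟨.inr (.inl P), rfl⟩, ⟨.inr (.inr (.inl (hu, P))), rfl⟩,
    ⟨.inr (.inr (.inr (.inl (hu, hv, i)))), rfl⟩,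
    ⟨.inr (.inr (.inr (.inr (hu, hv, i, c)))), rfl⟩]

/-- A step of the computation of the tracks. -/
def tracksStep (q : B.Tracks) (x : Bool) (u v : Column) : B.Tracks :=
  (B.next q.1 x v, trackStep true q.2.1 u v, trackStep false q.2.2.1 u v,
    trackStep true q.2.2.2 u v)

/-- The result of the comparison for a move. -/
def Tracks.holds (q : B.Tracks) : Move → Bool
  | .same => q.2.1.isSome
  | .child false => q.2.2.1.isSome
  | .child true => q.2.2.2.isSome

/-- A step of reading an index; `some false` and `some true` stand for `0` and `1`, and `none` for
all other numbers. -/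
def idxStep : Option Bool → Bool → Option Bool
  | some false, true => some true
  | _, _ => none

/-- The index, where all numbers apart from `0` and `1` are represented by `2`. -/
def idxValue : Option Bool → ℕ
  | some false => 0
  | some true => 1
  | none => 2

open scoped Classical in
/-- The decision whether a gate feeds another one. -/
noncomputable def predAnswer (hu hv : Option B.Header) (i : Option Bool) (c : Option B.Tracks) :
    Bool :=
  decide (∃ h h' q m, hu = some h ∧ hv = some h' ∧ c = some q ∧
    (B.shape h' q.1).preds[idxValue i]? = some (h, m) ∧ Tracks.holds B q m = true)

/-- The machine that decides which gates feed a gate. -/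
noncomputable def predMachine : ColumnMachine where
  State := B.PredState (b := b)
  start := .readNum
  next
    | .readNum, T => match T .inp with
      | some (some _) => some .readNum
      | _ => some (.readFst (some (0, none)))
    | .readFst P, T => match T .inp with
      | some (some x) => some (.readFst (parseStep E P x).1)
      | _ => some (.readSnd P.done (some (0, none)))
    | .readSnd hu P, T => match T .inp with
      | some (some x) => some (.readSnd hu (parseStep E P x).1)
      | _ => some (.readIdx hu P.done (some false))
    | .readIdx hu hv i, T => match T .inp with
      | some (some x) => some (.readIdx hu hv (idxStep i x))
      | _ => some (.scan hu hv i (some (B.start, some false, some true, some true)))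
    | .scan hu hv i c, T => match T .a, T .b, T .c with
      | some x, some u, some v => some (.scan hu hv i (c.map fun q => B.tracksStep q x u v))
      | none, none, none => none
      | _, _, _ => some (.scan hu hv i none)
  op
    | .readNum, T, k => match k, T .inp with
      | .inp, _ => .pop
      | .a, some (some x) => .push x
      | _, _ => .keep
    | .readFst P, T, k => match k, T .inp with
      | .inp, _ => .pop
      | .b, some (some x) => match (parseStep E P x).2 with
        | some y => .push y
        | none => .keep
      | _, _ => .keep
    | .readSnd _ P, T, k => match k, T .inp with
      | .inp, _ => .pop
      | .c, some (some x) => match (parseStep E P x).2 with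
        | some y => .push y
        | none => .keep
      | _, _ => .keep
    | .readIdx _ _ _, _, k => match k with
      | .inp => .pop
      | _ => .keep
    | .scan hu hv i c, T, k => match k, T .a, T .b, T .c with
      | .a, _, _, _ => .pop
      | .b, _, _, _ => .pop
      | .c, _, _, _ => .pop
      | .out, none, none, none => .push (B.predAnswer hu hv i c)
      | _, _, _, _ => .keep

open ColumnMachine

section PredMachine

variable {B} {z : (B.predMachine E).Config} {t : ℕ}

theorem predMachine_readNum (l : List Bool) (r o a b c d e)
    (h : (B.predMachine E).Reach t (some (.readFst (some (0, none))),
      tapes r o (l.reverse ++ a) b c d e) z) :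
    (B.predMachine E).Reach (t + (l.length + 1))
      (some .readNum, tapes (l.map some ++ none :: r) o a b c d e) z := by
  induction l generalizing a with
  | nil => exact reach_head rfl (by rintro ⟨⟩ <;> rfl) h
  | cons x l ih =>
    exact reach_head rfl (by rintro ⟨⟩ <;> rfl) (ih (x :: a) (by simpa using h))

theorem predMachine_readFst (l : List Bool) (P : ParseState B.Header b) (S r o a c d e)
    (h : (B.predMachine E).Reach t (some (.readSnd (l.foldl (parsePush E) (P, S)).1.done
      (some (0, none))), tapes r o a (l.foldl (parsePush E) (P, S)).2 c d e) z) :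
    (B.predMachine E).Reach (t + (l.length + 1))
      (some (.readFst P), tapes (l.map some ++ none :: r) o a S c d e) z := by
  induction l generalizing P S with
  | nil => exact reach_head rfl (by rintro ⟨⟩ <;> rfl) h
  | cons x l ih =>
    refine reach_head rfl (b' := (parsePush E (P, S) x).2) ?_ (ih _ _ h)
    rintro ⟨⟩ <;> try rfl
    simp only [predMachine, tapes, parsePush, List.map_cons, List.cons_append, List.head?_cons]
    cases (parseStep E P x).2 <;> rfl

theorem predMachine_readSnd (hu : Option B.Header) (l : List Bool) (P : ParseState B.Header b)
    (S r o a b' d e)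
    (h : (B.predMachine E).Reach t (some (.readIdx hu (l.foldl (parsePush E) (P, S)).1.done
      (some false)), tapes r o a b' (l.foldl (parsePush E) (P, S)).2 d e) z) :
    (B.predMachine E).Reach (t + (l.length + 1))
      (some (.readSnd hu P), tapes (l.map some ++ none :: r) o a b' S d e) z := by
  induction l generalizing P S with
  | nil => exact reach_head rfl (by rintro ⟨⟩ <;> rfl) h
  | cons x l ih =>
    refine reach_head rfl (c' := (parsePush E (P, S) x).2) ?_ (ih _ _ h)
    rintro ⟨⟩ <;> try rfl
    simp only [predMachine, tapes, parsePush, List.map_cons, List.cons_append, List.head?_cons]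
    cases (parseStep E P x).2 <;> rfl

theorem predMachine_readIdx (hu hv : Option B.Header) (l : List Bool) (i : Option Bool)
    (r o a b' c d e)
    (h : (B.predMachine E).Reach t (some (.scan hu hv (l.foldl idxStep i)
      (some (B.start, some false, some true, some true))), tapes r o a b' c d e) z) :
    (B.predMachine E).Reach (t + (l.length + 1))
      (some (.readIdx hu hv i), tapes (l.map some ++ none :: r) o a b' c d e) z := by
  induction l generalizing i with
  | nil => exact reach_head rfl (by rintro ⟨⟩ <;> rfl) h
  | cons x l ih => exact reach_head rfl (by rintro ⟨⟩ <;> rfl) (ih _ h)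

/-- The tracks of three lists, or `none` if the lengths of the lists differ. -/
def scanTracks (q : Option B.Tracks) (A : List Bool) (U V : List Column) : Option B.Tracks :=
  if A.length = U.length ∧ A.length = V.length then
    q.map fun q => (A.zip (U.zip V)).foldl (fun q x => B.tracksStep q x.1 x.2.1 x.2.2) q
  else none

/-- After an error the three stacks, of height at most `k`, are merely emptied. -/
theorem predMachine_scan_none (hu hv : Option B.Header) (i : Option Bool) (k : ℕ) (A : List Bool)
    (U V : List Column) (hA : A.length ≤ k) (hU : U.length ≤ k) (hV : V.length ≤ k) :
    (B.predMachine E).Reach (k + 1) (some (.scan hu hv i none), tapes [] [] A U V [] [])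
      (none, tapes [] [B.predAnswer hu hv i none] [] [] [] [] []) := by
  induction k generalizing A U V with
  | zero =>
    simp only [Nat.le_zero, List.length_eq_zero_iff] at hA hU hV
    subst hA hU hV
    exact reach_head rfl (by rintro ⟨⟩ <;> rfl) (.refl 0 _)
  | succ k ih =>
    by_cases h0 : A = [] ∧ U = [] ∧ V = []
    · obtain ⟨rfl, rfl, rfl⟩ := h0
      exact (ih [] [] [] (by simp) (by simp) (by simp)).mono (by omega)
    · refine reach_head ?_ ?_ (ih A.tail U.tail V.tail (by simpa using hA) (by simpa using hU)
        (by simpa using hV)) <;>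
      rcases A with _ | ⟨x, A⟩ <;> rcases U with _ | ⟨u, U⟩ <;> rcases V with _ | ⟨v, V⟩ <;>
        first | (exact absurd ⟨rfl, rfl, rfl⟩ h0) | rfl | (rintro ⟨⟩ <;> rfl)

theorem predMachine_scan (hu hv : Option B.Header) (i : Option Bool) (q : Option B.Tracks)
    (A : List Bool) (U V : List Column) :
    (B.predMachine E).Reach (A.length + U.length + V.length + 1)
      (some (.scan hu hv i q), tapes [] [] A U V [] [])
      (none, tapes [] [B.predAnswer hu hv i (scanTracks q A U V)] [] [] [] [] []) := by
  induction A generalizing U V q with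
  | nil =>
    by_cases h0 : U = [] ∧ V = []
    · obtain ⟨rfl, rfl⟩ := h0
      have h1 : scanTracks q [] [] [] = q := by simp [scanTracks]
      rw [h1]
      exact reach_head rfl (by rintro ⟨⟩ <;> rfl) (.refl 0 _)
    · have h1 : scanTracks q [] U V = none := by
        refine if_neg fun h => h0 ?_
        simpa [eq_comm, List.length_eq_zero_iff] using h
      rw [h1]
      have := predMachine_scan_none E hu hv i (U.tail.length + V.tail.length) [] U.tail V.tail
        (by simp) (by omega) (by omega)
      rcases U with _ | ⟨u, U⟩ <;> rcases V with _ | ⟨v, V⟩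
      · exact absurd ⟨rfl, rfl⟩ h0
      all_goals
        refine (reach_head rfl (by rintro ⟨⟩ <;> rfl) this).mono ?_
        simp only [List.length_cons, List.length_nil, List.tail_cons, List.tail_nil]
        omega
  | cons x A ih =>
    rcases U with _ | ⟨u, U⟩
    · have h1 : scanTracks q (x :: A) [] V = none := if_neg (by simp)
      rw [h1]
      have := predMachine_scan_none E hu hv i (A.length + V.tail.length) A [] V.tail
        (by omega) (by simp) (by omega)
      rcases V with _ | ⟨v, V⟩
      all_goals
        refine (reach_head rfl (by rintro ⟨⟩ <;> rfl) this).mono ?_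
        simp only [List.length_cons, List.length_nil, List.tail_cons, List.tail_nil]
        omega
    · rcases V with _ | ⟨v, V⟩
      · have h1 : scanTracks q (x :: A) (u :: U) [] = none := if_neg (by simp)
        rw [h1]
        have := predMachine_scan_none E hu hv i (A.length + U.length) A U []
          (by omega) (by omega) (by simp)
        refine (reach_head rfl (by rintro ⟨⟩ <;> rfl) this).mono ?_
        simp only [List.length_cons, List.length_nil]
        omega
      · have h1 : scanTracks q (x :: A) (u :: U) (v :: V) =
            scanTracks (q.map fun q => B.tracksStep q x u v) A U V := by
          simp [scanTracks, Function.comp_def]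
        rw [h1]
        refine (reach_head rfl (by rintro ⟨⟩ <;> rfl) (ih _ U V)).mono ?_
        simp only [List.length_cons]
        omega

end PredMachine

theorem foldl_tracksStep (A : List Bool) (U V : List Column) (hU : A.length = U.length)
    (hV : A.length = V.length) (q : B.Tracks) :
    (A.zip (U.zip V)).foldl (fun q x => B.tracksStep q x.1 x.2.1 x.2.2) q =
      ((A.zip V).foldl (fun q x => B.next q x.1 x.2) q.1,
        (U.zip V).foldl (fun q x => trackStep true q x.1 x.2) q.2.1,
        (U.zip V).foldl (fun q x => trackStep false q x.1 x.2) q.2.2.1,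
        (U.zip V).foldl (fun q x => trackStep true q x.1 x.2) q.2.2.2) := by
  induction A generalizing U V q with
  | nil =>
    cases U <;> cases V <;> simp_all
  | cons x A ih =>
    rcases U with _ | ⟨u, U⟩
    · simp at hU
    rcases V with _ | ⟨v, V⟩
    · simp at hV
    simp only [List.zip_cons_cons, List.foldl_cons]
    rw [ih U V (by simpa using hU) (by simpa using hV)]
    rfl

/-- `Nat.bits` is empty for `0` and `[true]` for `1`. All other numbers may be confused, since no
gate has more than two inputs. -/
theorem foldl_idxStep_bits (i k : ℕ) (hk : k < 2) :
    idxValue ((Nat.bits i).foldl idxStep (some false)) = k ↔ i = k := by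
  have hnone : ∀ l : List Bool, l.foldl idxStep none = none := fun l => by
    induction l with
    | nil => rfl
    | cons x l ih => simpa [idxStep] using ih
  rcases i with _ | _ | i
  · simp [idxValue]
  · simp [idxValue, idxStep]
  · obtain ⟨m, hm⟩ : ∃ m, m = i + 1 + 1 := ⟨_, rfl⟩
    rw [← hm]
    have hm2 : 2 ≤ m := by omega
    clear hm
    have h : idxValue ((Nat.bits m).foldl idxStep (some false)) = 2 := by
      have h1 := Nat.bodd_add_div2 m
      have h2 : Nat.bits m = m.bodd :: Nat.bits (m.div2) := by
        conv_lhs => rw [← Nat.bit_bodd_div2 m]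
        rw [Nat.bits_append_bit]
        intro h
        cases hb : m.bodd <;> simp_all <;> omega
      have h3 : Nat.bits (m.div2) ≠ [] := by
        rw [← List.length_pos_iff, Nat.size_eq_bits_len, Nat.size_pos]
        rcases hb : m.bodd <;> rw [hb] at h1 <;> simp only [Bool.toNat_true, Bool.toNat_false] at h1 <;> omega
      rw [h2]
      rcases hb : Nat.bits (m.div2) with _ | ⟨y, l⟩
      · exact absurd hb h3
      · cases m.bodd <;> simp [idxStep, hnone, idxValue]
    rw [h]
    omega

/-- Because names are unique, `u` is the gate described by an entry `(h, m)` of the shape of `v` if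
and only if its header is `h` and its columns are those of `v` after the move `m`. The finitely many
moves are tested simultaneously. -/
theorem predAnswer_eq (n : ℕ) (u v : List Bool) (hu : u.length ≤ logBound (B.nameConst E) n)
    (i : ℕ) :
    B.predAnswer (parse E u).1.done (parse E v).1.done ((Nat.bits i).foldl idxStep (some false))
      (scanTracks (some (B.start, some false, some true, some true)) (msb n) (parse E u).2
        (parse E v).2) =
    decide ((B.label E n v).preds[i]? = some ⟨u, hu⟩) := by
  rw [predAnswer, decide_eq_decide, label]
  by_cases hv : ∃ g, B.decode E n v = some g
  · obtain ⟨⟨h', V⟩, hd⟩ := hv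
    obtain ⟨rfl, hV⟩ := (B.decode_eq_some_iff E _ _ _ _).1 hd
    simp only [hd, realize_preds, List.getElem?_map, Option.map_eq_some_iff, parse_gateCode]
    have hlen : (B.shape h' (B.cls n V)).preds.length ≤ 2 := by
      cases B.shape h' (B.cls n V) <;> simp [Shape.preds]
    have hidx : ∀ x, (B.shape h' (B.cls n V)).preds[idxValue
          ((Nat.bits i).foldl idxStep (some false))]? = some x ↔
        (B.shape h' (B.cls n V)).preds[i]? = some x := by
      intro x
      by_cases hi : i < 2
      · rw [(foldl_idxStep_bits i i hi).2 rfl]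
      · have h2 : 2 ≤ idxValue ((Nat.bits i).foldl idxStep (some false)) := by
          by_contra hlt
          exact hi ((foldl_idxStep_bits i _ (not_le.1 hlt)).1 rfl ▸ not_le.1 hlt)
        rw [List.getElem?_eq_none (hlen.trans h2),
          List.getElem?_eq_none (hlen.trans (not_lt.1 hi))]
    have htr : ∀ U : List Column, U.length = Nat.size n → ∃ q : B.Tracks,
        scanTracks (some (B.start, some false, some true, some true)) (msb n) U V = some q ∧
        q.1 = B.cls n V ∧ ∀ m : Move, Tracks.holds B q m = true ↔ U = m.apply V := by
      intro U hU
      rw [scanTracks, if_pos ⟨(length_msb n).trans hU.symm, (length_msb n).trans hV.symm⟩]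
      refine ⟨_, rfl, ?_⟩
      beta_reduce
      rw [foldl_tracksStep B _ _ _ ((length_msb n).trans hU.symm) ((length_msb n).trans hV.symm)]
      refine ⟨rfl, ?_⟩
      have hUV := hU.trans hV.symm
      rintro (_ | _ | _)
      · exact foldl_trackStep_false _ _ _ hUV
      · exact foldl_trackStep_true _ _ _ hUV
      · exact foldl_trackStep_true _ _ _ hUV
    constructor
    · rintro ⟨h, g, q, m, hh, hg, hq, hp, hm⟩
      have hg : h' = g := by simpa [ParseState.done] using hg
      subst hg
      have hU : (parse E u).2.length = Nat.size n := by
        by_contra hne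
        rw [scanTracks, if_neg fun h => hne (h.1.symm.trans (length_msb n))] at hq
        cases hq
      obtain ⟨q', hq', hc, hm'⟩ := htr _ hU
      obtain rfl := Option.some_injective _ (hq.symm.trans hq')
      rw [hc, hidx] at hp
      refine ⟨(h, m), hp, ?_⟩
      have hde : decodeGate E u = some (h, m.apply V) := by
        rw [decodeGate, hh, ← (hm' m).1 hm]; rfl
      refine Subtype.ext ?_
      rw [gate_val _ _ ((m.length_apply V).trans hV)]
      exact ((decodeGate_eq_some_iff E _ _ _).1 hde).symm
    · rintro ⟨⟨h, m⟩, hp, hm⟩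
      have hu' : u = gateCode E h (m.apply V) := by
        rw [← gate_val _ _ ((m.length_apply V).trans hV), hm]
      obtain ⟨q, hq, hc, hm'⟩ := htr _ ((m.length_apply V).trans hV)
      refine ⟨h, h', q, m, ?_, ?_, ?_, ?_, (hm' m).2 rfl⟩
      · rw [hu', parse_gateCode]; rfl
      · rfl
      · rw [hu', parse_gateCode, hq]
      · rw [hc, hidx, hp]
  · have hnone : B.decode E n v = none := by
      rcases h : B.decode E n v with _ | g
      · rfl
      · exact absurd ⟨g, h⟩ hv
    simp only [hnone, GateLabel.preds, List.getElem?_nil, reduceCtorEq, iff_false]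
    rintro ⟨h, h', q, m, -, hh', hq, -⟩
    have hV : (parse E v).2.length = Nat.size n := by
      by_contra hne
      rw [scanTracks, if_neg fun h => hne (h.2.symm.trans (length_msb n))] at hq
      cases hq
    refine hv ⟨(h', (parse E v).2), ?_⟩
    rw [decode, decodeGate, hh']
    simp [Option.filter, hV]

theorem predMachine_reach (n : ℕ) (u v : List Bool)
    (hu : u.length ≤ logBound (B.nameConst E) n) (i : ℕ) :
    (B.predMachine E).Reach (2 * (Nat.size n + u.length + v.length + Nat.size i) + 5)
      (some (B.predMachine E).start,
        tapes (tupleCode [Nat.bits n, u, v, Nat.bits i]) [] [] [] [] [] [])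
      (none, tapes [] [decide ((B.label E n v).preds[i]? = some ⟨u, hu⟩)] [] [] [] [] []) := by
  rw [← predAnswer_eq, tupleCode_cons, tupleCode_cons, tupleCode_cons, tupleCode_cons]
  have hs := predMachine_scan E (parse E u).1.done (parse E v).1.done
    ((Nat.bits i).foldl idxStep (some false)) (some (B.start, some false, some true, some true))
    (msb n) (parse E u).2 (parse E v).2
  rw [msb, ← List.append_nil (Nat.bits n).reverse] at hs ⊢
  refine (predMachine_readNum E _ _ _ _ _ _ _ _ <| predMachine_readFst E _ _ _ _ _ _ _ _ _ <|
    predMachine_readSnd E _ _ _ _ _ _ _ _ _ _ <|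
      predMachine_readIdx E _ _ _ _ _ _ _ _ _ _ _ hs).mono ?_
  have h1 := length_parse_le E u
  have h2 := length_parse_le E v
  simp [Nat.size_eq_bits_len]
  omega

end Blueprint

/-! ### The machine that decides which gates are output gates -/

/-- The number with a given binary representation, the least significant bit first. -/
def lsbValue (l : List Bool) : ℕ := l.foldr (fun b a => b.toNat + 2 * a) 0

theorem lsbValue_reverse (l : List Bool) : lsbValue l.reverse = binaryValue l := by
  induction l using List.reverseRecOn with
  | nil => rfl
  | append_singleton l b ih =>
    rw [List.reverse_concat, binaryValue_concat, ← ih]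
    simp [lsbValue, add_comm]

theorem lsbValue_bits (n : ℕ) : lsbValue (Nat.bits n) = n := by
  induction n using Nat.binaryRec' with
  | zero => rfl
  | bit b n h ih =>
    rw [Nat.bits_append_bit _ _ h, Nat.bit_val]
    simp only [lsbValue, List.foldr_cons] at ih ⊢
    rw [ih, add_comm]

/-! ### Comparison with an output index by a finite carry -/

section Carry

variable (D T t : ℕ)

/-- A number, if it is small enough. -/
def boundedCarry (v : ℕ) : Option (Fin (D * T + 1)) :=
  if h : v < D * T + 1 then some ⟨v, h⟩ else none

/-- Add a multiple of a bit to the carry, and compare the last bit of the result with `y`. -/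
def carryBit (s : Bool) (c : Option (Fin (D * T + 1))) (x y : Bool) :
    Option (Fin (D * T + 1)) :=
  c.bind fun c =>
    if (c + (if s then D * T else D) * x.toNat) % 2 = y.toNat then
      boundedCarry D T ((c + (if s then D * T else D) * x.toNat) / 2) else none

/-- Add `D * t` to the carry. -/
def carrySep (c : Option (Fin (D * T + 1))) : Option (Fin (D * T + 1)) :=
  c.bind fun c => boundedCarry D T (c + D * t)

/-- Comparison of `D * (S + 2 ^ |S| * (t + T * E)) + c` with a number `J`, bit by bit. -/
def carryRun : Bool → Option (Fin (D * T + 1)) → List (Option Bool) → List Bool →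
    Option (Fin (D * T + 1))
  | _, c, [], [] => c
  | _, c, none :: Z, J => carryRun true (carrySep D T t c) Z J
  | s, c, some x :: Z, [] => carryRun s (carryBit D T s c x false) Z []
  | s, c, some x :: Z, y :: J => carryRun s (carryBit D T s c x y) Z J
  | s, c, [], y :: J => carryRun s (carryBit D T s c false y) [] J
termination_by _ _ Z J => Z.length + J.length

theorem carryRun_none (s : Bool) (Z : List (Option Bool)) (J : List Bool) :
    carryRun D T t s none Z J = none := by
  induction Z generalizing s J with
  | nil =>
    induction J with
    | nil => simp [carryRun]
    | cons y J ih => simpa [carryRun, carryBit] using ih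
  | cons z Z ih =>
    rcases z with _ | x
    · simpa [carryRun, carrySep] using ih _ _
    · rcases J with _ | ⟨y, J⟩ <;> simpa [carryRun, carryBit] using ih _ _

variable {D T t}

/-- Comparison of the last binary digits: the equation holds if and only if `c + m` has the parity
of `y` and the equation for the halves holds. -/
theorem carryBit_run (s : Bool) (c : ℕ) (hc : c < D * T + 1) (x y : Bool) (Z : List (Option Bool))
    (J : List Bool) (r m : ℕ) (hm : (if s then D * T else D) * x.toNat = m)
    (hv : (c + m) / 2 < D * T + 1)
    (h : carryRun D T t s (some ⟨_, hv⟩) Z J = some ⟨0, Nat.succ_pos _⟩ ↔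
      (c + m) / 2 + r = lsbValue J) :
    carryRun D T t s (carryBit D T s (some ⟨c, hc⟩) x y) Z J = some ⟨0, Nat.succ_pos _⟩ ↔
      c + m + 2 * r = y.toNat + 2 * lsbValue J := by
  simp only [carryBit, Option.bind_some, hm]
  have hy : y.toNat < 2 := by cases y <;> simp
  by_cases hp : (c + m) % 2 = y.toNat
  · rw [if_pos hp, boundedCarry, dif_pos hv, h]
    omega
  · rw [if_neg hp, carryRun_none]
    simp only [reduceCtorEq, false_iff]
    omega

/-- The list that ends first is continued by zeros, so the lengths of `E` and `J` need not agree. -/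
theorem carryRun_snd (E J : List Bool) (c : ℕ) (hc : c < D * T + 1) :
    carryRun D T t true (some ⟨c, hc⟩) (E.map some) J = some ⟨0, Nat.succ_pos _⟩ ↔
      c + D * T * lsbValue E = lsbValue J := by
  induction E generalizing J c with
  | nil =>
    induction J generalizing c with
    | nil => simp [carryRun, lsbValue]
    | cons y J ih =>
      have := carryBit_run (t := t) true c hc false y [] J 0 0 (by simp) (by omega)
        (by simpa [lsbValue] using ih _ _)
      simpa [carryRun, lsbValue] using this
  | cons x E ih =>
    -- The bound on the carry is preserved: it is half the sum of two numbers that are at most `D *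
    -- T`.
    have hb : (c + D * T * x.toNat) / 2 < D * T + 1 := by
      have : D * T * x.toNat ≤ D * T := by cases x <;> simp
      omega
    rcases J with _ | ⟨y, J⟩
    · have := carryBit_run (t := t) true c hc x false (E.map some) [] (D * T * lsbValue E)
        (D * T * x.toNat) (by simp) hb
        (ih _ _ _)
      simp only [List.map_cons, carryRun, this]
      simp only [lsbValue, List.foldr_cons, List.foldr_nil, Bool.toNat_false, mul_add,
        mul_left_comm, add_assoc, mul_zero, add_zero]
    · have := carryBit_run (t := t) true c hc x y (E.map some) J (D * T * lsbValue E)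
        (D * T * x.toNat) (by simp) hb
        (ih _ _ _)
      simp only [List.map_cons, carryRun, this]
      simp only [lsbValue, List.foldr_cons, mul_add, mul_left_comm, add_assoc]

/-- Before the separator the carry obeys the sharper bound `c ≤ D`, which leaves room for adding `D
* t` there, since `D + D * t ≤ D * T`. -/
theorem carryRun_fst (ht : t < T) (S E J : List Bool) (c : ℕ) (hc : c < D * T + 1) (hD : c ≤ D) :
    carryRun D T t false (some ⟨c, hc⟩) (S.map some ++ none :: E.map some) J =
        some ⟨0, Nat.succ_pos _⟩ ↔
      c + D * (lsbValue S + 2 ^ S.length * (t + T * lsbValue E)) = lsbValue J := by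
  have hDT : D ≤ D * T := Nat.le_mul_of_pos_right _ (by omega)
  induction S generalizing J c with
  | nil =>
    have hb : c + D * t < D * T + 1 := by
      have : D * (t + 1) ≤ D * T := Nat.mul_le_mul_left _ ht
      rw [mul_add] at this
      omega
    simp only [List.map_nil, List.nil_append, carryRun, carrySep, Option.bind_some, boundedCarry,
      dif_pos hb, carryRun_snd]
    simp only [lsbValue, List.foldr_nil, List.length_nil, pow_zero, one_mul, zero_add, mul_add,
      mul_assoc, add_assoc]
  | cons x S ih =>
    have hb : (c + D * x.toNat) / 2 ≤ D := by
      have : D * x.toNat ≤ D := by cases x <;> simp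
      omega
    have hb' : (c + D * x.toNat) / 2 < D * T + 1 := by omega
    have e1 : ∀ a b : ℕ, a + D * x.toNat +
        2 * (D * (lsbValue S + 2 ^ S.length * (t + T * lsbValue E))) = b ↔
        a + D * (lsbValue (x :: S) + 2 ^ (x :: S).length * (t + T * lsbValue E)) = b := by
      intro a b
      have : a + D * x.toNat + 2 * (D * (lsbValue S + 2 ^ S.length * (t + T * lsbValue E))) =
        a + D * (lsbValue (x :: S) + 2 ^ (x :: S).length * (t + T * lsbValue E)) := by
        simp only [lsbValue, List.foldr_cons, List.length_cons]
        ring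
      rw [this]
    rcases J with _ | ⟨y, J⟩
    · have := carryBit_run (t := t) false c hc x false (S.map some ++ none :: E.map some) []
        (D * (lsbValue S + 2 ^ S.length * (t + T * lsbValue E)))
        (D * x.toNat) (by simp) hb' (ih _ _ _ hb)
      simp only [List.map_cons, List.cons_append, carryRun, this]
      exact e1 _ _
    · have := carryBit_run (t := t) false c hc x y (S.map some ++ none :: E.map some) J
        (D * (lsbValue S + 2 ^ S.length * (t + T * lsbValue E)))
        (D * x.toNat) (by simp) hb' (ih _ _ _ hb)
      simp only [List.map_cons, List.cons_append, carryRun, this]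
      exact e1 _ _

end Carry

namespace Blueprint

variable (B : Blueprint) {b : ℕ} (E : B.Header ⊕ Column ≃ Fin (b + 1))

/-- The states of the machine that decides which gates are output gates. -/
inductive OutState : Type where
  | readNum
  | readGate (P : ParseState B.Header b)
  | readIdx (h : Option B.Header)
  | scan (h : Option B.Header) (ok : Bool)
  | turn (h : Option B.Header) (ok : Bool)
  | join (h : Option B.Header) (ok : Bool)
  | add (x : Option (Fin B.rows × Fin B.digits)) (s : Bool)
      (c : Option (Fin (B.digits * B.rows + 1)))

instance : Finite (B.OutState (b := b)) := by
  refine Finite.of_surjective (α := Unit ⊕ ParseState B.Header b ⊕ Option B.Header ⊕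
    (Option B.Header × Bool) ⊕ (Option B.Header × Bool) ⊕ (Option B.Header × Bool) ⊕
    (Option (Fin B.rows × Fin B.digits) × Bool × Option (Fin (B.digits * B.rows + 1))))
    (fun
      | .inl _ => .readNum
      | .inr (.inl P) => .readGate P
      | .inr (.inr (.inl h)) => .readIdx h
      | .inr (.inr (.inr (.inl x))) => .scan x.1 x.2
      | .inr (.inr (.inr (.inr (.inl x)))) => .turn x.1 x.2
      | .inr (.inr (.inr (.inr (.inr (.inl x))))) => .join x.1 x.2
      | .inr (.inr (.inr (.inr (.inr (.inr x))))) => .add x.1 x.2.1 x.2.2) ?_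
  rintro (_ | P | h | ⟨h, ok⟩ | ⟨h, ok⟩ | ⟨h, ok⟩ | ⟨x, s, c⟩)
  exacts [⟨.inl (), rfl⟩, ⟨.inr (.inl P), rfl⟩, ⟨.inr (.inr (.inl h)), rfl⟩,
    ⟨.inr (.inr (.inr (.inl (h, ok)))), rfl⟩, ⟨.inr (.inr (.inr (.inr (.inl (h, ok))))), rfl⟩,
    ⟨.inr (.inr (.inr (.inr (.inr (.inl (h, ok)))))), rfl⟩,
    ⟨.inr (.inr (.inr (.inr (.inr (.inr (x, s, c)))))), rfl⟩]

open scoped Classical in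
/-- The row and the digit that belong to the header of an output gate. -/
noncomputable def rootIndex (h : Option B.Header) (ok : Bool) :
    Option (Fin B.rows × Fin B.digits) :=
  if hx : ok = true ∧ ∃ x, h = some (B.root x) then some hx.2.choose else none

theorem rootIndex_eq_some_iff (h : Option B.Header) (ok : Bool) (x : Fin B.rows × Fin B.digits) :
    B.rootIndex h ok = some x ↔ ok = true ∧ h = some (B.root x) := by
  rw [rootIndex]
  split_ifs with hx
  · have hs := hx.2.choose_spec
    constructor
    · intro he
      rw [Option.some_inj] at he
      exact ⟨hx.1, he ▸ hs⟩
    · rintro ⟨-, he⟩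
      exact congrArg some (B.root_injective (Option.some_injective _ (hs.symm.trans he)))
  · simp only [false_iff]
    rintro ⟨h1, h2⟩
    exact hx ⟨h1, x, h2⟩

/-- The carry at the beginning. -/
def startCarry (x : Option (Fin B.rows × Fin B.digits)) :
    Option (Fin (B.digits * B.rows + 1)) :=
  x.bind fun x => boundedCarry _ _ x.2

/-- The number of the row. -/
def rowOf (x : Option (Fin B.rows × Fin B.digits)) : ℕ := x.elim 0 fun x => x.1

/-- The machine that decides which gates are output gates. -/
noncomputable def outMachine : ColumnMachine where
  State := B.OutState (b := b)
  start := .readNum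
  next
    | .readNum, T => match T .inp with
      | some (some _) => some .readNum
      | _ => some (.readGate (some (0, none)))
    | .readGate P, T => match T .inp with
      | some (some x) => some (.readGate (parseStep E P x).1)
      | _ => some (.readIdx P.done)
    | .readIdx h, T => match T .inp with
      | some (some _) => some (.readIdx h)
      | _ => some (.scan h true)
    | .scan h ok, T => match T .a, T .b with
      | some _, some y => some (.scan h (ok && y.2.2.isNone))
      | none, none => some (.turn h ok)
      | _, _ => some (.scan h false)
    | .turn h ok, T => match T .d with
      | some _ => some (.turn h ok)
      | none => some (.join h ok)
    | .join h ok, T => match T .c with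
      | some _ => some (.join h ok)
      | none => some (.add (B.rootIndex h ok) false (B.startCarry (B.rootIndex h ok)))
    | .add x s c, T => match T .e, T .a with
      | none, none => none
      | some none, _ => some (.add x true (carrySep _ _ (B.rowOf x) c))
      | some (some z), none => some (.add x s (carryBit _ _ s c z false))
      | some (some z), some y => some (.add x s (carryBit _ _ s c z y))
      | none, some y => some (.add x s (carryBit _ _ s c false y))
  op
    | .readNum, T, k => match k, T .inp with
      | .inp, _ => .pop
      | .a, some (some x) => .push x
      | _, _ => .keep
    | .readGate P, T, k => match k, T .inp with
      | .inp, _ => .pop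
      | .b, some (some x) => match (parseStep E P x).2 with
        | some y => .push y
        | none => .keep
      | .c, some (some x) => match (parseStep E P x).2 with
        | some y => .push y
        | none => .keep
      | _, _ => .keep
    | .readIdx _, T, k => match k, T .inp with
      | .inp, _ => .pop
      | .d, some (some x) => .push x
      | _, _ => .keep
    | .scan _ _, T, k => match k, T .a, T .b with
      | .a, _, _ => .pop
      | .b, _, _ => .pop
      | .e, some _, some y => .push (some y.2.1)
      | .e, none, none => .push none
      | _, _, _ => .keep
    | .turn _ _, T, k => match k, T .d with
      | .d, _ => .pop
      | .a, some x => .push x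
      | _, _ => .keep
    | .join _ _, T, k => match k, T .c with
      | .c, _ => .pop
      | .e, some y => .push (some y.1)
      | _, _ => .keep
    | .add x _ c, T, k => match k, T .e, T .a with
      | .out, none, none => .push (x.isSome && c = some ⟨0, Nat.succ_pos _⟩)
      | .e, _, _ => .pop
      | .a, some none, _ => .keep
      | .a, _, _ => .pop
      | _, _, _ => .keep

open ColumnMachine

section OutMachine

variable {B} {z : (B.outMachine E).Config} {t : ℕ}

theorem outMachine_readNum (l : List Bool) (r o a b c d e)
    (h : (B.outMachine E).Reach t (some (.readGate (some (0, none))),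
      tapes r o (l.reverse ++ a) b c d e) z) :
    (B.outMachine E).Reach (t + (l.length + 1))
      (some .readNum, tapes (l.map some ++ none :: r) o a b c d e) z := by
  induction l generalizing a with
  | nil => exact reach_head rfl (by rintro ⟨⟩ <;> rfl) h
  | cons x l ih =>
    exact reach_head rfl (by rintro ⟨⟩ <;> rfl) (ih (x :: a) (by simpa using h))

theorem outMachine_readGate (l : List Bool) (P : ParseState B.Header b) (S r o a d e)
    (h : (B.outMachine E).Reach t (some (.readIdx (l.foldl (parsePush E) (P, S)).1.done),
      tapes r o a (l.foldl (parsePush E) (P, S)).2 (l.foldl (parsePush E) (P, S)).2 d e) z) :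
    (B.outMachine E).Reach (t + (l.length + 1))
      (some (.readGate P), tapes (l.map some ++ none :: r) o a S S d e) z := by
  induction l generalizing P S with
  | nil => exact reach_head rfl (by rintro ⟨⟩ <;> rfl) h
  | cons x l ih =>
    refine reach_head rfl (b' := (parsePush E (P, S) x).2) (c' := (parsePush E (P, S) x).2) ?_
      (ih _ _ h)
    rintro ⟨⟩ <;> try rfl
    all_goals
      simp only [outMachine, tapes, parsePush, List.map_cons, List.cons_append, List.head?_cons]
      cases (parseStep E P x).2 <;> rfl

theorem outMachine_readIdx (hd : Option B.Header) (l : List Bool) (r o a b' c d e)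
    (h : (B.outMachine E).Reach t (some (.scan hd true),
      tapes r o a b' c (l.reverse ++ d) e) z) :
    (B.outMachine E).Reach (t + (l.length + 1))
      (some (.readIdx hd), tapes (l.map some ++ none :: r) o a b' c d e) z := by
  induction l generalizing d with
  | nil => exact reach_head rfl (by rintro ⟨⟩ <;> rfl) h
  | cons x l ih =>
    exact reach_head rfl (by rintro ⟨⟩ <;> rfl) (ih (x :: d) (by simpa using h))

/-- Whether the number of columns is right and their third address is not determined. -/
def scanRoot (ok : Bool) (A : List Bool) (S : List Column) : Bool :=
  decide (A.length = S.length) && (ok && S.all fun y => y.2.2.isNone)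

theorem outMachine_scan (h : Option B.Header) (ok : Bool) (A : List Bool)
    (S : List Column) (r o c' d e)
    (H : ∀ e', (A.length = S.length → e' = (S.map fun y => some y.2.1).reverse ++ e) →
      e'.length ≤ e.length + S.length →
      (B.outMachine E).Reach t (some (.turn h (scanRoot ok A S)),
        tapes r o [] [] c' d (none :: e')) z) :
    (B.outMachine E).Reach (t + (A.length + S.length + 1))
      (some (.scan h ok), tapes r o A S c' d e) z := by
  induction A generalizing S ok e with
  | nil =>
    induction S generalizing ok with
    | nil =>
      have := H e (by simp) le_rfl
      simp only [scanRoot, List.all_nil, Bool.and_true] at this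
      exact reach_head rfl (by rintro ⟨⟩ <;> rfl) this
    | cons y S ih =>
      refine reach_head rfl (by rintro ⟨⟩ <;> rfl) (ih false fun e' _ h2 => ?_)
      have := H e' (by simp) (h2.trans (by simp))
      simpa [scanRoot] using this
  | cons x A ih =>
    cases S with
    | nil =>
      refine (reach_head rfl (by rintro ⟨⟩ <;> rfl) (ih false [] e fun e' _ h2 => ?_)).mono
        (by simp only [List.length_cons, List.length_nil]; omega)
      have := H e' (by simp) h2
      simpa [scanRoot] using this
    | cons y S =>
      refine (reach_head rfl (by rintro ⟨⟩ <;> rfl) (ih (ok && y.2.2.isNone) S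
        (some y.2.1 :: e) fun e' h1 h2 => ?_)).mono (by simp; omega)
      have := H e' (fun hl => by
        rw [h1 (by simpa using hl)]; simp) (by simp at h2 ⊢; omega)
      simpa [scanRoot, Bool.and_assoc] using this

theorem outMachine_turn (h : Option B.Header) (ok : Bool) (r o a b' c' d e)
    (H : (B.outMachine E).Reach t (some (.join h ok), tapes r o (d.reverse ++ a) b' c' [] e) z) :
    (B.outMachine E).Reach (t + (d.length + 1)) (some (.turn h ok), tapes r o a b' c' d e) z := by
  induction d generalizing a with
  | nil => exact reach_head rfl (by rintro ⟨⟩ <;> rfl) H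
  | cons x l ih =>
    exact reach_head rfl (by rintro ⟨⟩ <;> rfl) (ih (x :: a) (by simpa using H))

theorem outMachine_join (h : Option B.Header) (ok : Bool) (r o a b' c' d e)
    (H : (B.outMachine E).Reach t (some (.add (B.rootIndex h ok) false
        (B.startCarry (B.rootIndex h ok))),
      tapes r o a b' [] d ((c'.map fun y => some y.1).reverse ++ e)) z) :
    (B.outMachine E).Reach (t + (c'.length + 1)) (some (.join h ok), tapes r o a b' c' d e) z := by
  induction c' generalizing e with
  | nil => exact reach_head rfl (by rintro ⟨⟩ <;> rfl) H
  | cons x l ih =>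
    exact reach_head rfl (by rintro ⟨⟩ <;> rfl) (ih (some x.1 :: e) (by simpa using H))

theorem outMachine_add (x : Option (Fin B.rows × Fin B.digits)) (s : Bool)
    (c : Option (Fin (B.digits * B.rows + 1))) (Z : List (Option Bool)) (J : List Bool) :
    (B.outMachine E).Reach (Z.length + J.length + 1)
      (some (.add x s c), tapes [] [] J [] [] [] Z)
      (none, tapes [] [x.isSome && carryRun _ _ (B.rowOf x) s c Z J = some ⟨0, Nat.succ_pos _⟩]
        [] [] [] [] []) := by
  induction Z generalizing s c J with
  | nil =>
    induction J generalizing c with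
    | nil =>
      simp only [carryRun]
      exact reach_head rfl (by rintro ⟨⟩ <;> rfl) (.refl 0 _)
    | cons y J ih =>
      simp only [carryRun]
      exact reach_head rfl (by rintro ⟨⟩ <;> rfl) (ih _)
  | cons w Z ih =>
    rcases w with _ | w
    · simp only [carryRun]
      refine (reach_head rfl (by rintro ⟨⟩ <;> rfl) (ih _ _ _)).mono ?_
      simp only [List.length_cons]
      omega
    · rcases J with _ | ⟨y, J⟩ <;> simp only [carryRun]
      · refine (reach_head rfl (by rintro ⟨⟩ <;> rfl) (ih _ _ _)).mono ?_
        simp only [List.length_cons]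
        omega
      · refine (reach_head rfl (by rintro ⟨⟩ <;> rfl) (ih _ _ _)).mono ?_
        simp only [List.length_cons]
        omega

end OutMachine

end Blueprint

/-! ### Addresses as lists of columns -/

theorem map_fst_rootCols (w s e : ℕ) :
    (rootCols w s e).map (fun y => y.1) = fixedBits w s := by
  have h : ∀ l l' : List Bool, l.length = l'.length →
      (List.zipWith (fun a b => ((a, b, none) : Column)) l l').map (fun y => y.1) = l := by
    intro l
    induction l with
    | nil => simp
    | cons a l ih =>
      rintro (_ | ⟨b, l'⟩) h
      · simp at h
      · simpa using ih l' (by simpa using h)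
  exact h _ _ (by simp [length_fixedBits])

theorem map_snd_rootCols (w s e : ℕ) :
    (rootCols w s e).map (fun y => y.2.1) = fixedBits w e := by
  have h : ∀ l l' : List Bool, l.length = l'.length →
      (List.zipWith (fun a b => ((a, b, none) : Column)) l l').map (fun y => y.2.1) = l' := by
    intro l
    induction l with
    | nil => simp [eq_comm]
    | cons a l ih =>
      rintro (_ | ⟨b, l'⟩) h
      · simp at h
      · simpa using ih l' (by simpa using h)
  exact h _ _ (by simp [length_fixedBits])

theorem rootCols_snd_snd (w s e : ℕ) : ∀ y ∈ rootCols w s e, y.2.2 = none := by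
  have h : ∀ l l' : List Bool,
      ∀ y ∈ List.zipWith (fun a b => ((a, b, none) : Column)) l l', y.2.2 = none := by
    intro l
    induction l with
    | nil => simp
    | cons a l ih =>
      rintro (_ | ⟨b, l'⟩)
      · simp
      · intro y hy
        rw [List.zipWith_cons_cons, List.mem_cons] at hy
        rcases hy with rfl | hy
        · rfl
        · exact ih l' y hy
  exact h _ _

theorem rootCols_binaryValue (cols : List Column) (h : ∀ y ∈ cols, y.2.2 = none) :
    rootCols cols.length (binaryValue (cols.map fun y => y.1))
      (binaryValue (cols.map fun y => y.2.1)) = cols := by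
  have h1 := fixedBits_binaryValue (cols.map fun y => y.1)
  have h2 := fixedBits_binaryValue (cols.map fun y => y.2.1)
  rw [List.length_map] at h1 h2
  rw [rootCols, h1, h2]
  clear h1 h2
  induction cols with
  | nil => rfl
  | cons c cols ih =>
    obtain ⟨s, e, p⟩ := c
    obtain rfl : p = none := h (s, e, p) List.mem_cons_self
    simpa using ih fun y hy => h y (List.mem_cons_of_mem _ hy)

theorem binaryValue_lt (l : List Bool) : binaryValue l < 2 ^ l.length := by
  induction l using List.reverseRecOn with
  | nil => simp [binaryValue]
  | append_singleton l b ih =>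
    rw [binaryValue_concat, List.length_append, List.length_singleton, pow_succ]
    have : b.toNat < 2 := by cases b <;> simp
    omega

namespace Blueprint

variable (B : Blueprint) {b : ℕ} (E : B.Header ⊕ Column ≃ Fin (b + 1))

theorem length_outCols (n j : ℕ) : (B.outCols n j).length = Nat.size n := length_rootCols _ _ _

/-- The index `j` is written in mixed radix with the bases `digits`, `2 ^ Nat.size n`, `rows`, `2 ^
Nat.size n`. In this form the divisions that define the output gates become multiplications by
constants, which a finite carry can handle. -/
theorem exists_out_iff (n : ℕ) (u : List Bool) (hu : u.length ≤ logBound (B.nameConst E) n)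
    (j : ℕ) :
    (∃ _ : j < B.outLen n, B.gate E n (B.outHeader n j) (B.outCols n j) = ⟨u, hu⟩) ↔
      ∃ x cols, u = gateCode E (B.root x) cols ∧ cols.length = Nat.size n ∧
        (∀ y ∈ cols, y.2.2 = none) ∧
        x.2 + B.digits * (binaryValue (cols.map fun y => y.1) + 2 ^ Nat.size n *
          (x.1 + B.rows * binaryValue (cols.map fun y => y.2.1))) = j := by
  have hW : 0 < 2 ^ Nat.size n := Nat.two_pow_pos _
  constructor
  · rintro ⟨hj, h⟩
    refine ⟨(⟨j / B.digits / 2 ^ Nat.size n % B.rows, Nat.mod_lt _ B.rows_pos⟩,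
      ⟨j % B.digits, Nat.mod_lt _ B.digits_pos⟩), B.outCols n j, ?_, length_rootCols _ _ _, rootCols_snd_snd _ _ _, ?_⟩
    · have := congrArg Subtype.val h
      rw [B.gate_val E (B.length_outCols _ _)] at this
      exact this.symm
    · rw [outCols, map_fst_rootCols, map_snd_rootCols, binaryValue_fixedBits,
        binaryValue_fixedBits, Nat.mod_mod]
      have h1 : j / B.digits / 2 ^ Nat.size n / B.rows < 2 ^ Nat.size n := by
        rw [Nat.div_lt_iff_lt_mul B.rows_pos, Nat.div_lt_iff_lt_mul hW,
          Nat.div_lt_iff_lt_mul B.digits_pos]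
        refine hj.trans_eq ?_
        rw [outLen]
        ring
      rw [Nat.mod_eq_of_lt h1, Nat.mod_add_div, Nat.mod_add_div, Nat.mod_add_div]
  · rintro ⟨⟨t, r⟩, cols, rfl, hl, hn, rfl⟩
    have hs := binaryValue_lt (cols.map fun y => y.1)
    have he := binaryValue_lt (cols.map fun y => y.2.1)
    have hc := rootCols_binaryValue cols hn
    rw [List.length_map, hl] at hs he
    rw [hl] at hc
    simp only
    set s := binaryValue (cols.map fun y => y.1)
    set e := binaryValue (cols.map fun y => y.2.1)
    have e1 : (r.1 + B.digits * (s + 2 ^ Nat.size n * (t.1 + B.rows * e))) / B.digits =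
        s + 2 ^ Nat.size n * (t.1 + B.rows * e) := by
      rw [Nat.add_mul_div_left _ _ B.digits_pos, Nat.div_eq_of_lt r.2, zero_add]
    have e2 : (s + 2 ^ Nat.size n * (t.1 + B.rows * e)) / 2 ^ Nat.size n = t.1 + B.rows * e := by
      rw [Nat.add_mul_div_left _ _ hW, Nat.div_eq_of_lt hs, zero_add]
    have e3 : (t.1 + B.rows * e) / B.rows = e := by
      rw [Nat.add_mul_div_left _ _ B.rows_pos, Nat.div_eq_of_lt t.2, zero_add]
    refine ⟨?_, ?_⟩
    · rw [outLen, mul_comm B.digits (2 ^ _ * _), ← Nat.div_lt_iff_lt_mul B.digits_pos, e1,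
        mul_comm (2 ^ _) (_ * _), ← Nat.div_lt_iff_lt_mul hW, e2, mul_comm B.rows (2 ^ _),
        ← Nat.div_lt_iff_lt_mul B.rows_pos, e3]
      exact he
    · refine Subtype.ext ?_
      rw [B.gate_val E (B.length_outCols _ _), outCols, outHeader]
      simp only [e1, e2, e3, Nat.add_mul_mod_self_left, Nat.mod_eq_of_lt r.2,
        Nat.mod_eq_of_lt t.2, Nat.mod_eq_of_lt hs, hc]

/-- The decidability instance is a parameter so that the result matches the one that occurs in
`DLogTimeUniform`. -/
theorem outMachine_reach (n : ℕ) (u : List Bool) (hu : u.length ≤ logBound (B.nameConst E) n)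
    (j : ℕ) (inst : Decidable (∃ _ : j < B.outLen n,
      B.gate E n (B.outHeader n j) (B.outCols n j) = ⟨u, hu⟩)) :
    (B.outMachine E).Reach (5 * (Nat.size n + u.length + Nat.size j) + 10)
      (some (B.outMachine E).start,
        tapes (tupleCode [Nat.bits n, u, Nat.bits j]) [] [] [] [] [] [])
      (none, tapes [] [@decide _ inst]
          [] [] [] [] []) := by
  rw [tupleCode_cons, tupleCode_cons, tupleCode_cons]
  have hlen := length_parse_le E u
  -- If the number of columns is wrong, nothing is known about the contents of `e'`; but then
  -- `rootIndex` is `none` and the answer is `false` anyway.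
  have key : ∀ e', ((Nat.bits n).reverse.length = (parse E u).2.length →
        e' = ((parse E u).2.map fun y => some y.2.1).reverse) →
      e'.length ≤ (parse E u).2.length →
      (B.outMachine E).Reach (3 * u.length + 2 * Nat.size j + 6)
        (some (.turn (parse E u).1.done (scanRoot true (msb n) (parse E u).2)),
          tapes [] [] [] [] (parse E u).2 (Nat.bits j).reverse (none :: e'))
        (none, tapes [] [@decide _ inst]
            [] [] [] [] []) := by
    intro e' h1 h2
    have hadd := outMachine_add E
      (B.rootIndex (parse E u).1.done (scanRoot true (msb n) (parse E u).2)) false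
      (B.startCarry (B.rootIndex (parse E u).1.done (scanRoot true (msb n) (parse E u).2)))
      (((parse E u).2.map fun y => some y.1).reverse ++ none :: e')
      (Nat.bits j)
    have hans : ((B.rootIndex (parse E u).1.done (scanRoot true (msb n) (parse E u).2)).isSome &&
        carryRun _ _ (B.rowOf (B.rootIndex (parse E u).1.done
            (scanRoot true (msb n) (parse E u).2))) false
          (B.startCarry (B.rootIndex (parse E u).1.done (scanRoot true (msb n) (parse E u).2)))
          (((parse E u).2.map fun y => some y.1).reverse ++ none :: e') (Nat.bits j) =
            some ⟨0, Nat.succ_pos _⟩) =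
        @decide _ inst := by
      rw [Bool.eq_iff_iff, decide_eq_true_iff, exists_out_iff]
      have hok : scanRoot true (msb n) (parse E u).2 = true ↔
          (parse E u).2.length = Nat.size n ∧ ∀ y ∈ (parse E u).2, y.2.2 = none := by
        rw [scanRoot, Bool.and_eq_true, decide_eq_true_eq, Bool.true_and, List.all_eq_true,
          length_msb, eq_comm]
        simp only [Option.isNone_iff_eq_none]
      rcases hr : B.rootIndex (parse E u).1.done (scanRoot true (msb n) (parse E u).2) with _ | x
      · simp only [Option.isSome_none, Bool.false_and, Bool.false_eq_true, false_iff]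
        rintro ⟨x, cols, rfl, hl, hn, -⟩
        rw [parse_gateCode] at hr hok
        change B.rootIndex (some (B.root x)) _ = none at hr
        have := (B.rootIndex_eq_some_iff _ _ x).2 ⟨hok.2 ⟨hl, hn⟩, rfl⟩
        exact Option.some_ne_none _ (this.symm.trans hr)
      · obtain ⟨hok', hh⟩ := (B.rootIndex_eq_some_iff _ _ _).1 hr
        obtain ⟨hl, hn⟩ := hok.1 hok'
        have he' := h1 (by rw [List.length_reverse, Nat.size_eq_bits_len, hl])
        have hu' : u = gateCode E (B.root x) (parse E u).2 := by
          rw [← decodeGate_eq_some_iff, decodeGate, hh]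
          rfl
        have hDT : B.digits ≤ B.digits * B.rows := Nat.le_mul_of_pos_right _ B.rows_pos
        have hx : x.2.1 < B.digits * B.rows + 1 := by have := x.2.2; omega
        have hcr := carryRun_fst x.1.2 ((parse E u).2.map fun y => y.1).reverse
          ((parse E u).2.map fun y => y.2.1).reverse (Nat.bits j) x.2 hx x.2.2.le
        rw [lsbValue_reverse, lsbValue_reverse, lsbValue_bits, List.length_reverse,
          List.length_map, hl, List.map_reverse, List.map_reverse, List.map_map, List.map_map]
          at hcr
        have hst : B.startCarry (some x) = some ⟨x.2.1, hx⟩ := by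
          rw [startCarry, Option.bind_some, boundedCarry, dif_pos hx]
        rw [hst, he']
        simp only [Option.isSome_some, Bool.true_and, decide_eq_true_eq]
        refine hcr.trans ⟨fun h => ⟨x, _, hu', hl, hn, h⟩, ?_⟩
        rintro ⟨x', cols, hu'', -, -, h⟩
        have := (hu'.symm.trans hu'')
        have := (decodeGate_gateCode E _ _).symm.trans
          ((congrArg (decodeGate E) this).trans (decodeGate_gateCode E _ _))
        simp only [Option.some.injEq, Prod.mk.injEq] at this
        obtain rfl := B.root_injective this.1
        rw [this.2]
        exact h
    rw [hans] at hadd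
    have hturn := outMachine_turn E (parse E u).1.done (scanRoot true (msb n) (parse E u).2) [] []
      [] [] (parse E u).2 (Nat.bits j).reverse (none :: e') (by
        rw [List.reverse_reverse, List.append_nil]
        exact outMachine_join E _ _ _ _ _ _ _ _ _ hadd)
    refine hturn.mono ?_
    simp [Nat.size_eq_bits_len]
    omega
  rw [msb, ← List.append_nil (Nat.bits n).reverse, ← List.append_nil (Nat.bits j).reverse] at key
  refine (outMachine_readNum E _ _ _ _ _ _ _ _ <| outMachine_readGate E _ _ _ _ _ _ _ _ <|
    outMachine_readIdx E _ _ _ _ _ _ _ _ _ <|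
      outMachine_scan E _ _ _ _ _ _ _ _ _ fun e' h1 h2 => key e' (by simpa [parse] using h1)
        (by simpa [parse] using h2)).mono ?_
  simp only [parse] at hlen
  simp [Nat.size_eq_bits_len]
  omega

instance : Finite (B.typeMachine E).State := inferInstanceAs (Finite (B.TypeState (b := b)))

instance : Finite (B.predMachine E).State := inferInstanceAs (Finite (B.PredState (b := b)))

instance : Finite (B.outMachine E).State := inferInstanceAs (Finite (B.OutState (b := b)))

/-- A family of circuits that is described by a blueprint is `DLOGTIME`-uniform. -/
theorem family_dLogTimeUniform : (B.family E).DLogTimeUniform := by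
  -- Besides `n`, a machine reads at most three strings of length at most `logBound (B.nameConst E)
  -- n`.
  have hbound : ∀ n l : ℕ, l ≤ logBound (B.nameConst E) n * 3 →
      5 * (Nat.size n + l) + 15 ≤ logBound (15 * B.nameConst E + 20) n := by
    intro n l h
    simp only [logBound] at h ⊢
    nlinarith
  refine ⟨15 * B.nameConst E + 20, ColumnMachine.toTupleMachine (B.typeMachine E),
    ColumnMachine.toTupleMachine (B.predMachine E), ColumnMachine.toTupleMachine (B.outMachine E),
    fun n u => ?_, fun n u v i hi => ?_, fun n u j hj => ?_⟩
  · have hu := u.2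
    change u.1.length ≤ logBound (B.nameConst E) n at hu
    refine ColumnMachine.outputsWithin _ ((B.typeMachine_outputsWithin E n u).mono ?_)
    have := hbound n u.1.length (by omega)
    omega
  · have hu := u.2
    have hv := v.2
    change u.1.length ≤ logBound (B.nameConst E) n at hu
    change v.1.length ≤ logBound (B.nameConst E) n at hv
    change Nat.size i ≤ logBound (B.nameConst E) n at hi
    have := hbound n (u.1.length + v.1.length + Nat.size i) (by omega)
    have h := ColumnMachine.outputsWithin _
      ((B.predMachine_reach E n u v hu i).mono
        (t' := logBound (15 * B.nameConst E + 20) n) (by omega))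
    exact h
  · have hu := u.2
    change u.1.length ≤ logBound (B.nameConst E) n at hu
    change Nat.size j ≤ logBound (B.nameConst E) n at hj
    have := hbound n (u.1.length + Nat.size j) (by omega)
    exact ColumnMachine.outputsWithin _ ((B.outMachine_reach E n u hu j _).mono (by omega))

end Blueprint

/-! ### Evaluation of finite automata by circuits -/

theorem Circuit.eval_input {n m : ℕ} {α : Type} {C : Circuit n m α} {x : Fin n → Bool} {v : α}
    {i : Fin n} (h : C.label v = .input i) : C.eval x v = x i := by
  rw [Circuit.eval]
  split <;> simp_all

theorem Circuit.eval_const {n m : ℕ} {α : Type} {C : Circuit n m α} {x : Fin n → Bool} {v : α}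
    {b : Bool} (h : C.label v = .const b) : C.eval x v = b := by
  rw [Circuit.eval]
  split <;> simp_all

theorem Circuit.eval_not {n m : ℕ} {α : Type} {C : Circuit n m α} {x : Fin n → Bool} {v u : α}
    (h : C.label v = .not u) : C.eval x v = !C.eval x u := by
  rw [Circuit.eval]
  split <;> simp_all

theorem Circuit.eval_and {n m : ℕ} {α : Type} {C : Circuit n m α} {x : Fin n → Bool} {v u w : α}
    (h : C.label v = .and u w) : C.eval x v = (C.eval x u && C.eval x w) := by
  rw [Circuit.eval]
  split <;> simp_all

theorem Circuit.eval_or {n m : ℕ} {α : Type} {C : Circuit n m α} {x : Fin n → Bool} {v u w : α}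
    (h : C.label v = .or u w) : C.eval x v = (C.eval x u || C.eval x w) := by
  rw [Circuit.eval]
  split <;> simp_all

/-- A finite automaton that reads the bits at the positions `p < 2 ^ w` of a string (`none` if there
is no bit at the position `p`), together with finite information on the position, which another
automaton computes from the binary representations of the length of the string, of `p` and of two
parameters. Finitely many rows and digits are further parameters. -/
structure PositionalAutomaton where
  rows : ℕ
  digits : ℕ
  rows_pos : 0 < rows
  digits_pos : 0 < digits
  states : ℕ
  Info : Type
  [finite_info : Finite Info]
  infoStart : Info
  infoNext : Info → Bool → Bool → Bool → Bool → Info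
  step : Fin rows × Fin digits → Info → Fin states → Option Bool → Fin states
  start : Fin states
  accept : Fin states

namespace PositionalAutomaton

attribute [instance] finite_info

variable (A : PositionalAutomaton)

/-- The information that is computed from four lists of bits. -/
def info : A.Info → List Bool → List Bool → List Bool → List Bool → A.Info
  | r, a :: N, s :: S, e :: E, p :: P => info (A.infoNext r a s e p) N S E P
  | r, _, _, _, _ => r

/-- The headers of the gates: `none` for the input gates. -/
abbrev TreeHeader : Type :=
  Option ((Fin A.rows × Fin A.digits) × Fin A.states × Fin A.states × Bool × Fin (A.states + 1))

/-- The classes of columns. The first component is `some false` if the third address is determined,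
`some true` if only its first bits are determined, and `none` if it is not of this form; the second
component is the result of the comparison of the third address with the number of inputs. -/
abbrev TreeClass : Type := Option Bool × Option Bool × A.Info

/-- A step of the computation of the class. -/
def treeNext (q : A.TreeClass) (a : Bool) (c : Column) : A.TreeClass :=
  (match q.1, c.2.2 with
    | some false, some _ => some false
    | some _, none => some true
    | _, _ => none,
   -- The first differing bit decides the comparison: the greater number has the bit `true` there,
   -- so `a` tells whether this is the number of inputs.
   match q.2.1 with
    | none => if c.2.2.getD false = a then none else some a
    | some b => some b,
   A.infoNext q.2.2 a c.1 c.2.1 (c.2.2.getD false))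

/-- The shape of the gate that tells whether a bit leads from the state `q` to the state `q'`. -/
def leafShape (x : Fin A.rows × Fin A.digits) (r : A.Info) (lt : Bool) (q q' : Fin A.states) :
    Shape A.TreeHeader :=
  if lt then
    if A.step x r q (some true) = q' then
      -- The `or` of the input gate with itself copies the input bit.
      if A.step x r q (some false) = q' then .const true else .or (none, .same) (none, .same)
    else
      if A.step x r q (some false) = q' then .not (none, .same) else .const false
  else .const (decide (A.step x r q none = q'))

/-- The shapes of the gates. The gate `(x, q, q', false, 0)` tells whether the bits of a block lead
from `q` to `q'`, the gate `(x, q, q', false, k)` whether they do so through an intermediate state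
not less than `k`, and the gate `(x, q, q', true, k)` whether they do so through the state `k`. -/
def treeShape : A.TreeHeader → A.TreeClass → Shape A.TreeHeader
  | none, (some false, some true, _) => .inp
  | none, _ => .const false
  | some (x, q, q', false, k), (some false, lt, r) =>
    if k.1 = 0 then A.leafShape x r (lt = some true) q q' else .const false
  | some (x, q, q', false, k), (some true, _, _) =>
    if h : k.1 < A.states then
      .or (some (x, q, q', true, k), .same)
        (some (x, q, q', false, ⟨k.1 + 1, Nat.succ_lt_succ h⟩), .same)
    else .const false
  | some (x, q, q', true, k), (some true, _, _) =>
    if h : k.1 < A.states then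
      .and (some (x, q, ⟨k.1, h⟩, false, 0), .child false)
        (some (x, ⟨k.1, h⟩, q', false, 0), .child true)
    else .const false
  | _, _ => .const false

/-- The number of bits of the third address that are not determined. -/
def openBits (cols : List Column) : ℕ := cols.countP fun c => c.2.2.isNone

/-- The level of a gate. -/
def treeLevel : A.TreeHeader → List Column → ℕ
  | none, _ => 0
  | some (_, _, _, b, k), cols =>
    -- Every wire comes from a smaller level: `k` grows along the chain of `or` gates, an `and` gate
    -- is just below the `or` gate with the same `k`, and a child has one open bit fewer, which
    -- outweighs its restart at `k = 0`.
    (2 * A.states + 4) * openBits cols + 2 * (A.states - k) + if b then 1 else 2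

theorem openBits_child (b : Bool) (cols : List Column) (h : ∃ c ∈ cols, c.2.2 = none) :
    openBits (Column.child b cols) + 1 = openBits cols := by
  induction cols with
  | nil => simp at h
  | cons c cols ih =>
    obtain ⟨s, e, _ | a⟩ := c
    · simp [openBits, Column.child]
    · simpa [openBits, Column.child] using ih (by simpa using h)

/-- The class `some true` is entered only at an open bit. Hence the children of an `and` gate really
have fewer open bits. -/
theorem exists_none_of_class (N : List Bool) (cols : List Column) (q : A.TreeClass)
    (hq : q.1 ≠ some true)
    (h : ((N.zip cols).foldl (fun q x => A.treeNext q x.1 x.2) q).1 = some true) :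
    ∃ c ∈ cols, c.2.2 = none := by
  induction cols generalizing N q with
  | nil => simp [hq] at h
  | cons c cols ih =>
    rcases N with _ | ⟨a, N⟩
    · simp [hq] at h
    · rcases hc : c.2.2 with _ | p
      · exact ⟨c, List.mem_cons_self, hc⟩
      · obtain ⟨c', hc', h'⟩ := ih N _ (by
          rcases hq1 : q.1 with _ | _ | _
          · simp [treeNext, hc, hq1]
          · simp [treeNext, hc, hq1]
          · exact absurd hq1 hq) h
        exact ⟨c', List.mem_cons_of_mem _ hc', h'⟩

theorem compare_class (N : List Bool) (cols : List Column) (q : A.TreeClass) (hq : q.2.1 = none)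
    (hl : cols.length = N.length) :
    match ((N.zip cols).foldl (fun q x => A.treeNext q x.1 x.2) q).2.1 with
    | none => Column.address cols = binaryValue N
    | some true => Column.address cols < binaryValue N
    | some false => binaryValue N < Column.address cols := by
  induction N using List.reverseRecOn generalizing cols with
  | nil =>
    obtain rfl := List.length_eq_zero_iff.1 hl
    simp [hq, Column.address, binaryValue]
  | append_singleton N a ih =>
    rcases List.eq_nil_or_concat cols with rfl | ⟨cols, c, rfl⟩
    · simp at hl
    · rw [List.concat_eq_append] at hl ⊢
      have hl' : cols.length = N.length := by simpa using hl
      have ih := ih cols hl'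
      rw [List.zip_append hl'.symm, List.foldl_append]
      simp only [List.zip_cons_cons, List.zip_nil_left, List.foldl_cons, List.foldl_nil]
      generalize (N.zip cols).foldl (fun q x => A.treeNext q x.1 x.2) q = q' at ih ⊢
      have h1 : Column.address (cols ++ [c]) =
          2 * Column.address cols + (c.2.2.getD false).toNat := by
        simp [Column.address, binaryValue_concat]
      rw [h1, binaryValue_concat]
      simp only [treeNext]
      generalize c.2.2.getD false = p
      have := Bool.toNat_lt p
      have := Bool.toNat_lt a
      rcases h2 : q'.2.1 with _ | _ | _ <;> simp only [h2] at ih ⊢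
      · cases p <;> cases a <;> simp <;> omega
      · omega
      · omega

theorem binaryValue_msb (n : ℕ) : binaryValue (msb n) = n := by
  rw [msb, ← lsbValue_reverse, List.reverse_reverse, lsbValue_bits]

theorem treeShape_eq_inp {h : A.TreeHeader} {q : A.TreeClass} (hs : A.treeShape h q = .inp) :
    q.2.1 = some true := by
  unfold treeShape at hs
  split at hs
  · rfl
  · cases hs
  · rw [leafShape] at hs
    split_ifs at hs
  · split_ifs at hs
  · split_ifs at hs
  · cases hs

/-- The blueprint of the circuits that simulate an automaton. -/
def blueprint : Blueprint where
  Header := A.TreeHeader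
  Class := A.TreeClass
  start := (some false, none, A.infoStart)
  next := A.treeNext
  shape := A.treeShape
  level := A.treeLevel
  inp_lt n h cols hl hs := by
    have h1 := A.compare_class (msb n) cols (some false, none, A.infoStart) rfl
      (by rw [hl, length_msb])
    rw [A.treeShape_eq_inp hs, binaryValue_msb] at h1
    exact h1
  level_lt n h cols hl u hu := by
    have h1 := A.exists_none_of_class (msb n) cols (some false, none, A.infoStart) (by simp)
    generalize ((msb n).zip cols).foldl (fun q x => A.treeNext q x.1 x.2)
      (some false, none, A.infoStart) = q at h1 hu
    unfold treeShape at hu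
    split at hu
    · simp [Shape.preds] at hu
    · simp [Shape.preds] at hu
    · rw [leafShape] at hu
      split_ifs at hu <;> simp [Shape.preds] at hu <;> obtain rfl := hu <;>
        simp [treeLevel]
    · rename_i x q q' k _ _
      split_ifs at hu with hk
      · simp only [Shape.preds, List.mem_cons, List.not_mem_nil, or_false] at hu
        rcases hu with rfl | rfl
        · simp [treeLevel, Move.apply]
        · simp [treeLevel, Move.apply]
          omega
      · simp [Shape.preds] at hu
    · rename_i x q q' k _ _
      split_ifs at hu with hk
      · have h2 := fun b => openBits_child b cols (h1 rfl)
        simp only [Shape.preds, List.mem_cons, List.not_mem_nil, or_false] at hu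
        have h3 : ∀ b, (2 * A.states + 4) * openBits (Column.child b cols) + (2 * A.states + 4) =
            (2 * A.states + 4) * openBits cols := fun b => by rw [← h2 b]; ring
        have h4 := h3 false
        have h5 := h3 true
        rcases hu with rfl | rfl
        · simp [treeLevel, Move.apply]
          omega
        · simp [treeLevel, Move.apply]
          omega
      · simp [Shape.preds] at hu
    · simp [Shape.preds] at hu
  levelConst := 2 * A.states + 4
  level_le h cols := by
    rcases h with _ | ⟨x, q, q', b, k⟩
    · simp [treeLevel]
    · have h1 : openBits cols ≤ cols.length := List.countP_le_length
      have h2 := Nat.mul_le_mul_left (2 * A.states + 4) h1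
      rw [treeLevel, mul_add]
      split_ifs <;> omega
  rows := A.rows
  digits := A.digits
  rows_pos := A.rows_pos
  digits_pos := A.digits_pos
  root x := some (x, A.start, A.accept, false, 0)
  root_injective x y h := by simpa using h

/-! ### Columns of blocks of positions and their classes -/

/-- Columns with given first and second addresses, whose third address has given first bits. -/
def treeCols : List Bool → List Bool → List Bool → List Column
  | s :: S, e :: E, p :: P => (s, e, some p) :: treeCols S E P
  | s :: S, e :: E, [] => (s, e, none) :: treeCols S E []
  | _, _, _ => []

theorem length_treeCols (S E P : List Bool) (hE : E.length = S.length) :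
    (treeCols S E P).length = S.length := by
  induction S generalizing E P with
  | nil => simp [treeCols]
  | cons s S ih =>
    rcases E with _ | ⟨e, E⟩
    · simp at hE
    · cases P <;> simp [treeCols, ih E _ (by simpa using hE)]

theorem child_treeCols (S E P : List Bool) (b : Bool) (hE : E.length = S.length)
    (hP : P.length < S.length) :
    Column.child b (treeCols S E P) = treeCols S E (P ++ [b]) := by
  induction S generalizing E P with
  | nil => simp at hP
  | cons s S ih =>
    rcases E with _ | ⟨e, E⟩
    · simp at hE
    · cases P
      · simp [treeCols, Column.child]
      · simp [treeCols, Column.child, ih E _ (by simpa using hE) (by simpa using hP)]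

theorem treeCols_nil (w s e : ℕ) :
    treeCols (fixedBits w s) (fixedBits w e) [] = rootCols w s e := by
  have h : ∀ S E : List Bool, treeCols S E [] = List.zipWith (fun a b => (a, b, none)) S E := by
    intro S
    induction S with
    | nil => simp [treeCols]
    | cons a S ih =>
      rintro (_ | ⟨b, E⟩)
      · simp [treeCols]
      · simp [treeCols, ih E]
  exact h _ _

/-- The two cases of `hq` are the invariants after and before the end of the determined bits. -/
theorem class_treeCols_open (N S E P : List Bool) (q : A.TreeClass) (hN : N.length = S.length)
    (hE : E.length = S.length) (hP : P.length ≤ S.length)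
    (hq : q.1 = some true ∧ P = [] ∨ q.1 = some false ∧ P.length < S.length) :
    ((N.zip (treeCols S E P)).foldl (fun q x => A.treeNext q x.1 x.2) q).1 = some true := by
  induction S generalizing N E P q with
  | nil =>
    rcases hq with hq | hq
    · simpa [treeCols] using hq.1
    · simp at hq
  | cons s S ih =>
    rcases E with _ | ⟨e, E⟩
    · simp at hE
    rcases N with _ | ⟨a, N⟩
    · simp at hN
    rcases P with _ | ⟨p, P⟩
    · simp only [treeCols, List.zip_cons_cons, List.foldl_cons]
      refine ih N E [] _ (by simpa using hN) (by simpa using hE) (by simp) (Or.inl ⟨?_, rfl⟩)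
      rcases hq with hq | hq <;> simp [treeNext, hq.1]
    · rcases hq with hq | hq
      · simp at hq
      · simp only [treeCols, List.zip_cons_cons, List.foldl_cons]
        refine ih N E P _ (by simpa using hN) (by simpa using hE) (by simpa using hP)
          (Or.inr ⟨?_, by simpa using hq.2⟩)
        simp [treeNext, hq.1]

theorem class_treeCols_closed (N S E P : List Bool) (q : A.TreeClass) (hN : N.length = S.length)
    (hE : E.length = S.length) (hP : P.length = S.length) (hq : q.1 = some false) :
    ((N.zip (treeCols S E P)).foldl (fun q x => A.treeNext q x.1 x.2) q).1 = some false ∧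
    ((N.zip (treeCols S E P)).foldl (fun q x => A.treeNext q x.1 x.2) q).2.2 =
      A.info q.2.2 N S E P := by
  induction S generalizing N E P q with
  | nil =>
    obtain rfl := List.length_eq_zero_iff.1 hN
    simpa [treeCols, info] using hq
  | cons s S ih =>
    rcases E with _ | ⟨e, E⟩
    · simp at hE
    rcases N with _ | ⟨a, N⟩
    · simp at hN
    rcases P with _ | ⟨p, P⟩
    · simp at hP
    · simp only [treeCols, List.zip_cons_cons, List.foldl_cons, info]
      exact ih N E P _ (by simpa using hN) (by simpa using hE) (by simpa using hP)
        (by simp [treeNext, hq])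

theorem address_treeCols (S E P : List Bool) (hE : E.length = S.length)
    (hP : P.length = S.length) : Column.address (treeCols S E P) = binaryValue P := by
  have h : (treeCols S E P).map (fun c => c.2.2.getD false) = P := by
    induction S generalizing E P with
    | nil => simpa [treeCols, eq_comm] using hP
    | cons s S ih =>
      rcases E with _ | ⟨e, E⟩
      · simp at hE
      rcases P with _ | ⟨p, P⟩
      · simp at hP
      · simp [treeCols, ih E P (by simpa using hE) (by simpa using hP)]
  rw [Column.address, h]

/-! ### Values of the gates -/

variable {b : ℕ} (E : A.blueprint.Header ⊕ Column ≃ Fin (b + 1))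

/-- The value of a gate. -/
def gateValue (x : List Bool) (h : A.TreeHeader) (cols : List Column) : Bool :=
  ((A.blueprint.family E).circuit x.length).eval x.get (A.blueprint.gate E x.length h cols)

theorem label_gate (n : ℕ) (h : A.TreeHeader) (cols : List Column)
    (hl : cols.length = Nat.size n) :
    ((A.blueprint.family E).circuit n).label (A.blueprint.gate E n h cols) =
      A.blueprint.realize E n cols (A.treeShape h (A.blueprint.cls n cols)) := by
  change A.blueprint.label E n _ = _
  rw [Blueprint.label, A.blueprint.decode_gate E h hl]
  rfl

/-- The state in which the automaton is after it has read the positions in a block of length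
`2 ^ h`, whose first bits are given. -/
def runBlock (x : List Bool) (t : Fin A.rows × Fin A.digits) (S E : List Bool) :
    ℕ → List Bool → Fin A.states → Fin A.states
  | 0, P, q => A.step t (A.info A.infoStart (msb x.length) S E P) q x[binaryValue P]?
  | h + 1, P, q => runBlock x t S E h (P ++ [true]) (runBlock x t S E h (P ++ [false]) q)

/-- A leaf is one of the four Boolean functions of a single input bit, and a constant at a position
beyond the input. -/
theorem gateValue_leaf (x : List Bool) (t : Fin A.rows × Fin A.digits) (S E' P : List Bool)
    (hS : S.length = Nat.size x.length) (hE : E'.length = S.length) (hP : P.length = S.length)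
    (q q' : Fin A.states) :
    A.gateValue E x (some (t, q, q', false, 0)) (treeCols S E' P) =
      decide (A.runBlock x t S E' 0 P q = q') := by
  have hl : (treeCols S E' P).length = Nat.size x.length := (length_treeCols S E' P hE).trans hS
  have hN : (msb x.length).length = S.length := by rw [length_msb, hS]
  have hc := A.class_treeCols_closed (msb x.length) S E' P (some false, none, A.infoStart) hN hE
    hP rfl
  have hcmp := A.compare_class (msb x.length) (treeCols S E' P) (some false, none, A.infoStart) rfl
    (by rw [hl, length_msb])
  rw [binaryValue_msb, address_treeCols S E' P hE hP] at hcmp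
  change (A.blueprint.cls x.length (treeCols S E' P)).1 = some false ∧
    (A.blueprint.cls x.length (treeCols S E' P)).2.2 = _ at hc
  change match (A.blueprint.cls x.length (treeCols S E' P)).2.1 with
    | none => _
    | some true => _
    | some false => _ at hcmp
  have hlab := fun h => A.label_gate E x.length h _ hl
  generalize A.blueprint.cls x.length (treeCols S E' P) = c at hc hcmp hlab
  obtain ⟨c1, c2, c3⟩ := c
  obtain ⟨rfl, rfl⟩ := hc
  have hlt : c2 = some true ↔ binaryValue P < x.length := by
    rcases c2 with _ | _ | _ <;> simp only [reduceCtorEq, Option.some.injEq, Bool.false_eq_true,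
      false_iff, true_iff, not_lt] at hcmp ⊢ <;> omega
  have h0 := hlab (some (t, q, q', false, 0))
  simp only [treeShape, Fin.val_zero, if_true, leafShape] at h0
  rw [gateValue, runBlock]
  generalize A.info A.infoStart (msb x.length) S E' P = r at h0 ⊢
  by_cases hx : binaryValue P < x.length
  · have hin : ∀ u, u = A.blueprint.gate E x.length none (treeCols S E' P) →
        ((A.blueprint.family E).circuit x.length).eval x.get u = x[binaryValue P] := by
      rintro u rfl
      have h1 := hlab none
      rw [hlt.2 hx] at h1
      simp only [treeShape, Blueprint.realize] at h1
      have ha := address_treeCols S E' P hE hP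
      rw [dif_pos (by rw [ha]; exact hx)] at h1
      rw [Circuit.eval_input h1]
      simp [ha]
    rw [List.getElem?_eq_getElem hx]
    simp only [hlt.2 hx, decide_true, if_true] at h0
    split_ifs at h0 with h1 h2 h2
    · rw [Circuit.eval_const h0]
      cases x[binaryValue P] <;> simp [h1, h2]
    · rw [Circuit.eval_or h0]
      refine (congrArg₂ _ (hin _ rfl) (hin _ rfl)).trans ?_
      cases x[binaryValue P] <;> simp [h1, h2]
    · rw [Circuit.eval_not h0]
      refine (congrArg _ (hin _ rfl)).trans ?_
      cases x[binaryValue P] <;> simp [h1, h2]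
    · rw [Circuit.eval_const h0]
      cases x[binaryValue P] <;> simp [h1, h2]
  · rw [List.getElem?_eq_none (not_lt.1 hx)]
    simp only [mt hlt.1 hx, decide_false, Bool.false_eq_true, if_false] at h0
    rw [Circuit.eval_const h0]

/-- Divide and conquer: a block leads from `q` to `q'` if and only if its first half leads from `q`
to some state from which its second half leads to `q'`. The number of states is constant, so the
disjunction over this state has constant depth. -/
theorem gateValue_block (x : List Bool) (t : Fin A.rows × Fin A.digits) (S E' : List Bool)
    (hS : S.length = Nat.size x.length) (hE : E'.length = S.length) (h : ℕ) (P : List Bool)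
    (hP : P.length + h = S.length) (q q' : Fin A.states) :
    A.gateValue E x (some (t, q, q', false, 0)) (treeCols S E' P) =
      decide (A.runBlock x t S E' h P q = q') := by
  induction h generalizing P q q' with
  | zero => exact A.gateValue_leaf E x t S E' P hS hE hP q q'
  | succ h ih =>
    have hl : ∀ P, (treeCols S E' P).length = Nat.size x.length := fun P =>
      (length_treeCols S E' P hE).trans hS
    have hc := A.class_treeCols_open (msb x.length) S E' P (some false, none, A.infoStart)
      (by rw [length_msb, hS]) hE (by omega) (Or.inr ⟨rfl, by omega⟩)
    change (A.blueprint.cls x.length (treeCols S E' P)).1 = some true at hc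
    have hlab := fun h => A.label_gate E x.length h _ (hl P)
    have hch := fun b => child_treeCols S E' P b hE (by omega)
    generalize A.blueprint.cls x.length (treeCols S E' P) = c at hc hlab
    obtain ⟨c1, c2, c3⟩ := c
    obtain rfl : c1 = some true := hc
    have hand : ∀ k : ℕ, ∀ hk : k < A.states,
        A.gateValue E x (some (t, q, q', true, ⟨k, by omega⟩)) (treeCols S E' P) =
          (decide (A.runBlock x t S E' h (P ++ [false]) q = ⟨k, hk⟩) &&
            decide (A.runBlock x t S E' h (P ++ [true]) ⟨k, hk⟩ = q')) := by
      intro k hk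
      have h1 := hlab (some (t, q, q', true, ⟨k, by omega⟩))
      simp only [treeShape, hk, dif_pos, Blueprint.realize, Move.apply, hch] at h1
      rw [gateValue, Circuit.eval_and h1, ← ih _ (by simp; omega), ← ih _ (by simp; omega)]
      rfl
    -- The chain of `or` gates is followed from its end: for `k = A.states` the disjunction over the
    -- states not less than `k` is empty, and `d` counts the links back to the head.
    have hor : ∀ d k : ℕ, ∀ hk : k + d = A.states,
        A.gateValue E x (some (t, q, q', false, ⟨k, by omega⟩)) (treeCols S E' P) =
          decide (k ≤ (A.runBlock x t S E' h (P ++ [false]) q).1 ∧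
            A.runBlock x t S E' (h + 1) P q = q') := by
      intro d
      induction d with
      | zero =>
        intro k hk
        have h1 := hlab (some (t, q, q', false, ⟨k, by omega⟩))
        simp only [treeShape, show ¬k < A.states by omega, dif_neg, not_false_eq_true,
          Blueprint.realize] at h1
        rw [gateValue, Circuit.eval_const h1]
        have := (A.runBlock x t S E' h (P ++ [false]) q).2
        simp only [show ¬k ≤ (A.runBlock x t S E' h (P ++ [false]) q).1 by omega, false_and,
          decide_false]
      | succ d ihd =>
        intro k hk
        have hk' : k < A.states := by omega
        have h1 := hlab (some (t, q, q', false, ⟨k, by omega⟩))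
        simp only [treeShape, hk', dif_pos, Blueprint.realize, Move.apply] at h1
        have h2 := hand k hk'
        have h3 := ihd (k + 1) (by omega)
        rw [gateValue] at h2 h3 ⊢
        rw [Circuit.eval_or h1]
        refine (congrArg₂ _ h2 h3).trans ?_
        rw [runBlock, Bool.eq_iff_iff]
        simp only [Bool.or_eq_true, Bool.and_eq_true, decide_eq_true_eq]
        generalize A.runBlock x t S E' h (P ++ [false]) q = m
        constructor
        · rintro (⟨rfl, h4⟩ | ⟨h4, h5⟩)
          · exact ⟨le_rfl, h4⟩
          · exact ⟨by omega, h5⟩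
        · rintro ⟨h4, h5⟩
          rcases h4.eq_or_lt with h6 | h6
          · obtain rfl : m = ⟨k, hk'⟩ := Fin.ext h6.symm
            exact Or.inl ⟨rfl, h5⟩
          · exact Or.inr ⟨h6, h5⟩
    have := hor A.states 0 (zero_add _)
    simpa using this

theorem runBlock_eq_foldl (x : List Bool) (t : Fin A.rows × Fin A.digits) (S E : List Bool)
    (h : ℕ) (P : List Bool) (q : Fin A.states) :
    A.runBlock x t S E h P q =
      (List.range' (2 ^ h * binaryValue P) (2 ^ h)).foldl (fun q p =>
        A.step t (A.info A.infoStart (msb x.length) S E (fixedBits (P.length + h) p)) q x[p]?) q := by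
  induction h generalizing P q with
  | zero => simp [runBlock, fixedBits_binaryValue]
  | succ h ih =>
    rw [runBlock, ih, ih, pow_succ, mul_two, ← List.range'_append_1, List.foldl_append]
    simp only [binaryValue_concat, List.length_append, List.length_singleton, Bool.toNat_true,
      Bool.toNat_false]
    have e1 : 2 ^ h * (2 * binaryValue P + 0) = (2 ^ h + 2 ^ h) * binaryValue P := by ring
    have e2 : 2 ^ h * (2 * binaryValue P + 1) = (2 ^ h + 2 ^ h) * binaryValue P + 2 ^ h := by ring
    have e3 : P.length + 1 + h = P.length + (h + 1) := by ring
    rw [e1, e2, e3]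

/-- The output bit with the row `t`, the digit `r`, and the parameters `s` and `e`. -/
def outputBit (x : List Bool) (t : Fin A.rows × Fin A.digits) (s e : ℕ) : Bool :=
  decide ((List.range (2 ^ Nat.size x.length)).foldl (fun q p =>
    A.step t (A.info A.infoStart (msb x.length) (fixedBits (Nat.size x.length) s)
      (fixedBits (Nat.size x.length) e) (fixedBits (Nat.size x.length) p)) q x[p]?) A.start =
    A.accept)

/-- The function that is computed by the circuits. -/
def output (x : List Bool) : List Bool :=
  (List.range (A.digits * (2 ^ Nat.size x.length * (A.rows * 2 ^ Nat.size x.length)))).map fun j =>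
    A.outputBit x (⟨j / A.digits / 2 ^ Nat.size x.length % A.rows, Nat.mod_lt _ A.rows_pos⟩,
      ⟨j % A.digits, Nat.mod_lt _ A.digits_pos⟩) (j / A.digits % 2 ^ Nat.size x.length)
      (j / A.digits / 2 ^ Nat.size x.length / A.rows)

theorem run_family (x : List Bool) : (A.blueprint.family E).run x = A.output x := by
  rw [CircuitFamily.run, output]
  refine List.ext_getElem (by simp; rfl) fun j h1 h2 => ?_
  rw [List.getElem_ofFn, List.getElem_map, List.getElem_range]
  have h3 := A.gateValue_block E x
    (⟨j / A.digits / 2 ^ Nat.size x.length % A.rows, Nat.mod_lt _ A.rows_pos⟩,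
      ⟨j % A.digits, Nat.mod_lt _ A.digits_pos⟩)
    (fixedBits (Nat.size x.length) (j / A.digits % 2 ^ Nat.size x.length))
    (fixedBits (Nat.size x.length) (j / A.digits / 2 ^ Nat.size x.length / A.rows))
    (length_fixedBits _ _) (by simp [length_fixedBits]) (Nat.size x.length) []
    (by simp [length_fixedBits]) A.start A.accept
  rw [treeCols_nil, runBlock_eq_foldl] at h3
  rw [outputBit, List.range_eq_range']
  simp only [binaryValue, List.foldl_nil, mul_zero, List.length_nil, zero_add] at h3
  exact h3

/-- The function that is computed by a positional automaton is computable in `NC¹`. -/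
theorem nc1Computable_output : NC1Computable A.output := by
  obtain ⟨b, ⟨E⟩⟩ : ∃ b, Nonempty (A.blueprint.Header ⊕ Column ≃ Fin (b + 1)) := by
    have : Nonempty (A.blueprint.Header ⊕ Column) := ⟨.inr default⟩
    obtain ⟨b, ⟨E⟩⟩ := Finite.exists_equiv_fin (A.blueprint.Header ⊕ Column)
    obtain ⟨k, rfl⟩ : ∃ k, b = k + 1 := by
      refine Nat.exists_eq_succ_of_ne_zero ?_
      rintro rfl
      exact (E (.inr default)).elim0
    exact ⟨k, ⟨E⟩⟩
  exact ⟨A.blueprint.family E, A.blueprint.family_logDepth E,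
    A.blueprint.family_dLogTimeUniform E, fun x => (A.run_family E x).symm⟩

end PositionalAutomaton

/-! ### Finite information on linear forms -/

/-- The nearest number in the interval from `-B` to `B`. -/
def clamp (B v : ℤ) : ℤ := max (-B) (min B v)

theorem clamp_mem {B : ℤ} (hB : 0 ≤ B) (v : ℤ) : clamp B v ∈ Finset.Icc (-B) B := by
  rw [clamp, Finset.mem_Icc]
  omega

/-- A value beyond an end of the interval stays at or beyond this end when it is doubled and changed
by at most `B`. So a Horner scheme can be run on clamped values. -/
theorem clamp_step {B g v : ℤ} (hg : |g| ≤ B) : clamp B (2 * clamp B v + g) = clamp B (2 * v + g) := by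
  have := abs_le.1 hg
  simp only [clamp]
  omega

/-- The inequality is strict because the ends `B` and `-B` also represent all values beyond them. -/
theorem clamp_eq_iff {B k v : ℤ} (hk : |k| < B) : clamp B v = k ↔ v = k := by
  have := abs_lt.1 hk
  simp only [clamp]
  omega

/-- A linear form in the length of the input, the parameters `s` and `e`, the position `p`, and the
greatest number with a given number of bits. -/
structure LinearForm where
  onLength : ℤ
  onS : ℤ
  onE : ℤ
  onP : ℤ
  onTop : ℤ

namespace LinearForm

variable (f : LinearForm)

/-- The value of a linear form. -/
def eval (w n s e p : ℕ) : ℤ :=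
  f.onLength * n + f.onS * s + f.onE * e + f.onP * p + f.onTop * (2 ^ w - 1)

/-- The contribution of a single bit of each of the numbers. -/
def weight (a s e p : Bool) : ℤ :=
  f.onLength * a.toNat + f.onS * s.toNat + f.onE * e.toNat + f.onP * p.toNat + f.onTop

/-- A bound for the contributions of single bits. -/
def bound : ℤ := |f.onLength| + |f.onS| + |f.onE| + |f.onP| + |f.onTop|

theorem abs_weight_le (a s e p : Bool) : |f.weight a s e p| ≤ f.bound := by
  have h : ∀ (z : ℤ) (b : Bool), |z * b.toNat| ≤ |z| := fun z b => by cases b <;> simp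
  refine (abs_add_le _ _).trans (add_le_add ?_ le_rfl)
  refine (abs_add_le _ _).trans (add_le_add ?_ (h _ _))
  refine (abs_add_le _ _).trans (add_le_add ?_ (h _ _))
  exact (abs_add_le _ _).trans (add_le_add (h _ _) (h _ _))

end LinearForm

theorem binaryValue_cons (a : Bool) (l : List Bool) :
    binaryValue (a :: l) = 2 ^ l.length * a.toNat + binaryValue l := by
  induction l using List.reverseRecOn with
  | nil => simp [binaryValue]
  | append_singleton l b ih =>
    rw [← List.cons_append, binaryValue_concat, ih, binaryValue_concat, List.length_append,
      List.length_singleton, pow_succ]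
    ring

/-! ### Block codes and strings with a fixed layout -/

theorem BlockCode.flatMap_injective {A : Type*} (c : BlockCode A) (hc : 0 < c.len) :
    Function.Injective fun l : List A => l.flatMap c.code := by
  intro l l' h
  induction l generalizing l' with
  | nil =>
    rcases l' with _ | ⟨b, l'⟩
    · rfl
    · have := congrArg List.length h
      simp only [List.flatMap_nil, List.length_nil, List.flatMap_cons, List.length_append,
        c.length_code] at this
      omega
  | cons a l ih =>
    rcases l' with _ | ⟨b, l'⟩
    · have := congrArg List.length h
      simp only [List.flatMap_nil, List.length_nil, List.flatMap_cons, List.length_append,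
        c.length_code] at this
      omega
    · have := List.append_inj (show c.code a ++ l.flatMap c.code = c.code b ++ l'.flatMap c.code
        from h) (by rw [c.length_code, c.length_code])
      rw [c.code_injective this.1, ih this.2]

/-- A string of symbols in rows, whose slots consist of a number of places, in blocks. -/
def layout {B : Type*} (rows places w : ℕ) (f : ℕ → ℕ → ℕ → ℕ → B) : List B :=
  (List.range (2 ^ w)).flatMap fun e => (List.range rows).flatMap fun t =>
    (List.range (2 ^ w)).flatMap fun s => (List.range places).map fun m => f e t s m

/-- Turns the flat enumeration of the output bits into the nested loops of `layout`. -/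
theorem range_mul_flatMap {C : Type*} (a b : ℕ) (f : ℕ → ℕ → List C) :
    (List.range (a * b)).flatMap (fun j => f (j / a) (j % a)) =
      (List.range b).flatMap fun i => (List.range a).flatMap fun j => f i j := by
  induction b with
  | zero => simp
  | succ b ih =>
    rw [mul_add, mul_one, List.range_add, List.flatMap_append, ih, List.range_succ,
      List.flatMap_append, List.flatMap_singleton, List.flatMap_map]
    congr 1
    refine List.flatMap_congr fun j hj => ?_
    have hj := List.mem_range.1 hj
    rw [Nat.mul_add_div (by omega), Nat.div_eq_of_lt hj, add_zero, Nat.mul_add_mod,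
      Nat.mod_eq_of_lt hj]

/-! ### Translations of strings of symbols by finite automata -/

/-- The distinguished properties of the position of a symbol in a string, for given parameters. -/
structure Tag where
  slot : Bool
  last : Bool
  next : Bool
  digit : Bool

/-- A letter-to-block translation of strings over `A`, which are given by a binary code, into strings
over `B`: the symbol in the place `m` of the slot `s` of the row `t` of the block `e` depends only on
the state of a finite automaton, which has read the string, and on whether `s = 0`. The automaton is
told at which symbols certain equations between the position and `s`, `e`, `m` are satisfied. -/
structure Translation (A B σ : Type*) where
  source : BlockCode A
  target : BlockCode B
  places : ℕ
  rows : ℕ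
  source_pos : 0 < source.len
  target_pos : 0 < target.len
  places_pos : 0 < places
  rows_pos : 0 < rows
  init : σ
  step : Tag → σ → A → Option σ
  symbol : ℕ → ℕ → Bool → Option σ → B

namespace Translation

variable {A B σ : Type*} (R : Translation A B σ)

/-- The tag of the position `i`. -/
def tag (w s e m i : ℕ) : Tag where
  slot := i = s
  last := i = e
  next := i = e + 1
  -- In a row, the place `m` of the slot `s` is followed by this many symbols. The digit sought has
  -- the same distance from the end `e` of the pair, so numbers are aligned at their last digits.
  digit := i + R.places * (2 ^ w - 1 - s) + (R.places - 1 - m) = e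

/-- The state after a string of symbols that starts at the position `i`. -/
def run (T : ℕ → Tag) : ℕ → List A → σ → Option σ
  | _, [], q => some q
  | i, a :: l, q => (R.step (T i) q a).bind (run T (i + 1) l)

theorem run_append (T : ℕ → Tag) (i : ℕ) (l l' : List A) (q : σ) :
    R.run T i (l ++ l') q = (R.run T i l q).bind (R.run T (i + l.length) l') := by
  induction l generalizing i q with
  | nil => rfl
  | cons a l ih =>
    rw [List.cons_append, run, run, Option.bind_assoc]
    congr 1
    funext q'
    rw [ih, List.length_cons]
    congr 2
    omega

/-- The linear forms that determine the tags of the positions. -/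
def form : Fin 5 → LinearForm
  -- The symbol `i` ends with the bit `p = len * (i + 1) - 1`. Writing `len` for the source length,
  -- the forms are `p - len * e`, `p - len * s`, the form for `Tag.digit` with `onTop` supplying `2
  -- ^ w - 1`, `p - n`, and `s`.
  | 0 => ⟨0, 0, -R.source.len, 1, 0⟩
  | 1 => ⟨0, -R.source.len, 0, 1, 0⟩
  | 2 => ⟨0, -(R.source.len * R.places), -R.source.len, 1, R.source.len * R.places⟩
  | 3 => ⟨-1, 0, 0, 1, 0⟩
  | 4 => ⟨0, 1, 0, 0, 0⟩

/-- A bound for the relevant values of the linear forms. -/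
def bound : ℤ :=
  -- The sum serves `clamp_step`; the rest exceeds the constants in `infoTag`, as `clamp_eq_iff`
  -- requires.
  (∑ i, (R.form i).bound) + 2 * R.source.len + R.source.len * R.places + 1

theorem form_bound_nonneg (i : Fin 5) : 0 ≤ (R.form i).bound := by
  rw [LinearForm.bound]
  positivity

theorem form_bound_le (i : Fin 5) : (R.form i).bound ≤ R.bound := by
  have := Finset.single_le_sum (fun i _ => R.form_bound_nonneg i) (Finset.mem_univ i)
  rw [bound]
  have : (0 : ℤ) ≤ R.source.len * R.places := by positivity
  omega

theorem bound_gt : (2 * R.source.len + R.source.len * R.places : ℤ) < R.bound := by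
  have := Finset.sum_nonneg fun i (_ : i ∈ Finset.univ) => R.form_bound_nonneg i
  rw [bound]
  omega

/-- The finite information on the values of the linear forms. -/
abbrev Info : Type := Fin 5 → Finset.Icc (-R.bound) R.bound

theorem bound_nonneg : 0 ≤ R.bound := (R.form_bound_nonneg 0).trans (R.form_bound_le 0)

/-- The tag, determined from the information. -/
def infoTag (m : ℕ) (r : R.Info) : Tag where
  slot := (r 1 : ℤ) = R.source.len - 1
  last := (r 0 : ℤ) = R.source.len - 1
  next := (r 0 : ℤ) = 2 * R.source.len - 1
  digit := (r 2 : ℤ) = R.source.len - 1 - R.source.len * (R.places - 1 - m : ℕ)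

/-- The states of the automaton that reads single bits. -/
inductive BitState (R : Translation A B σ)
  | run (buf : {l : List Bool // l.length < R.source.len}) (q : Option σ)
  | halt (b : Bool)

instance [Finite σ] : Finite R.BitState := by
  have : Finite {l : List Bool // l.length < R.source.len} :=
    (List.finite_length_lt Bool R.source.len).to_subtype
  refine Finite.of_injective (fun q : R.BitState => match q with
    | .run buf q => (Sum.inl (buf, q) : ({l : List Bool // l.length < R.source.len} × Option σ) ⊕ Bool)
    | .halt b => Sum.inr b) ?_
  rintro (⟨b, q⟩ | b) (⟨b', q'⟩ | b') h <;> simp_all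

/-- The bit that is written for a state. -/
def outBit (t r : ℕ) (z : Bool) (q : Option σ) : Bool :=
  (R.target.code (R.symbol t (r / R.target.len) z q)).getD (r % R.target.len) false

open Classical in
/-- A step of the automaton that reads single bits. -/
noncomputable def bitStep (t r : ℕ) (i : R.Info) : R.BitState → Option Bool → R.BitState
  | .run buf q, some b =>
    if h : (buf.1 ++ [b]).length < R.source.len then .run ⟨buf.1 ++ [b], h⟩ q
    else .run ⟨[], R.source_pos⟩
      (if h : ∃ a, R.source.code a = buf.1 ++ [b] then
        q.bind fun q => R.step (R.infoTag (r / R.target.len) i) q h.choose else none)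
  | .run buf q, none =>
    -- The form `3` vanishes at the first position after the string, which exists because `n < 2 ^
    -- Nat.size n`. A non-empty buffer at this point is an incomplete codeword.
    if (i 3 : ℤ) = 0 then
      .halt (R.outBit t r (decide ((i 4 : ℤ) = 0)) (if buf.1 = [] then q else none))
    else .run buf q
  | .halt b, _ => .halt b

theorem flatMap_code_append {y z : List Bool} {l : List A} (hz : z.length = R.source.len)
    (h : y ++ z = l.flatMap R.source.code) :
    ∃ l' a, l = l' ++ [a] ∧ y = l'.flatMap R.source.code ∧ z = R.source.code a := by
  rcases List.eq_nil_or_concat l with rfl | ⟨l', a, rfl⟩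
  · have := R.source_pos
    have := congrArg List.length h
    rw [List.length_append, List.flatMap_nil, List.length_nil] at this
    omega
  · rw [List.concat_eq_append] at h ⊢
    rw [List.flatMap_append, List.flatMap_singleton] at h
    have := List.append_inj' h (by rw [hz, R.source.length_code])
    exact ⟨l', a, rfl, this.1, this.2⟩

theorem length_flatMap_code (l : List A) :
    (l.flatMap R.source.code).length = R.source.len * l.length := by
  rw [List.length_flatMap, List.map_congr_left (fun a _ => R.source.length_code a)]
  simp [mul_comm]

variable [Finite σ]

/-- An enumeration of the states. -/
noncomputable def stateEquiv : R.BitState ≃ Fin (Nat.card R.BitState) := Finite.equivFin _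

/-- The automaton that computes the translation bit by bit. -/
noncomputable def automaton : PositionalAutomaton where
  rows := R.rows
  digits := R.places * R.target.len
  rows_pos := R.rows_pos
  digits_pos := Nat.mul_pos R.places_pos R.target_pos
  states := Nat.card R.BitState
  Info := R.Info
  infoStart := fun _ => ⟨clamp R.bound 0, clamp_mem R.bound_nonneg _⟩
  infoNext r a s e p := fun i =>
    ⟨clamp R.bound (2 * (r i : ℤ) + (R.form i).weight a s e p), clamp_mem R.bound_nonneg _⟩
  step x i q b := R.stateEquiv (R.bitStep x.1 x.2 i (R.stateEquiv.symm q) b)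
  start := R.stateEquiv (.run ⟨[], R.source_pos⟩ (some R.init))
  accept := R.stateEquiv (.halt true)

/-- Horner's scheme from the most significant bit: `v` is the exact value of the form on the bits
read so far, of which only the clamped value is stored. -/
theorem info_eq (r : R.Info) (i : Fin 5) (v : ℤ) (hr : (r i : ℤ) = clamp R.bound v)
    (N S E P : List Bool) (hS : S.length = N.length) (hE : E.length = N.length)
    (hP : P.length = N.length) :
    ((R.automaton.info r N S E P : R.Info) i : ℤ) = clamp R.bound (2 ^ N.length * v +
      (R.form i).eval N.length (binaryValue N) (binaryValue S) (binaryValue E) (binaryValue P)) := by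
  induction N generalizing S E P r v with
  | nil =>
    obtain rfl := List.length_eq_zero_iff.1 hS
    obtain rfl := List.length_eq_zero_iff.1 hE
    obtain rfl := List.length_eq_zero_iff.1 hP
    simpa [PositionalAutomaton.info, LinearForm.eval, binaryValue] using hr
  | cons a N ih =>
    rcases S with _ | ⟨s, S⟩
    · simp at hS
    rcases E with _ | ⟨e, E⟩
    · simp at hE
    rcases P with _ | ⟨p, P⟩
    · simp at hP
    simp only [List.length_cons, Nat.add_right_cancel_iff] at hS hE hP
    refine (ih (R.automaton.infoNext r a s e p) (2 * v + (R.form i).weight a s e p) ?_ S E P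
      hS hE hP).trans ?_
    rotate_left
    · simp only [binaryValue_cons, LinearForm.eval, LinearForm.weight, hS, hE, hP,
        List.length_cons]
      congr 1
      push_cast
      ring
    · change clamp R.bound (2 * (r i : ℤ) + (R.form i).weight a s e p) = _
      rw [hr, clamp_step (((R.form i).abs_weight_le a s e p).trans (R.form_bound_le i))]

/-- The information on the position `p`. -/
noncomputable def infoAt (n s e p : ℕ) : R.Info :=
  R.automaton.info R.automaton.infoStart (msb n) (fixedBits (Nat.size n) s)
    (fixedBits (Nat.size n) e) (fixedBits (Nat.size n) p)

variable {n s e p : ℕ}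

theorem infoAt_eq (hs : s < 2 ^ Nat.size n) (he : e < 2 ^ Nat.size n) (hp : p < 2 ^ Nat.size n)
    (i : Fin 5) {k : ℤ} (hk : |k| < R.bound) :
    (R.infoAt n s e p i : ℤ) = k ↔ (R.form i).eval (Nat.size n) n s e p = k := by
  rw [show (R.infoAt n s e p i : ℤ) = _ from R.info_eq R.automaton.infoStart i 0 rfl (msb n) _ _ _
    (by simp [length_fixedBits, length_msb]) (by simp [length_fixedBits, length_msb])
    (by simp [length_fixedBits, length_msb]), mul_zero,
    zero_add, clamp_eq_iff hk, PositionalAutomaton.binaryValue_msb, binaryValue_fixedBits,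
    binaryValue_fixedBits, binaryValue_fixedBits, Nat.mod_eq_of_lt hs, Nat.mod_eq_of_lt he,
    Nat.mod_eq_of_lt hp, length_msb]

theorem infoAt_end (hs : s < 2 ^ Nat.size n) (he : e < 2 ^ Nat.size n) (hp : p < 2 ^ Nat.size n) :
    (R.infoAt n s e p 3 : ℤ) = 0 ↔ p = n := by
  rw [R.infoAt_eq hs he hp 3 (by have := R.bound_gt; rw [abs_zero]; refine lt_of_le_of_lt ?_ this; positivity)]
  simp only [form, LinearForm.eval]
  omega

theorem infoAt_zero (hs : s < 2 ^ Nat.size n) (he : e < 2 ^ Nat.size n)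
    (hp : p < 2 ^ Nat.size n) : (R.infoAt n s e p 4 : ℤ) = 0 ↔ s = 0 := by
  rw [R.infoAt_eq hs he hp 4 (by have := R.bound_gt; rw [abs_zero]; refine lt_of_le_of_lt ?_ this; positivity)]
  simp only [form, LinearForm.eval]
  omega

/-- At the last bit of the symbol `i`, the difference of the two sides of each equation in `infoTag`
is the code length times that of the equation in `tag`, and the code length cancels. -/
theorem infoTag_infoAt (hs : s < 2 ^ Nat.size n) (he : e < 2 ^ Nat.size n)
    (hp : p < 2 ^ Nat.size n) (m i : ℕ) (hm : m < R.places) (hi : p + 1 = R.source.len * (i + 1)) :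
    R.infoTag m (R.infoAt n s e p) = R.tag (Nat.size n) s e m i := by
  have hb := R.bound_gt
  have hl : (0 : ℤ) < R.source.len := by exact_mod_cast R.source_pos
  have hM : (0 : ℤ) < R.places := by exact_mod_cast R.places_pos
  have hlM : (0 : ℤ) < R.source.len * R.places := mul_pos hl hM
  have hi' : (p : ℤ) = R.source.len * (i + 1) - 1 := by
    have : ((p + 1 : ℕ) : ℤ) = (R.source.len * (i + 1) : ℕ) := by rw [hi]
    push_cast at this
    linarith
  have hq : ((R.places - 1 - m : ℕ) : ℤ) = R.places - 1 - m := by omega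
  have hk2 : |(R.source.len - 1 - R.source.len * (R.places - 1 - m : ℕ) : ℤ)| < R.bound := by
    have h1 : (R.source.len * (R.places - 1 - m : ℕ) : ℤ) ≤ R.source.len * R.places :=
      mul_le_mul_of_nonneg_left (by omega) hl.le
    have h2 : (0 : ℤ) ≤ R.source.len * (R.places - 1 - m : ℕ) := by positivity
    rw [abs_lt]
    constructor <;> linarith
  have hk0 : |(R.source.len - 1 : ℤ)| < R.bound := by
    rw [abs_lt]
    constructor <;> linarith
  have hk1 : |(2 * R.source.len - 1 : ℤ)| < R.bound := by
    rw [abs_lt]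
    constructor <;> linarith
  have hcancel : ∀ z : ℤ, (R.source.len : ℤ) * z = 0 ↔ z = 0 := fun z => by
    rw [mul_eq_zero, or_iff_right hl.ne']
  have hw : ((2 ^ Nat.size n - 1 - s : ℕ) : ℤ) = 2 ^ Nat.size n - 1 - s := by
    have : ((2 ^ Nat.size n : ℕ) : ℤ) = 2 ^ Nat.size n := by push_cast; rfl
    omega
  simp only [infoTag, tag, Tag.mk.injEq, decide_eq_decide]
  rw [R.infoAt_eq hs he hp 1 hk0, R.infoAt_eq hs he hp 0 hk0, R.infoAt_eq hs he hp 0 hk1,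
    R.infoAt_eq hs he hp 2 hk2]
  simp only [form, LinearForm.eval, hi']
  refine ⟨?_, ?_, ?_, ?_⟩
  · rw [← sub_eq_zero, show ∀ l i s : ℤ, 0 * (n : ℤ) + -l * s + 0 * (e : ℤ) + 1 * (l * (i + 1) - 1) +
      0 * (2 ^ Nat.size n - 1) - (l - 1) = l * (i - s) by intros; ring, hcancel]
    omega
  · rw [← sub_eq_zero, show ∀ l i e : ℤ, 0 * (n : ℤ) + 0 * (s : ℤ) + -l * e + 1 * (l * (i + 1) - 1) +
      0 * (2 ^ Nat.size n - 1) - (l - 1) = l * (i - e) by intros; ring, hcancel]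
    omega
  · rw [← sub_eq_zero, show ∀ l i e : ℤ, 0 * (n : ℤ) + 0 * (s : ℤ) + -l * e + 1 * (l * (i + 1) - 1) +
      0 * (2 ^ Nat.size n - 1) - (2 * l - 1) = l * (i - e - 1) by intros; ring, hcancel]
    omega
  · rw [← sub_eq_zero, show ∀ l i e s M t q : ℤ, 0 * (n : ℤ) + -(l * M) * s + -l * e +
      1 * (l * (i + 1) - 1) + l * M * (t - 1) - (l - 1 - l * q) =
      l * (i + M * (t - 1 - s) + q - e) by intros; ring, hcancel, ← hw]
    push_cast [← Int.natCast_inj]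
    exact sub_eq_zero

/-! ### Runs of the automaton on bits -/

/-- The state after the first bits of a string. -/
noncomputable def bitRun (x : List Bool) (t r s e k : ℕ) : R.BitState :=
  (List.range k).foldl (fun q p => R.bitStep t r (R.infoAt x.length s e p) q x[p]?)
    (.run ⟨[], R.source_pos⟩ (some R.init))

theorem outputBit_iff (x : List Bool) (y : Fin R.automaton.rows × Fin R.automaton.digits)
    (s e : ℕ) :
    R.automaton.outputBit x y s e = true ↔
      R.bitRun x y.1 y.2 s e (2 ^ Nat.size x.length) = .halt true := by
  have h : ∀ (l : List ℕ) (q : R.BitState), l.foldl (fun q p =>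
      R.stateEquiv (R.bitStep y.1 y.2 (R.infoAt x.length s e p) (R.stateEquiv.symm q) x[p]?))
        (R.stateEquiv q) =
      R.stateEquiv (l.foldl (fun q p => R.bitStep y.1 y.2 (R.infoAt x.length s e p) q x[p]?) q) := by
    intro l
    induction l with
    | nil => exact fun q => rfl
    | cons p l ih =>
      intro q
      rw [List.foldl_cons, List.foldl_cons, ← ih, Equiv.symm_apply_apply]
  rw [PositionalAutomaton.outputBit, decide_eq_true_iff, bitRun, ← R.stateEquiv.apply_eq_iff_eq,
    ← h]
  exact Iff.rfl

/-- Invariant: the prefix consists of complete blocks `y` and a buffer. The state `none` alone does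
not tell that `y` is not a code, since `R.step` may fail as well; hence the two alternatives. -/
theorem bitRun_spec (x : List Bool) (t r s e k : ℕ) (hs : s < 2 ^ Nat.size x.length)
    (he : e < 2 ^ Nat.size x.length) (hk : k ≤ x.length)
    (hr : r / R.target.len < R.places) :
    ∃ (y : List Bool) (buf : {l : List Bool // l.length < R.source.len}) (q : Option σ),
      x.take k = y ++ buf.1 ∧ R.bitRun x t r s e k = .run buf q ∧ R.source.len ∣ y.length ∧
      ((∃ l : List A, y = l.flatMap R.source.code ∧
        q = R.run (R.tag (Nat.size x.length) s e (r / R.target.len)) 0 l R.init) ∨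
      (q = none ∧ ¬∃ l : List A, y = l.flatMap R.source.code)) := by
  induction k with
  | zero => exact ⟨[], ⟨[], R.source_pos⟩, some R.init, rfl, rfl, by simp, Or.inl ⟨[], rfl, rfl⟩⟩
  | succ k ih =>
    obtain ⟨y, buf, q, h1, h2, h3, h4⟩ := ih (by omega)
    have hkx : k < x.length := by omega
    have hstep : R.bitRun x t r s e (k + 1) =
        R.bitStep t r (R.infoAt x.length s e k) (.run buf q) (some x[k]) := by
      rw [← h2, bitRun, bitRun, List.range_succ, List.foldl_append]
      simp [List.getElem?_eq_getElem hkx]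
    have htake : x.take (k + 1) = y ++ (buf.1 ++ [x[k]]) := by
      rw [List.take_succ_eq_append_getElem hkx, h1, List.append_assoc]
    by_cases hb : (buf.1 ++ [x[k]]).length < R.source.len
    · refine ⟨y, ⟨_, hb⟩, q, htake, ?_, h3, h4⟩
      rw [hstep, bitStep, dif_pos hb]
    · have hlen : (buf.1 ++ [x[k]]).length = R.source.len := by
        have := buf.2
        simp only [List.length_append, List.length_singleton] at hb ⊢
        omega
      rw [bitStep, dif_neg hb] at hstep
      refine ⟨y ++ (buf.1 ++ [x[k]]), ⟨[], R.source_pos⟩, _, by rw [htake, List.append_nil],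
        hstep, ?_, ?_⟩
      · rw [List.length_append, hlen]
        exact (Nat.dvd_add_right h3).2 dvd_rfl
      · rcases h4 with ⟨l, rfl, rfl⟩ | ⟨rfl, h4⟩
        · by_cases ha : ∃ a, R.source.code a = buf.1 ++ [x[k]]
          · rw [dif_pos ha]
            refine Or.inl ⟨l ++ [ha.choose], ?_, ?_⟩
            · rw [List.flatMap_append, List.flatMap_singleton, ha.choose_spec]
            · have hpos : k + 1 = R.source.len * (l.length + 1) := by
                have h5 := congrArg List.length htake
                rw [List.length_take, min_eq_left hk, List.length_append, hlen,
                  R.length_flatMap_code] at h5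
                rw [h5]
                ring
              have hkw : k < 2 ^ Nat.size x.length := hkx.trans (Nat.lt_size_self _)
              rw [run_append, R.infoTag_infoAt hs he hkw _ _ hr hpos, zero_add]
              congr 1
              funext q
              simp [run]
          · rw [dif_neg ha]
            refine Or.inr ⟨rfl, ?_⟩
            rintro ⟨l', h5⟩
            obtain ⟨_, a, _, _, h6⟩ := R.flatMap_code_append hlen h5
            exact ha ⟨a, h6.symm⟩
        · refine Or.inr ⟨by split_ifs <;> rfl, ?_⟩
          rintro ⟨l', h5⟩
          obtain ⟨l'', a, _, h6, _⟩ := R.flatMap_code_append hlen h5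
          exact h4 ⟨l'', h6⟩

theorem bitRun_halt (x : List Bool) (t r s e : ℕ) (hs : s < 2 ^ Nat.size x.length)
    (he : e < 2 ^ Nat.size x.length) (hr : r / R.target.len < R.places) :
    ∃ q : Option σ, R.bitRun x t r s e (2 ^ Nat.size x.length) =
        .halt (R.outBit t r (decide (s = 0)) q) ∧
      ((∃ l : List A, x = l.flatMap R.source.code ∧
        q = R.run (R.tag (Nat.size x.length) s e (r / R.target.len)) 0 l R.init) ∨
      (q = none ∧ ¬∃ l : List A, x = l.flatMap R.source.code)) := by
  obtain ⟨y, buf, q, h1, h2, h3, h4⟩ := R.bitRun_spec x t r s e x.length hs he le_rfl hr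
  rw [List.take_length] at h1
  have hlt : x.length < 2 ^ Nat.size x.length := Nat.lt_size_self _
  refine ⟨if buf.1 = [] then q else none, ?_, ?_⟩
  -- The automaton halts at the position `x.length` and ignores the remaining `d` positions.
  · obtain ⟨d, hd⟩ : ∃ d, 2 ^ Nat.size x.length = x.length + 1 + d :=
      ⟨2 ^ Nat.size x.length - (x.length + 1), by omega⟩
    rw [hd]
    clear hd
    induction d with
    | zero =>
      have h5 : R.bitRun x t r s e (x.length + 1) =
          R.bitStep t r (R.infoAt x.length s e x.length) (.run buf q) none := by
        rw [← h2, bitRun, bitRun, List.range_succ, List.foldl_append]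
        simp
      rw [add_zero, h5, bitStep, if_pos ((R.infoAt_end hs he hlt).2 rfl),
        decide_eq_decide.2 (R.infoAt_zero hs he hlt)]
    | succ d ih =>
      have h5 : R.bitRun x t r s e (x.length + 1 + (d + 1)) =
          R.bitStep t r (R.infoAt x.length s e (x.length + 1 + d))
            (R.bitRun x t r s e (x.length + 1 + d)) x[x.length + 1 + d]? := by
        rw [← add_assoc, bitRun, bitRun, List.range_succ, List.foldl_append]
        rfl
      rw [h5, ih, bitStep]
  · by_cases hb : buf.1 = []
    · rw [if_pos hb]
      rw [hb, List.append_nil] at h1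
      obtain rfl := h1
      exact h4
    · rw [if_neg hb]
      refine Or.inr ⟨rfl, ?_⟩
      rintro ⟨l, hl⟩
      have h5 := congrArg List.length hl
      rw [R.length_flatMap_code, h1, List.length_append] at h5
      have h6 : R.source.len ∣ buf.1.length := (Nat.dvd_add_right h3).1 ⟨l.length, h5⟩
      exact hb (List.length_eq_zero_iff.1 (Nat.eq_zero_of_dvd_of_lt h6 buf.2))

/-- Every bit comes from a run of its own, but the tags depend only on block, slot and place. So the
bits of one symbol, in any row, see the same final state `q e s m` and form one codeword. -/
theorem output_automaton (x : List Bool) :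
    ∃ q : ℕ → ℕ → ℕ → Option σ,
      R.automaton.output x = (layout R.rows R.places (Nat.size x.length) fun e t s m =>
        R.symbol t m (decide (s = 0)) (q e s m)).flatMap R.target.code ∧
      ((∃ l : List A, x = l.flatMap R.source.code ∧
        ∀ e < 2 ^ Nat.size x.length, ∀ s < 2 ^ Nat.size x.length, ∀ m < R.places,
          q e s m = R.run (R.tag (Nat.size x.length) s e m) 0 l R.init) ∨
      ((∀ e s m, q e s m = none) ∧ ¬∃ l : List A, x = l.flatMap R.source.code)) := by
  set w := Nat.size x.length with hw
  obtain ⟨q, hq, hq'⟩ : ∃ q : ℕ → ℕ → ℕ → Option σ,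
      (∀ e < 2 ^ w, ∀ s < 2 ^ w, ∀ t r, r / R.target.len < R.places → R.bitRun x t r s e (2 ^ w) =
        .halt (R.outBit t r (decide (s = 0)) (q e s (r / R.target.len)))) ∧
      ((∃ l : List A, x = l.flatMap R.source.code ∧
        ∀ e < 2 ^ w, ∀ s < 2 ^ w, ∀ m < R.places,
          q e s m = R.run (R.tag w s e m) 0 l R.init) ∨
      ((∀ e s m, q e s m = none) ∧ ¬∃ l : List A, x = l.flatMap R.source.code)) := by
    by_cases hx : ∃ l : List A, x = l.flatMap R.source.code
    · obtain ⟨l, hl⟩ := hx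
      refine ⟨fun e s m => R.run (R.tag w s e m) 0 l R.init, ?_,
        Or.inl ⟨l, hl, fun e _ s _ m _ => rfl⟩⟩
      intro e he s hs t r hr
      obtain ⟨q, h1, ⟨l', h2, rfl⟩ | ⟨-, h2⟩⟩ := R.bitRun_halt x t r s e hs he hr
      · obtain rfl : l' = l := by
          refine R.source.flatMap_injective R.source_pos ?_
          exact h2.symm.trans hl
        exact h1
      · exact absurd ⟨l, hl⟩ h2
    · refine ⟨fun _ _ _ => none, ?_, Or.inr ⟨fun _ _ _ => rfl, hx⟩⟩
      intro e he s hs t r hr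
      obtain ⟨q, h1, ⟨l', h2, rfl⟩ | ⟨rfl, h2⟩⟩ := R.bitRun_halt x t r s e hs he hr
      · exact absurd ⟨l', h2⟩ hx
      · exact h1
  refine ⟨q, ?_, hq'⟩
  have hb : ∀ y : Fin R.automaton.rows × Fin R.automaton.digits, ∀ s < 2 ^ w, ∀ e < 2 ^ w,
      R.automaton.outputBit x y s e =
        R.outBit y.1 y.2 (decide (s = 0)) (q e s (y.2 / R.target.len)) := by
    intro y s hs e he
    have hy : y.2.1 / R.target.len < R.places := by
      refine Nat.div_lt_of_lt_mul ?_
      rw [mul_comm]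
      exact y.2.2
    rw [Bool.eq_iff_iff, R.outputBit_iff, ← hw, hq e he s hs _ _ hy, BitState.halt.injEq]
  have hcode : ∀ b : B, R.target.code b =
      (List.range R.target.len).map fun k => (R.target.code b).getD k false := by
    intro b
    refine List.ext_getElem (by simp [R.target.length_code]) fun i h1 h2 => ?_
    simp [List.getElem?_eq_getElem h1]
  have h1 : R.automaton.output x = (List.range (R.places * R.target.len *
      (2 ^ w * (R.rows * 2 ^ w)))).map fun j =>
        R.outBit (j / (R.places * R.target.len) / 2 ^ w % R.rows) (j % (R.places * R.target.len))
          (decide (j / (R.places * R.target.len) % 2 ^ w = 0))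
          (q (j / (R.places * R.target.len) / 2 ^ w / R.rows)
            (j / (R.places * R.target.len) % 2 ^ w)
            (j % (R.places * R.target.len) / R.target.len)) := by
    refine List.map_congr_left fun j hj => hb _ _ (Nat.mod_lt _ (by positivity)) _ ?_
    rw [Nat.div_div_eq_div_mul, Nat.div_div_eq_div_mul]
    refine Nat.div_lt_of_lt_mul ?_
    have := List.mem_range.1 hj
    rwa [mul_assoc, mul_assoc] at *
  have h2 := fun g : ℕ → ℕ → ℕ → ℕ → List Bool =>
    range_mul_flatMap (R.places * R.target.len) (2 ^ w * (R.rows * 2 ^ w))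
      (fun i r => g (i / 2 ^ w / R.rows) (i / 2 ^ w % R.rows) (i % 2 ^ w) r)
  have h3 := fun g : ℕ → ℕ → ℕ → List Bool =>
    range_mul_flatMap (2 ^ w) (R.rows * 2 ^ w) (fun i s => g (i / R.rows) (i % R.rows) s)
  have h4 := range_mul_flatMap (C := Bool) R.rows (2 ^ w)
  rw [h1, List.map_eq_flatMap,
    h2 fun e t s r => [R.outBit t r (decide (s = 0)) (q e s (r / R.target.len))],
    h3 fun e t s => (List.range (R.places * R.target.len)).flatMap fun r =>
      [R.outBit t r (decide (s = 0)) (q e s (r / R.target.len))],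
    h4 fun e t => (List.range (2 ^ w)).flatMap fun s =>
      (List.range (R.places * R.target.len)).flatMap fun r =>
      [R.outBit t r (decide (s = 0)) (q e s (r / R.target.len))]]
  simp only [layout, List.flatMap_assoc, List.flatMap_map]
  refine List.flatMap_congr fun e _ => List.flatMap_congr fun t _ => List.flatMap_congr fun s _ => ?_
  rw [mul_comm]
  refine (range_mul_flatMap R.target.len R.places fun m k =>
    [(R.target.code (R.symbol t m (decide (s = 0)) (q e s m))).getD k false]).trans ?_
  refine List.flatMap_congr fun m _ => ?_
  refine Eq.trans ?_ (hcode _).symm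
  rw [List.map_eq_flatMap]

end Translation

/-! ### A finite automaton that scans power words -/

/-- The digits of the quotient in a division by `K`. -/
def quotientDigits (K : ℕ) (D : List Bool) : List Bool :=
  (List.range D.length).map fun j =>
    decide (K ≤ 2 * (binaryValue (D.take j) % K) + (D.getD j false).toNat)

theorem length_quotientDigits (K : ℕ) (D : List Bool) :
    (quotientDigits K D).length = D.length := by
  simp [quotientDigits]

theorem quotientDigits_concat (K : ℕ) (D : List Bool) (b : Bool) :
    quotientDigits K (D ++ [b]) =
      quotientDigits K D ++ [decide (K ≤ 2 * (binaryValue D % K) + b.toNat)] := by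
  rw [quotientDigits, quotientDigits, List.length_append, List.length_singleton, List.range_succ,
    List.map_append, List.map_singleton, List.take_left]
  congr 1
  · refine List.map_congr_left fun j hj => ?_
    have hj := List.mem_range.1 hj
    rw [List.take_append_of_le_length hj.le]
    simp [List.getD_eq_getElem?_getD, List.getElem?_append_left hj]
  · simp [List.getD_eq_getElem?_getD]

/-- Long division in base two: the remainder of the prefix is less than `K`, so the next digit of
the quotient is `0` or `1` and depends only on this remainder and the next bit. -/
theorem binaryValue_quotientDigits {K : ℕ} (hK : 0 < K) (D : List Bool) :
    binaryValue (quotientDigits K D) = binaryValue D / K := by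
  induction D using List.reverseRecOn with
  | nil => simp [quotientDigits, binaryValue]
  | append_singleton D b ih =>
    rw [quotientDigits_concat, binaryValue_concat, binaryValue_concat, ih]
    have h1 := Nat.div_add_mod (binaryValue D) K
    have h2 := Nat.mod_lt (binaryValue D) hK
    have h3 : 2 * binaryValue D + b.toNat =
        K * (2 * (binaryValue D / K)) + (2 * (binaryValue D % K) + b.toNat) := by
      conv_lhs => rw [← h1]
      ring
    have hb := Bool.toNat_lt b
    rw [h3, Nat.mul_add_div hK]
    congr 1
    generalize binaryValue D % K = r at h2
    by_cases h : K ≤ 2 * r + b.toNat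
    · rw [decide_eq_true h]
      refine (Nat.div_eq_of_lt_le ?_ ?_).symm <;> simp <;> omega
    · rw [decide_eq_false h, Nat.div_eq_of_lt (not_le.1 h)]
      rfl

/-- The letter at the position `s` with the product of the preceding letters. -/
def slotAt {X Γ : Type*} [Group Γ] (π : FreeGroup X →* Γ) (s i : ℕ) (u : List (X × Bool)) : Option (Γ × (X × Bool)) :=
  if s < i then none else u[s - i]?.map fun a => (π (FreeGroup.mk (u.take (s - i))), a)

theorem slotAt_concat {X Γ : Type*} [Group Γ] (π : FreeGroup X →* Γ) (s i : ℕ) (u : List (X × Bool)) (a : X × Bool) :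
    slotAt π s i (u ++ [a]) =
      if i + u.length = s then some (π (FreeGroup.mk u), a) else slotAt π s i u := by
  rw [slotAt, slotAt]
  by_cases h1 : s < i
  · rw [if_pos h1, if_pos h1, if_neg (by omega)]
  · rw [if_neg h1, if_neg h1]
    by_cases h2 : i + u.length = s
    · obtain rfl := h2
      simp
    · rw [if_neg h2]
      rcases Nat.lt_or_ge (s - i) u.length with h3 | h3
      · rw [List.getElem?_append_left h3, List.take_append_of_le_length h3.le]
      · rw [List.getElem?_eq_none h3, List.getElem?_eq_none (by
          rw [List.length_append, List.length_singleton]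
          omega)]
        rfl

theorem FreeGroup.map_mk_append {α G : Type*} [Group G] (π : FreeGroup α →* G)
    (u v : List (α × Bool)) :
    π (FreeGroup.mk (u ++ v)) = π (FreeGroup.mk u) * π (FreeGroup.mk v) := by
  rw [← _root_.map_mul, FreeGroup.mul_mk]

section Scan

variable {X Γ : Type*} [Group Γ] [Finite Γ]

/-- The data of a pair `(u, x)` of a power word that a finite automaton collects: the product of the
preceding pairs, the value of `u`, the sign and the remainder of `x`, the letter at a distinguished
position of `u` with the product of the preceding letters, and a distinguished digit of the quotient
of `x`. -/
structure FactorScan (X Γ : Type*) [Finite Γ] where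
  pre : Γ
  base : Γ
  neg : Bool
  rem : Fin (Nat.card Γ)
  slot : Option (Γ × (X × Bool))
  digit : Bool

instance [Finite X] : Finite (FactorScan X Γ) := by
  refine Finite.of_injective (fun f : FactorScan X Γ =>
    (f.pre, f.base, f.neg, f.rem, f.slot, f.digit)) ?_
  rintro ⟨⟩ ⟨⟩ h
  simp_all

instance neZeroCard : NeZero (Nat.card Γ) := ⟨Nat.card_pos.ne'⟩

namespace FactorScan

variable (π : FreeGroup X →* Γ) (f : FactorScan X Γ)

/-- The product of the pairs up to the present one. -/
noncomputable def post : Γ := f.pre * f.base ^ (if f.neg then -(f.rem.1 : ℤ) else f.rem.1)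

/-- The data at the beginning of the next pair. -/
noncomputable def next : FactorScan X Γ := ⟨f.post, 1, false, 0, none, false⟩

/-- The data after a letter. -/
noncomputable def letter (T : Tag) (a : X × Bool) : FactorScan X Γ :=
  { f with
    base := f.base * π (FreeGroup.mk [a])
    slot := if T.slot then some (f.base, a) else f.slot }

/-- The data after a digit. -/
noncomputable def bit (T : Tag) (b : Bool) : FactorScan X Γ :=
  { f with
    rem := Fin.ofNat (Nat.card Γ) (2 * f.rem + b.toNat)
    digit := if T.digit then decide (Nat.card Γ ≤ 2 * f.rem + b.toNat) else f.digit }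

end FactorScan

/-- What has been read last. -/
inductive ScanMode
  | start | letter | sign | bit
  deriving DecidableEq

instance : Finite ScanMode :=
  Finite.of_injective (fun m : ScanMode => match m with
    | .start => (0 : Fin 4)
    | .letter => 1
    | .sign => 2
    | .bit => 3) (by rintro ⟨⟩ ⟨⟩ h <;> simp_all)

/-- The states of the automaton that scans power words. The last component is the data of the pair
that ends at a distinguished position. -/
structure PowerScan (X Γ : Type*) [Finite Γ] where
  mode : ScanMode
  cur : FactorScan X Γ
  res : Option (FactorScan X Γ)

instance [Finite X] : Finite (PowerScan X Γ) := by
  refine Finite.of_injective (fun q : PowerScan X Γ => (q.mode, q.cur, q.res)) ?_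
  rintro ⟨⟩ ⟨⟩ h
  simp_all

namespace PowerScan

variable (π : FreeGroup X →* Γ) (q : PowerScan X Γ)

/-- The initial state. -/
noncomputable def init : PowerScan X Γ := ⟨.start, ⟨1, 1, false, 0, none, false⟩, none⟩

/-- The data to which a letter or a sign is added. -/
noncomputable def opened : FactorScan X Γ := if q.mode = .letter then q.cur else q.cur.next

/-- Whether a power word may end in the state. -/
def Complete : Prop := q.mode = .start ∨ q.mode = .bit

instance : Decidable q.Complete := inferInstanceAs (Decidable (_ ∨ _))

/-- A step of the automaton. -/
noncomputable def step (T : Tag) (q : PowerScan X Γ) : PowerSymbol X → Option (PowerScan X Γ)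
  | .letter a => if q.mode = .sign then none else some ⟨.letter, q.opened.letter π T a, q.res⟩
  | .sign b => if q.mode = .sign then none else some ⟨.sign, { q.opened with neg := b }, q.res⟩
  | .bit b =>
    if q.mode = .sign ∨ q.mode = .bit then
      -- At `e` it is not yet known whether the pair ends. Its data are recorded there and withdrawn
      -- if another digit follows at `e + 1`.
      some ⟨.bit, q.cur.bit T b, if T.last then some (q.cur.bit T b) else
        if T.next then none else q.res⟩
    else none

end PowerScan

/-- The pair of a power word, which starts at the position `i`, that ends at the position `e`,
together with the product of the preceding pairs and the position where it starts. -/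
def pairAt (π : FreeGroup X →* Γ) (e : ℕ) : ℕ → Γ → List (PowerFactor X) →
    Option (Γ × ℕ × PowerFactor X)
  | _, _, [] => none
  | i, r, f :: P =>
    if e + 1 = i + f.symbols.length then some (r, i, f)
    else pairAt π e (i + f.symbols.length) (r * π (FreeGroup.mk f.base) ^ f.exponent) P

/-- The data of a pair that the automaton collects. -/
noncomputable def pairScan (π : FreeGroup X →* Γ) (s k : ℕ) (x : Γ × ℕ × PowerFactor X) : FactorScan X Γ where
  pre := x.1
  base := π (FreeGroup.mk x.2.2.base)
  neg := x.2.2.neg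
  rem := Fin.ofNat (Nat.card Γ) (binaryValue x.2.2.digits)
  slot := slotAt π s x.2.1 x.2.2.base
  digit := (quotientDigits (Nat.card Γ) x.2.2.digits).reverse.getD k false

namespace Translation

open PowerScan

variable {B : Type*} (π : FreeGroup X →* Γ) (R : Translation (PowerSymbol X) B (PowerScan X Γ))
  (hR : R.step = PowerScan.step π) (T : ℕ → Tag) (s e k : ℕ)
  (hslot : ∀ i, (T i).slot = decide (i = s)) (hlast : ∀ i, (T i).last = decide (i = e))
  (hnext : ∀ i, (T i).next = decide (i = e + 1)) (hdigit : ∀ i, (T i).digit = decide (i + k = e))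

include hR

theorem run_concat (i : ℕ) (l : List (PowerSymbol X)) (a : PowerSymbol X) (q : PowerScan X Γ) :
    R.run T i (l ++ [a]) q = (R.run T i l q).bind fun q => PowerScan.step π (T (i + l.length)) q a := by
  rw [run_append]
  congr 1
  funext q
  rw [run, hR]
  simp [run]

include hslot in
-- The conclusion concerns `opened` rather than `cur`, since with an empty base no letter has opened
-- the new pair yet.
theorem run_letters (i : ℕ) (u : List (X × Bool)) (q : PowerScan X Γ) (hq : q.Complete) :
    ∃ q', R.run T i (u.map .letter) q = some q' ∧ q'.mode ≠ .sign ∧ q'.res = q.res ∧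
      q'.opened = ⟨q.cur.post, π (FreeGroup.mk u), false, 0, slotAt π s i u, false⟩ := by
  induction u using List.reverseRecOn with
  | nil =>
    refine ⟨q, rfl, ?_, rfl, ?_⟩
    · rcases hq with h | h <;> simp [h]
    · rw [opened, if_neg (by rcases hq with h | h <;> simp [h]), FactorScan.next]
      simp [slotAt, ← FreeGroup.one_eq_mk]
  | append_singleton u a ih =>
    obtain ⟨q', h1, h2, h3, h4⟩ := ih
    refine ⟨⟨.letter, q'.opened.letter π (T (i + u.length)) a, q'.res⟩, ?_, by simp, h3, ?_⟩
    · rw [List.map_append, List.map_singleton, R.run_concat π hR, h1, Option.bind_some,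
        List.length_map]
      simp only [PowerScan.step, if_neg h2]
    · rw [opened, if_pos rfl, h4, FactorScan.letter, slotAt_concat, FreeGroup.map_mk_append, hslot]
      simp

include hslot hlast hnext hdigit in
-- By `hres` nothing has been recorded before `e`, so a withdrawal at `e + 1` restores the old
-- value. During the run the distinguished digit is counted from the left; only when the pair ends
-- at `e` does this become an index from the right.
theorem run_pair (i : ℕ) (f : PowerFactor X) (q : PowerScan X Γ) (hq : q.Complete)
    (hres : i ≤ e → q.res = none) :
    ∃ q', R.run T i f.symbols q = some q' ∧ q'.mode = .bit ∧
      q'.cur.post = q.cur.post * π (FreeGroup.mk f.base) ^ f.exponent ∧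
      q'.res = if e + 1 = i + f.symbols.length then some (pairScan π s k (q.cur.post, i, f))
        else q.res := by
  obtain ⟨q₁, h1, h2, h3, h4⟩ := R.run_letters π hR T s hslot i f.base q hq
  have key : ∀ D : List Bool, ∃ q', R.run T i
      (f.base.map PowerSymbol.letter ++ [PowerSymbol.sign f.neg] ++ D.map PowerSymbol.bit) q = some q' ∧
      (q'.mode = .sign ∧ D = [] ∨ q'.mode = .bit ∧ D ≠ []) ∧
      q'.cur = ⟨q.cur.post, π (FreeGroup.mk f.base), f.neg,
        Fin.ofNat (Nat.card Γ) (binaryValue D), slotAt π s i f.base,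
        if e < i + f.base.length + 1 + k then false else
          (quotientDigits (Nat.card Γ) D).getD (e - k - (i + f.base.length + 1)) false⟩ ∧
      q'.res = if D ≠ [] ∧ e + 1 = i + f.base.length + 1 + D.length then some q'.cur
        else q.res := by
    intro D
    induction D using List.reverseRecOn with
    | nil =>
      refine ⟨⟨.sign, { q₁.opened with neg := f.neg }, q₁.res⟩, ?_, by simp, ?_, by simp [h3]⟩
      · rw [List.map_nil, List.append_nil, R.run_concat π hR, h1, Option.bind_some]
        simp only [PowerScan.step, if_neg h2]
      · simp [h4, quotientDigits, binaryValue]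
    | append_singleton D b ih =>
      obtain ⟨q', g1, g2, g3, g4⟩ := ih
      have hj : i + (f.base.map PowerSymbol.letter ++ [PowerSymbol.sign f.neg] ++
          D.map PowerSymbol.bit).length = i + f.base.length + 1 + D.length := by
        simp
        ring
      generalize hT : T (i + f.base.length + 1 + D.length) = T'
      refine ⟨⟨.bit, q'.cur.bit T' b, if T'.last then some (q'.cur.bit T' b) else
        if T'.next then none else q'.res⟩, ?_, Or.inr ⟨rfl, by simp⟩, ?_, ?_⟩
      · rw [List.map_append, List.map_singleton, ← List.append_assoc, R.run_concat π hR, g1,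
          Option.bind_some, hj, hT]
        simp only [PowerScan.step]
        rw [if_pos (by rcases g2 with g2 | g2 <;> simp [g2.1])]
      · subst hT
        simp only [g3, FactorScan.bit, hdigit, Fin.val_ofNat, binaryValue_concat,
          quotientDigits_concat, FactorScan.mk.injEq, true_and]
        refine ⟨Fin.ext (by simp [Nat.add_mod, Nat.mul_mod]), ?_⟩
        by_cases c1 : e < i + f.base.length + 1 + k
        · rw [if_pos c1, if_pos c1, if_neg (by simp; omega)]
        · rw [if_neg c1, if_neg c1]
          by_cases c2 : i + f.base.length + 1 + D.length + k = e
          · rw [if_pos (by simpa using c2), show e - k - (i + f.base.length + 1) = D.length by omega]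
            simp [List.getD_eq_getElem?_getD, length_quotientDigits]
          · rw [if_neg (by simpa using c2)]
            simp only [List.getD_eq_getElem?_getD]
            rcases Nat.lt_or_ge (e - k - (i + f.base.length + 1)) D.length with c3 | c3
            · rw [List.getElem?_append_left (by rwa [length_quotientDigits])]
            · rw [List.getElem?_eq_none (by rwa [length_quotientDigits]),
                List.getElem?_eq_none (by simp [length_quotientDigits]; omega)]
      · subst hT
        simp only [hlast, hnext, List.length_append, List.length_singleton]
        by_cases c1 : i + f.base.length + 1 + D.length = e
        · rw [if_pos (by simpa using c1), if_pos ⟨by simp, by omega⟩]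
        · have c3 : ¬(D ++ [b] ≠ [] ∧ e + 1 = i + f.base.length + 1 + (D.length + 1)) := by omega
          rw [if_neg (by simpa using c1), if_neg c3]
          by_cases c2 : i + f.base.length + 1 + D.length = e + 1
          · rw [if_pos (by simpa using c2), hres (by omega)]
          · rw [if_neg (by simpa using c2), g4, if_neg (by omega)]
  obtain ⟨q', g1, g2, g3, g4⟩ := key f.digits
  have hf := f.digits_ne_nil
  have hlen : f.symbols.length = f.base.length + 1 + f.digits.length := by
    simp [PowerFactor.symbols]
    ring
  have hpos := List.length_pos_iff.2 hf
  refine ⟨q', ?_, ?_, ?_, ?_⟩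
  · rw [PowerFactor.symbols, ← g1, List.append_assoc]
    rfl
  · rcases g2 with g2 | g2
    · exact absurd g2.2 hf
    · exact g2.1
  -- In `Γ` only the remainder of the exponent modulo the order of `Γ` matters.
  · rw [g3, FactorScan.post, PowerFactor.exponent]
    simp only [Fin.val_ofNat]
    split_ifs
    · rw [zpow_neg, zpow_neg, zpow_natCast, zpow_natCast, pow_mod_natCard]
    · rw [zpow_natCast, zpow_natCast, pow_mod_natCard]
  · rw [g4, hlen]
    by_cases c : e + 1 = i + (f.base.length + 1 + f.digits.length)
    · rw [if_pos ⟨hf, by omega⟩, if_pos c, g3, pairScan]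
      congr 2
      by_cases c1 : e < i + f.base.length + 1 + k
      · rw [if_pos c1, List.getD_eq_getElem?_getD, List.getElem?_eq_none]
        · rfl
        · simp only [List.length_reverse, length_quotientDigits]
          omega
      · rw [if_neg c1, List.getD_eq_getElem?_getD, List.getD_eq_getElem?_getD,
          List.getElem?_reverse (by simp only [length_quotientDigits]; omega), length_quotientDigits]
        congr 2
        simp only
        omega
    · rw [if_neg (by omega), if_neg c]

include hslot hlast hnext hdigit in
theorem run_powerWord (i : ℕ) (P : List (PowerFactor X)) (q : PowerScan X Γ) (hq : q.Complete)
    (hres : i ≤ e → q.res = none) :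
    ∃ q', R.run T i (P.flatMap PowerFactor.symbols) q = some q' ∧ q'.Complete ∧
      q'.cur.post = q.cur.post * powerWordValue π P ∧
      q'.res = if e < i then q.res else (pairAt π e i q.cur.post P).map (pairScan π s k) := by
  induction P generalizing i q with
  | nil =>
    refine ⟨q, rfl, hq, by simp [powerWordValue], ?_⟩
    split_ifs with h
    · rfl
    · exact hres (not_lt.1 h)
  | cons f P ih =>
    obtain ⟨q₁, h1, h2, h3, h4⟩ :=
      R.run_pair π hR T s e k hslot hlast hnext hdigit i f q hq hres
    have hpos : 0 < f.symbols.length := by simp [PowerFactor.symbols]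
    obtain ⟨q₂, g1, g2, g3, g4⟩ := ih (i + f.symbols.length) q₁ (Or.inr h2) fun h => by
      rw [h4, if_neg (by omega), hres (by omega)]
    refine ⟨q₂, ?_, g2, ?_, ?_⟩
    · rw [List.flatMap_cons, run_append, h1, Option.bind_some, g1]
    · rw [g3, h3, powerWordValue, powerWordValue, List.map_cons, List.prod_cons, mul_assoc]
    · rw [g4, pairAt, h4, h3]
      by_cases c1 : e < i
      · rw [if_pos c1, if_pos (by omega), if_neg (by omega)]
      · rw [if_neg c1]
        by_cases c2 : e + 1 = i + f.symbols.length
        · rw [if_pos c2, if_pos (by omega), if_pos c2]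
          rfl
        · rw [if_neg c2, if_neg c2]
          by_cases c3 : e < i + f.symbols.length
          · rw [if_pos c3, hres (by omega)]
            have : ∀ (P : List (PowerFactor X)) (j : ℕ) (r : Γ), e < j →
                pairAt π e j r P = none := by
              intro P
              induction P with
              | nil => exact fun _ _ _ => rfl
              | cons f P ih =>
                intro j r hj
                rw [pairAt, if_neg, ih _ _ (by omega)]
                simp [PowerFactor.symbols]
                omega
            rw [this _ _ _ c3]
            rfl
          · rw [if_neg c3]

/-- The mode checks the grammar of power words, so only power words lead to a state that is
`Complete`. The incomplete modes are included for the induction on the last symbol. -/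
theorem exists_powerWord_of_run (l : List (PowerSymbol X)) (q : PowerScan X Γ)
    (hq : R.run T 0 l PowerScan.init = some q) :
    match q.mode with
    | .start => l = []
    | .letter => ∃ (P : List (PowerFactor X)) (u : List (X × Bool)),
        l = P.flatMap PowerFactor.symbols ++ u.map .letter
    | .sign => ∃ (P : List (PowerFactor X)) (u : List (X × Bool)) (b : Bool),
        l = P.flatMap PowerFactor.symbols ++ u.map .letter ++ [.sign b]
    | .bit => ∃ (P : List (PowerFactor X)) (f : PowerFactor X),
        l = P.flatMap PowerFactor.symbols ++ f.symbols := by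
  induction l using List.reverseRecOn generalizing q with
  | nil =>
    obtain rfl : PowerScan.init = q := by simpa [run] using hq
    rfl
  | append_singleton l a ih =>
    rw [R.run_concat π hR, Option.bind_eq_some_iff] at hq
    obtain ⟨q₀, h1, h2⟩ := hq
    replace ih := ih q₀ h1
    have hopen : q₀.mode ≠ .sign → ∃ (P : List (PowerFactor X)) (u : List (X × Bool)),
        l = P.flatMap PowerFactor.symbols ++ u.map .letter := by
      intro h
      generalize q₀.mode = M at ih h
      rcases M
      · exact ⟨[], [], by simpa using ih⟩
      · exact ih
      · exact absurd rfl h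
      · obtain ⟨P, f, rfl⟩ := ih
        exact ⟨P ++ [f], [], by simp⟩
    rcases a with a | b | b
    · simp only [PowerScan.step] at h2
      split_ifs at h2 with h3
      obtain rfl := Option.some.inj h2
      obtain ⟨P, u, rfl⟩ := hopen h3
      exact ⟨P, u ++ [a], by simp⟩
    · simp only [PowerScan.step] at h2
      split_ifs at h2 with h3
      obtain rfl := Option.some.inj h2
      obtain ⟨P, u, rfl⟩ := hopen h3
      exact ⟨P, u, b, by simp⟩
    · simp only [PowerScan.step] at h2
      split_ifs at h2 with h3 h4 h5
      all_goals
        obtain rfl := Option.some.inj h2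
        clear h2 h1
        generalize q₀.mode = M at ih h3
        rcases M
        · simp at h3
        · simp at h3
        · obtain ⟨P, u, b', rfl⟩ := ih
          exact ⟨P, ⟨u, b', [b], by simp⟩, by simp [PowerFactor.symbols]⟩
        · obtain ⟨P, f, rfl⟩ := ih
          exact ⟨P, ⟨f.base, f.neg, f.digits ++ [b], by simp⟩, by simp [PowerFactor.symbols]⟩

end Translation

end Scan

/-! ### Reductions between power word problems -/

theorem BlockCode.len_pos {Y : Type*} (c : BlockCode (PowerSymbol Y)) : 0 < c.len := by
  rcases Nat.eq_zero_or_pos c.len with h | h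
  · have h1 := fun a => List.length_eq_zero_iff.1 ((c.length_code a).trans h)
    have h2 := c.code_injective ((h1 (.sign true)).trans (h1 (.sign false)).symm)
    simp at h2
  · exact h

/-- Unique readability: a base ends at the first sign, and the digits end before the first symbol
that is not a bit, because no pair begins with a bit. -/
theorem PowerFactor.flatMap_symbols_injective {Y : Type*} :
    Function.Injective fun P : List (PowerFactor Y) => P.flatMap PowerFactor.symbols := by
  have hletters : ∀ (u v : List (Y × Bool)) (a b : Bool) (l l' : List (PowerSymbol Y)),
      u.map PowerSymbol.letter ++ .sign a :: l = v.map PowerSymbol.letter ++ .sign b :: l' →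
      u = v ∧ a = b ∧ l = l' := by
    intro u
    induction u with
    | nil =>
      rintro (_ | ⟨y, v⟩) a b l l' h
      · simpa using h
      · simp at h
    | cons x u ih =>
      rintro (_ | ⟨y, v⟩) a b l l' h
      · simp at h
      · simp only [List.map_cons, List.cons_append, List.cons.injEq, PowerSymbol.letter.injEq] at h
        obtain ⟨h1, h2⟩ := h
        obtain ⟨rfl, h3⟩ := ih v a b l l' h2
        exact ⟨by rw [h1], h3⟩
  have hbits : ∀ (u v : List Bool) (l l' : List (PowerSymbol Y)), (∀ b, l.head? ≠ some (.bit b)) →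
      (∀ b, l'.head? ≠ some (.bit b)) →
      u.map PowerSymbol.bit ++ l = v.map PowerSymbol.bit ++ l' → u = v ∧ l = l' := by
    intro u
    induction u with
    | nil =>
      rintro (_ | ⟨y, v⟩) l l' hl hl' h
      · exact ⟨rfl, h⟩
      · obtain rfl : l = _ := h
        simp at hl
    | cons x u ih =>
      rintro (_ | ⟨y, v⟩) l l' hl hl' h
      · obtain rfl : _ = l' := h
        simp at hl'
      · simp only [List.map_cons, List.cons_append, List.cons.injEq, PowerSymbol.bit.injEq] at h
        obtain ⟨rfl, h3⟩ := ih v l l' hl hl' h.2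
        exact ⟨by rw [h.1], h3⟩
  have hhead : ∀ (P : List (PowerFactor Y)) (b : Bool),
      (P.flatMap PowerFactor.symbols).head? ≠ some (.bit b) := by
    rintro (_ | ⟨⟨_ | ⟨x, u⟩, a, D, hD⟩, P⟩) b <;> simp [PowerFactor.symbols]
  intro P Q h
  induction P generalizing Q with
  | nil =>
    rcases Q with _ | ⟨g, Q⟩
    · rfl
    · simp [PowerFactor.symbols] at h
  | cons f P ih =>
    rcases Q with _ | ⟨g, Q⟩
    · simp [PowerFactor.symbols] at h
    · simp only [List.flatMap_cons, PowerFactor.symbols, List.append_assoc, List.cons_append] at h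
      obtain ⟨h1, h2, h3⟩ := hletters _ _ _ _ _ _ h
      obtain ⟨h4, h5⟩ := hbits _ _ _ _ (hhead P) (hhead Q) h3
      obtain rfl := ih h5
      obtain ⟨u, a, D, hD⟩ := f
      obtain ⟨v, b, D', hD'⟩ := g
      obtain rfl : u = v := h1
      obtain rfl : a = b := h2
      obtain rfl : D = D' := h4
      rfl

theorem mem_PowWP_iff {Y H : Type*} [Group H] (ψ : FreeGroup Y →* H)
    (d : BlockCode (PowerSymbol Y)) (P : List (PowerFactor Y)) :
    (P.flatMap PowerFactor.symbols).flatMap d.code ∈ PowWP ψ d ↔ powerWordValue ψ P = 1 := by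
  constructor
  · rintro ⟨Q, h1, h2⟩
    obtain rfl := PowerFactor.flatMap_symbols_injective (d.flatMap_injective d.len_pos h1)
    exact h2
  · exact fun h => ⟨P, rfl, h⟩

/-- No pair begins with a bit, so a leading bit spoils the string whatever follows. All negative
outputs have this form. -/
theorem not_mem_PowWP {Y H : Type*} [Group H] (ψ : FreeGroup Y →* H)
    (d : BlockCode (PowerSymbol Y)) (b : Bool) (l : List (PowerSymbol Y)) :
    (PowerSymbol.bit b :: l).flatMap d.code ∉ PowWP ψ d := by
  rintro ⟨P, h1, -⟩
  have h2 := d.flatMap_injective d.len_pos h1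
  rcases P with _ | ⟨⟨_ | ⟨x, u⟩, a, D, hD⟩, P⟩ <;> simp [PowerFactor.symbols] at h2

open Classical in
/-- The symbol that is written for a state: `g` yields the symbols if the string is a power word whose
value is `1`. -/
noncomputable def scanSymbol {X Y Γ : Type*} [Group Γ] [Finite Γ]
    (g : ℕ → ℕ → Bool → Option (FactorScan X Γ) → PowerSymbol Y) (t m : ℕ) (z : Bool) :
    Option (PowerScan X Γ) → PowerSymbol Y
  | some q => if q.Complete ∧ q.cur.post = 1 then g t m z q.res else .bit false
  | none => .bit false

/-- A string that does not encode a power word whose value in the finite group `Γ` is `1` can be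
mapped to a string that does not encode a power word, and the other strings to a string whose symbols
depend on the data that a finite automaton collects. -/
theorem exists_nc1Computable_scan {X Y Γ : Type*} [Finite X] [Group Γ] [Finite Γ]
    (π : FreeGroup X →* Γ) (c : BlockCode (PowerSymbol X)) (d : BlockCode (PowerSymbol Y))
    (rows places : ℕ) (hrows : 0 < rows) (hplaces : 0 < places)
    (g : ℕ → ℕ → Bool → Option (FactorScan X Γ) → PowerSymbol Y) :
    ∃ f : List Bool → List Bool, NC1Computable f ∧ ∀ x,
      (∃ (P : List (PowerFactor X)) (w : ℕ), x = (P.flatMap PowerFactor.symbols).flatMap c.code ∧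
        powerWordValue π P = 1 ∧ (P.flatMap PowerFactor.symbols).length < 2 ^ w ∧
        f x = (layout rows places w fun e t s m => g t m (decide (s = 0))
          ((pairAt π e 0 1 P).map
            (pairScan π s (places * (2 ^ w - 1 - s) + (places - 1 - m))))).flatMap d.code) ∨
      ((¬∃ P : List (PowerFactor X), x = (P.flatMap PowerFactor.symbols).flatMap c.code ∧
        powerWordValue π P = 1) ∧ ∃ l, f x = (PowerSymbol.bit false :: l).flatMap d.code) := by
  let R : Translation (PowerSymbol X) (PowerSymbol Y) (PowerScan X Γ) :=
    { source := c
      target := d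
      places := places
      rows := rows
      source_pos := c.len_pos
      target_pos := d.len_pos
      places_pos := hplaces
      rows_pos := hrows
      init := PowerScan.init
      step := PowerScan.step π
      symbol := scanSymbol g }
  refine ⟨R.automaton.output, R.automaton.nc1Computable_output, fun x => ?_⟩
  obtain ⟨q, hq, hx⟩ := R.output_automaton x
  set w := Nat.size x.length with hw
  -- For a negative output only the first symbol, whose coordinates are all zero, has to be
  -- inspected.
  have hhead : ∀ F : ℕ → ℕ → ℕ → ℕ → PowerSymbol Y, F 0 0 0 0 = .bit false →
      ∃ l, layout rows places w F = .bit false :: l := by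
    intro F hF
    have hsucc : ∀ k, 0 < k → ∃ l, List.range k = 0 :: l := by
      intro k hk
      obtain ⟨k, rfl⟩ := Nat.exists_eq_succ_of_ne_zero hk.ne'
      exact ⟨_, List.range_succ_eq_map⟩
    obtain ⟨l1, h1⟩ := hsucc (2 ^ w) (by positivity)
    obtain ⟨l2, h2⟩ := hsucc rows hrows
    obtain ⟨l3, h3⟩ := hsucc places hplaces
    rw [layout, h1, h2, h3]
    simp only [List.flatMap_cons, List.map_cons, List.cons_append, hF]
    exact ⟨_, rfl⟩
  have hw0 : 0 < 2 ^ w := by positivity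
  rcases hx with ⟨l, hl, hrun⟩ | ⟨hnone, hx⟩
  · by_cases hP : ∃ P : List (PowerFactor X),
        x = (P.flatMap PowerFactor.symbols).flatMap c.code ∧ powerWordValue π P = 1
    · obtain ⟨P, hP, hval⟩ := hP
      left
      obtain rfl : l = P.flatMap PowerFactor.symbols :=
        c.flatMap_injective c.len_pos (hl.symm.trans hP)
      refine ⟨P, w, hP, hval, ?_, ?_⟩
      · refine lt_of_le_of_lt ?_ (Nat.lt_size_self x.length)
        have h1 := congrArg List.length hl
        rw [R.length_flatMap_code] at h1
        rw [h1]
        exact Nat.le_mul_of_pos_left _ c.len_pos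
      · rw [hq]
        congr 1
        refine List.flatMap_congr fun e he => List.flatMap_congr fun t _ =>
          List.flatMap_congr fun s hs => List.map_congr_left fun m hm => ?_
        have he := List.mem_range.1 he
        have hs := List.mem_range.1 hs
        have hm := List.mem_range.1 hm
        obtain ⟨q', g1, g2, g3, g4⟩ := R.run_powerWord π rfl (R.tag w s e m) s e
          (places * (2 ^ w - 1 - s) + (places - 1 - m)) (fun _ => rfl) (fun _ => rfl)
          (fun _ => rfl) (fun i => by rw [← add_assoc]; rfl) 0 P PowerScan.init (Or.inl rfl)
          (fun _ => rfl)
        have hinit : (PowerScan.init : PowerScan X Γ).cur.post = 1 := by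
          simp [PowerScan.init, FactorScan.post]
        rw [hinit, one_mul, hval] at g3
        rw [hinit, if_neg (by omega)] at g4
        have h2 : q e s m = some q' := (hrun e he s hs m hm).trans g1
        change scanSymbol g t m (decide (s = 0)) (q e s m) = g t m (decide (s = 0)) _
        rw [h2, scanSymbol, if_pos ⟨g2, g3⟩, g4]
    · right
      refine ⟨hP, ?_⟩
      obtain ⟨l', hl'⟩ := hhead (fun e t s m => R.symbol t m (decide (s = 0)) (q e s m)) (by
        have h1 := hrun 0 hw0 0 hw0 0 hplaces
        change scanSymbol g 0 0 _ (q 0 0 0) = _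
        rcases h2 : q 0 0 0 with _ | q'
        · rfl
        · rw [scanSymbol, if_neg]
          rintro ⟨h3, h4⟩
          obtain ⟨P, hP'⟩ : ∃ P : List (PowerFactor X), l = P.flatMap PowerFactor.symbols := by
            have h5 := R.exists_powerWord_of_run π rfl _ l q' (h1.symm.trans h2)
            rcases h3 with h3 | h3
            · rw [h3] at h5
              exact ⟨[], h5⟩
            · rw [h3] at h5
              obtain ⟨P, f, h5⟩ := h5
              exact ⟨P ++ [f], by simp [h5]⟩
          subst hP'
          refine hP ⟨P, hl, ?_⟩
          obtain ⟨q'', g1, g2, g3, g4⟩ := R.run_powerWord π rfl (R.tag w 0 0 0) 0 0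
            (places * (2 ^ w - 1 - 0) + (places - 1 - 0)) (fun _ => rfl) (fun _ => rfl)
            (fun _ => rfl) (fun i => by rw [← add_assoc]; rfl) 0 P PowerScan.init (Or.inl rfl)
            (fun _ => rfl)
          obtain rfl : q' = q'' := Option.some.inj ((h1.symm.trans h2).symm.trans g1)
          rw [h4] at g3
          simpa [PowerScan.init, FactorScan.post] using g3.symm)
      exact ⟨l', hq.trans (congrArg _ hl')⟩
  · right
    refine ⟨?_, ?_⟩
    · rintro ⟨P, hP, -⟩
      exact hx ⟨_, hP⟩
    · obtain ⟨l', hl'⟩ := hhead (fun e t s m => R.symbol t m (decide (s = 0)) (q e s m)) (by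
        rw [hnone]
        rfl)
      exact ⟨l', hq.trans (congrArg _ hl')⟩

/-! ### Words for the products of generators with coset representatives -/

/-- The length modulo two is a homomorphism on the free group, since `-1 = 1` in `ZMod 2`. Its
kernel has finite index, and so has the image of the kernel under a surjection. -/
theorem exists_even_words {Y H : Type*} [Nonempty Y] [Group H] (ψ : FreeGroup Y →* H)
    (hψ : Function.Surjective ψ) :
    ∃ E : Subgroup H, E.FiniteIndex ∧ ∀ x ∈ E, ∃ l : List (Y × Bool),
      Even l.length ∧ ψ (FreeGroup.mk l) = x := by
  classical
  let p : FreeGroup Y →* Multiplicative (ZMod 2) := FreeGroup.lift fun _ => Multiplicative.ofAdd 1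
  refine ⟨p.ker.map ψ, ?_, ?_⟩
  · have h1 : p.ker.FiniteIndex := inferInstance
    exact ⟨fun h => h1.index_ne_zero (Nat.eq_zero_of_zero_dvd (h ▸ Subgroup.index_map_dvd _ hψ))⟩
  · rintro _ ⟨v, hv, rfl⟩
    refine ⟨v.toWord, ?_, by rw [FreeGroup.mk_toWord]⟩
    have h1 : ∀ L : List (Y × Bool), p (FreeGroup.mk L) = Multiplicative.ofAdd (L.length : ZMod 2) := by
      intro L
      induction L with
      | nil => simp [← FreeGroup.one_eq_mk]
      | cons a L ih =>
        rw [← List.singleton_append, FreeGroup.map_mk_append, ih]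
        obtain ⟨a, _ | _⟩ := a
        · simp only [p, FreeGroup.lift_mk, List.map_singleton, List.prod_singleton, cond_false,
            List.length_append, List.length_singleton, Nat.cast_add, Nat.cast_one, ofAdd_add]
          congr 1
        · simp only [p, FreeGroup.lift_mk, List.map_singleton, List.prod_singleton, cond_true,
            List.length_append, List.length_singleton, Nat.cast_add, Nat.cast_one, ofAdd_add]
    have h2 : p (FreeGroup.mk v.toWord) = 1 := by rw [FreeGroup.mk_toWord]; exact hv
    rw [h1, ofAdd_eq_one, ZMod.natCast_eq_zero_iff] at h2
    exact even_iff_two_dvd.2 h2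

/-- Padding by `y y⁻¹` adds two letters at a time, which is why the words must agree in parity. -/
theorem exists_words_of_length {Y H ι : Type*} [Nonempty Y] [Finite ι] [Group H]
    (ψ : FreeGroup Y →* H) (v : ι → H)
    (hv : ∀ k, ∃ l : List (Y × Bool), Even l.length ∧ ψ (FreeGroup.mk l) = v k) :
    ∃ (h : ℕ) (W : ι → List (Y × Bool)),
      ∀ k, (W k).length = 2 * h ∧ ψ (FreeGroup.mk (W k)) = v k := by
  choose l hl hv using hv
  obtain ⟨h, hh⟩ := Finite.exists_le fun k => (l k).length
  obtain ⟨y⟩ := ‹Nonempty Y›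
  have hpad : ∀ n, ψ (FreeGroup.mk (List.replicate n [(y, true), (y, false)]).flatten) = 1 := by
    intro n
    induction n with
    | zero => simp [← FreeGroup.one_eq_mk]
    | succ n ih =>
      rw [List.replicate_succ, List.flatten_cons, FreeGroup.map_mk_append, ih, mul_one]
      have : FreeGroup.mk [(y, true), (y, false)] = 1 := by
        rw [FreeGroup.one_eq_mk]
        exact Quot.sound FreeGroup.Red.Step.cons_not
      rw [this, map_one]
  refine ⟨h, fun k => l k ++
    (List.replicate (h - (l k).length / 2) [(y, true), (y, false)]).flatten, fun k => ⟨?_, ?_⟩⟩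
  · have h1 := hh k
    obtain ⟨a, ha⟩ := hl k
    have h2 : ∀ n, (List.replicate n [(y, true), (y, false)]).flatten.length = n * 2 := by simp
    rw [List.length_append, h2]
    omega
  · rw [FreeGroup.map_mk_append, hpad, mul_one, hv]

/-- For a group `G`, a homomorphism `val` from words over `Y`, and generators of `G` over `X`: a finite
quotient `Γ` of `G`, coset representatives, and words of a fixed even length for the products of the
generators with the representatives. -/
structure CosetWords (X Y G Γ : Type*) [Group G] [Group Γ] where
  φ : FreeGroup X →* G
  val : FreeGroup Y →* G
  quot : G →* Γ
  rep : Γ → G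
  half : ℕ
  word : Option (Γ × (X × Bool)) → List (Y × Bool)
  length_word : ∀ k, (word k).length = 2 * half
  val_none : val (FreeGroup.mk (word none)) = 1
  val_some : ∀ γ a, val (FreeGroup.mk (word (some (γ, a)))) =
    rep γ * φ (FreeGroup.mk [a]) * (rep (γ * quot (φ (FreeGroup.mk [a]))))⁻¹

/-- `N` is the normal core in `G` of the subgroup of `exists_even_words`. The Schreier elements `v
k` are trivial in `G ⧸ N`, hence values of words of even length. -/
theorem exists_cosetWords {X Y G : Type*} [Finite X] [Nonempty Y] [Group G] (H : Subgroup G)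
    (hH : H.FiniteIndex) (φ : FreeGroup X →* G) (ψ : FreeGroup Y →* H)
    (hψ : Function.Surjective ψ) :
    ∃ (N : Subgroup G) (_ : N.Normal) (_ : Finite (G ⧸ N)) (C : CosetWords X Y G (G ⧸ N)),
      C.φ = φ ∧ C.val = H.subtype.comp ψ := by
  obtain ⟨E, hE, hwords⟩ := exists_even_words ψ hψ
  have hEG : (E.map H.subtype).FiniteIndex := by
    refine ⟨?_⟩
    rw [Subgroup.index_map_subtype]
    exact mul_ne_zero hE.index_ne_zero hH.index_ne_zero
  have hfin : Finite (G ⧸ (E.map H.subtype).normalCore) := inferInstance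
  refine ⟨(E.map H.subtype).normalCore, inferInstance, hfin, ?_⟩
  set N := (E.map H.subtype).normalCore with hN
  let v : Option ((G ⧸ N) × (X × Bool)) → G
    | none => 1
    | some (γ, a) => γ.out * φ (FreeGroup.mk [a]) *
        (γ * QuotientGroup.mk' N (φ (FreeGroup.mk [a]))).out⁻¹
  have hv : ∀ k, v k ∈ N := by
    rintro (_ | ⟨γ, a⟩)
    · exact one_mem N
    · rw [← QuotientGroup.eq_one_iff]
      simp only [v, QuotientGroup.mk_mul, QuotientGroup.mk_inv, QuotientGroup.out_eq',
        QuotientGroup.mk'_apply]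
      group
  have hv' : ∀ k, ∃ l : List (Y × Bool), Even l.length ∧
      H.subtype.comp ψ (FreeGroup.mk l) = v k := by
    intro k
    obtain ⟨x, hx, hxv⟩ := Subgroup.normalCore_le _ (hv k)
    obtain ⟨l, h1, h2⟩ := hwords x hx
    exact ⟨l, h1, by rw [← hxv, MonoidHom.comp_apply, h2]⟩
  obtain ⟨h, W, hW⟩ := exists_words_of_length (H.subtype.comp ψ) v hv'
  exact ⟨⟨φ, H.subtype.comp ψ, QuotientGroup.mk' N, Quotient.out, h, W, fun k => (hW k).1,
    (hW none).2, fun γ a => (hW _).2⟩, rfl, rfl⟩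

/-! ### Auxiliary facts on products -/

theorem List.prod_map_range_telescope {G : Type*} [Group G] (c : ℕ → G) (m k : ℕ) (a : ℕ → G)
    (h1 : ∀ t < m, a t = c t * (c (t + 1))⁻¹) (h2 : ∀ t, m ≤ t → a t = 1) :
    ((List.range k).map a).prod = c 0 * (c (min k m))⁻¹ := by
  induction k with
  | zero => simp
  | succ k ih =>
    rw [List.range_succ, List.map_append, List.prod_append, ih, List.map_singleton,
      List.prod_singleton]
    rcases Nat.lt_or_ge k m with h | h
    · rw [h1 k h, min_eq_left h.le, min_eq_left (Nat.succ_le_of_lt h)]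
      group
    · rw [h2 k h, min_eq_right h, min_eq_right (h.trans k.le_succ), mul_one]

theorem powerWordValue_append {Y H : Type*} [Group H] (ψ : FreeGroup Y →* H)
    (P Q : List (PowerFactor Y)) :
    powerWordValue ψ (P ++ Q) = powerWordValue ψ P * powerWordValue ψ Q := by
  simp [powerWordValue]

theorem powerWordValue_flatMap {Y H ι : Type*} [Group H] (ψ : FreeGroup Y →* H) (l : List ι)
    (P : ι → List (PowerFactor Y)) :
    powerWordValue ψ (l.flatMap P) = (l.map fun i => powerWordValue ψ (P i)).prod := by
  induction l with
  | nil => rfl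
  | cons i l ih => rw [List.flatMap_cons, powerWordValue_append, ih, List.map_cons, List.prod_cons]

theorem powerWordValue_comp {Y H G : Type*} [Group H] [Group G] (θ : H →* G) (ψ : FreeGroup Y →* H)
    (P : List (PowerFactor Y)) :
    powerWordValue (θ.comp ψ) P = θ (powerWordValue ψ P) := by
  simp [powerWordValue, map_list_prod, Function.comp_def]

theorem FreeGroup.map_mk_flatMap {Y H ι : Type*} [Group H] (ψ : FreeGroup Y →* H) (l : List ι)
    (u : ι → List (Y × Bool)) :
    ψ (FreeGroup.mk (l.flatMap u)) = (l.map fun i => ψ (FreeGroup.mk (u i))).prod := by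
  induction l with
  | nil => simp [← FreeGroup.one_eq_mk]
  | cons i l ih =>
    rw [List.flatMap_cons, FreeGroup.map_mk_append, ih, List.map_cons, List.prod_cons]

theorem pairAt_of_lt {X Γ : Type*} [Group Γ] (π : FreeGroup X →* Γ) (e : ℕ)
    (P : List (PowerFactor X)) (i : ℕ) (r : Γ) (h : e < i) : pairAt π e i r P = none := by
  induction P generalizing i r with
  | nil => rfl
  | cons f P ih =>
    have : 0 < f.symbols.length := by simp [PowerFactor.symbols]
    rw [pairAt, if_neg (by omega), ih _ _ (by omega)]

/-- Each pair ends at exactly one position, and all other positions contribute `1`. The coset in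
which a pair ends is the one in which the next pair begins, so the factors telescope. -/
theorem List.prod_map_range_pairAt {X Γ G : Type*} [Group Γ] [Group G] (π : FreeGroup X →* Γ)
    (φ : FreeGroup X →* G) (rep : Γ → G) (B : ℕ) (F : Option (Γ × ℕ × PowerFactor X) → G)
    (hnone : F none = 1) (hsome : ∀ r i f, i + f.symbols.length ≤ B → F (some (r, i, f)) =
      rep r * φ (FreeGroup.mk f.base) ^ f.exponent *
        (rep (r * π (FreeGroup.mk f.base) ^ f.exponent))⁻¹)
    (P : List (PowerFactor X)) (i N : ℕ) (r : Γ)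
    (hN : (P.flatMap PowerFactor.symbols).length ≤ N) (hB : i + N ≤ B) :
    ((List.range' i N).map fun e => F (pairAt π e i r P)).prod =
      rep r * powerWordValue φ P * (rep (r * powerWordValue π P))⁻¹ := by
  induction P generalizing i N r with
  | nil =>
    rw [List.prod_eq_one]
    · simp [powerWordValue]
    · simp [pairAt, hnone]
  | cons f P ih =>
    have hpos : 0 < f.symbols.length := by simp [PowerFactor.symbols]
    rw [List.flatMap_cons, List.length_append] at hN
    -- The first pair occupies the positions `i, …, i + k` and contributes only at the last of them.
    obtain ⟨k, hk⟩ : ∃ k, f.symbols.length = k + 1 := ⟨f.symbols.length - 1, by omega⟩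
    obtain ⟨N', rfl⟩ : ∃ N', N = k + 1 + N' := ⟨N - (k + 1), by omega⟩
    rw [← List.range'_append_1, List.map_append, List.prod_append, List.range'_1_concat,
      List.map_append, List.prod_append, List.map_singleton, List.prod_singleton]
    have h1 : ((List.range' i k).map fun e => F (pairAt π e i r (f :: P))).prod = 1 := by
      refine List.prod_eq_one fun x hx => ?_
      obtain ⟨e, he, rfl⟩ := List.mem_map.1 hx
      have he := List.mem_range'_1.1 he
      rw [pairAt, if_neg (by omega), pairAt_of_lt _ _ _ _ _ (by omega), hnone]
    have h2 : ((List.range' (i + (k + 1)) N').map fun e => F (pairAt π e i r (f :: P))) =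
        (List.range' (i + (k + 1)) N').map fun e => F (pairAt π e (i + (k + 1))
          (r * π (FreeGroup.mk f.base) ^ f.exponent) P) := by
      refine List.map_congr_left fun e he => ?_
      have he := List.mem_range'_1.1 he
      rw [pairAt, if_neg (by omega), hk]
    rw [h1, h2, ih _ _ _ (by omega) (by omega), pairAt, if_pos (by omega), hsome _ _ _ (by omega),
      powerWordValue, powerWordValue, powerWordValue, powerWordValue, List.map_cons, List.map_cons,
      List.prod_cons, List.prod_cons, ← mul_assoc r]
    group

/-! ### The translation of power words -/

theorem List.map_getD_range {α : Type*} (l : List α) (a : α) (n : ℕ) (h : l.length = n) :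
    (List.range n).map (fun m => l.getD m a) = l := by
  subst h
  refine List.ext_getElem (by simp) fun i h1 h2 => ?_
  simp [List.getD_eq_getElem?_getD, List.getElem?_eq_getElem h2]

theorem binaryValue_replicate_append (n : ℕ) (l : List Bool) :
    binaryValue (List.replicate n false ++ l) = binaryValue l := by
  induction n with
  | zero => rfl
  | succ n ih => rw [List.replicate_succ, List.cons_append, binaryValue_cons, ih]; simp

theorem List.map_getD_reverse_range (l : List Bool) (n : ℕ) (h : l.length ≤ n) :
    (List.range n).map (fun j => l.reverse.getD (n - 1 - j) false) =
      List.replicate (n - l.length) false ++ l := by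
  refine List.ext_getElem (by simp; omega) fun i h1 h2 => ?_
  simp only [List.length_map, List.length_range] at h1
  rw [List.getElem_map, List.getElem_range, List.getD_eq_getElem?_getD]
  rcases Nat.lt_or_ge i (n - l.length) with h3 | h3
  · rw [List.getElem_append_left (by simpa using h3), List.getElem?_eq_none (by simp; omega)]
    simp
  · rw [List.getElem_append_right (by simpa using h3), List.getElem?_reverse (by omega)]
    simp only [List.length_replicate]
    rw [List.getElem?_eq_getElem (by omega), Option.getD_some]
    congr 1
    omega

namespace CosetWords

variable {X Y G Γ : Type*} [Group G] [Group Γ] (C : CosetWords X Y G Γ)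

/-- The number of places in a slot. -/
def places : ℕ := 2 * C.half + 2

/-- The pair in a slot of a row of single copies. -/
def slotPair (u : List (Y × Bool)) (neg b : Bool) : PowerFactor Y := ⟨u, neg, [b], by simp⟩

theorem digits_pos (w : ℕ) : 0 < C.places * 2 ^ w - 1 := by
  have h1 : 2 * 1 ≤ C.places * 2 ^ w :=
    Nat.mul_le_mul (by rw [places]; omega) Nat.one_le_two_pow
  omega

/-- This accounts for the summand `2` in `places`: one sign and one bit. In rows of letters
`baseWord` fills these two places with `y y⁻¹`. -/
theorem length_symbols_slotPair (k : Option (Γ × (X × Bool))) (a b : Bool) :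
    (slotPair (C.word k) a b).symbols.length = C.places := by
  simp [slotPair, PowerFactor.symbols, C.length_word, places]

variable (w : ℕ) (x : Option (Γ × ℕ × PowerFactor X))

/-- The digits of the quotient. -/
noncomputable def digitsOf : List Bool :=
  (List.range (C.places * 2 ^ w - 1)).map fun j => x.elim false fun x =>
    (quotientDigits (Nat.card Γ) x.2.2.digits).reverse.getD (C.places * 2 ^ w - 1 - 1 - j) false

theorem digitsOf_ne_nil : C.digitsOf w x ≠ [] := by
  have := C.digits_pos w
  rw [digitsOf, Ne, List.map_eq_nil_iff, List.range_eq_nil]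
  omega

variable [Finite Γ] (y : Y)

/-- The homomorphism to the finite quotient. -/
abbrev toQuot : FreeGroup X →* Γ := C.quot.comp C.φ

/-- The coset and the letter that determine the word in a slot of the row `t`. -/
def key (t : ℕ) (F : Option (FactorScan X Γ)) : Option (Γ × (X × Bool)) :=
  F.bind fun F => F.slot.map fun p => (F.pre * F.base ^ t * p.1, p.2)

/-- The word in a slot of a row that is part of the base of a pair. -/
def baseWord (t : ℕ) (F : Option (FactorScan X Γ)) : List (Y × Bool) :=
  C.word (key t F) ++ [(y, true), (y, false)]

/-- The number of the single copies of a base. -/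
noncomputable def copies (neg : Bool) (rem : ℕ) : ℕ := if neg then Nat.card Γ - rem else rem

/-- The symbols of the translation. -/
noncomputable def symbol (t m : ℕ) (z : Bool) (F : Option (FactorScan X Γ)) : PowerSymbol Y :=
  -- With `K = Nat.card Γ`, the rows are: `K` copies of the base, sign and digits of the quotient,
  -- `K` copies of the base again, a row whose slot `0` closes this second base by the exponent `-1`
  -- or `0`, and `K` copies of the base with every slot as a pair of its own.
  if t < Nat.card Γ then .letter ((C.baseWord y t F).getD m (y, true))
  else if t = Nat.card Γ then
    if z = true ∧ m = 0 then .sign (F.elim false FactorScan.neg)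
    else .bit (F.elim false FactorScan.digit)
  else if t < Nat.card Γ + 1 + Nat.card Γ then
    .letter ((C.baseWord y (t - (Nat.card Γ + 1)) F).getD m (y, true))
  else if t = Nat.card Γ + 1 + Nat.card Γ then
    (slotPair (C.word none) true (z && F.elim false FactorScan.neg)).symbols.getD m (.bit false)
  else
    (slotPair (C.word (key (t - (Nat.card Γ + 1 + Nat.card Γ + 1)) F)) false
      (F.elim false fun F => decide (t - (Nat.card Γ + 1 + Nat.card Γ + 1) <
        copies (Γ := Γ) F.neg F.rem))).symbols.getD m (.bit false)

/-- The data of the pair `x` for the slot `s`. -/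
noncomputable def scan (s : ℕ) : Option (FactorScan X Γ) := x.map (pairScan C.toQuot s 0)

/-- The word that consists of all slots of all copies. -/
noncomputable def baseOf : List (Y × Bool) :=
  (List.range (Nat.card Γ)).flatMap fun t =>
    (List.range (2 ^ w)).flatMap fun s => C.baseWord y t (C.scan x s)

/-- The sign of a pair. -/
def negOf : Bool := x.elim false fun x => x.2.2.neg

/-- The number of single copies for a pair. -/
noncomputable def copiesOf : ℕ := x.elim 0 fun x =>
  copies (Γ := Γ) x.2.2.neg (Fin.ofNat (Nat.card Γ) (binaryValue x.2.2.digits))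

/-- The power word for the block of a pair. -/
noncomputable def block : List (PowerFactor Y) :=
  ⟨C.baseOf w x y, negOf x, C.digitsOf w x, C.digitsOf_ne_nil w x⟩ ::
    -- The second base has no row of digits of its own and is swallowed by the pair in slot `0`; the
    -- other slots of this row have the value `1`.
    ((List.range (2 ^ w)).map (fun s => slotPair ((if s = 0 then C.baseOf w x y else []) ++
      C.word none) true (decide (s = 0) && negOf x)) ++
    (List.range (Nat.card Γ)).flatMap fun t => (List.range (2 ^ w)).map fun s =>
      slotPair (C.word (key t (C.scan x s))) false (decide (t < copiesOf x)))

theorem length_baseWord (t : ℕ) (F : Option (FactorScan X Γ)) :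
    (C.baseWord y t F).length = C.places := by
  rw [baseWord, List.length_append, C.length_word, places]
  rfl

/-- The data of the pair `x` at the place `m` of the slot `s`. -/
noncomputable def scanAt (s m : ℕ) : Option (FactorScan X Γ) :=
  x.map (pairScan C.toQuot s (C.places * (2 ^ w - 1 - s) + (C.places - 1 - m)))

theorem key_scanAt (t s m : ℕ) : key t (C.scanAt w x s m) = key t (C.scan x s) := by
  rcases x with _ | x <;> rfl

theorem neg_scanAt (s m : ℕ) :
    (C.scanAt w x s m).elim false FactorScan.neg = negOf x := by
  rcases x with _ | x <;> rfl

/-- Used for both groups of letter rows, with `t₀ = 0` and `t₀ = Nat.card Γ + 1`. -/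
theorem baseRows_eq (t₀ : ℕ) (ht : ∀ t < Nat.card Γ, ∀ s m, C.symbol y (t₀ + t) m (decide (s = 0))
      (C.scanAt w x s m) = .letter ((C.baseWord y t (C.scan x s)).getD m (y, true))) :
    ((List.range (Nat.card Γ)).flatMap fun t => (List.range (2 ^ w)).flatMap fun s =>
      (List.range C.places).map fun m =>
        C.symbol y (t₀ + t) m (decide (s = 0)) (C.scanAt w x s m)) =
      (C.baseOf w x y).map .letter := by
  rw [baseOf, List.map_flatMap]
  refine List.flatMap_congr fun t h => ?_
  rw [List.map_flatMap]
  refine List.flatMap_congr fun s _ => ?_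
  conv_rhs => rw [← List.map_getD_range _ (y, true) _ (C.length_baseWord y t (C.scan x s))]
  rw [List.map_map]
  exact List.map_congr_left fun m _ => ht t (List.mem_range.1 h) s m

theorem digitRow_eq :
    ((List.range (2 ^ w)).flatMap fun s => (List.range C.places).map fun m =>
        C.symbol y (Nat.card Γ) m (decide (s = 0)) (C.scanAt w x s m)) =
      .sign (negOf x) :: (C.digitsOf w x).map .bit := by
  have hp : 0 < C.places := by rw [places]; omega
  have h1 := range_mul_flatMap C.places (2 ^ w) fun s m =>
    [C.symbol y (Nat.card Γ) m (decide (s = 0)) (C.scanAt w x s m)]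
  simp only [List.map_eq_flatMap]
  refine h1.symm.trans ?_
  obtain ⟨J, hJ⟩ : ∃ J, C.places * 2 ^ w = J + 1 :=
    ⟨C.places * 2 ^ w - 1, by have := C.digits_pos w; omega⟩
  rw [← List.map_eq_flatMap, ← List.map_eq_flatMap, digitsOf, hJ, List.range_succ_eq_map,
    List.map_cons, List.map_map, List.map_map]
  congr 1
  · rw [Nat.zero_div, Nat.zero_mod, symbol, if_neg (lt_irrefl _), if_pos rfl, if_pos (by simp),
      neg_scanAt]
  · refine List.map_congr_left fun j hj => ?_
    have hj : j < J := by simpa using hj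
    simp only [Function.comp_apply, Nat.succ_eq_add_one]
    rw [symbol, if_neg (lt_irrefl _), if_pos rfl, if_neg]
    · congr 1
      rcases x with _ | x
      · rfl
      · change List.getD _ _ _ = List.getD _ _ _
        congr 1
        -- The sign takes the first place of the row, so the digit `j` is in the slot `(j + 1) /
        -- C.places` at the place `(j + 1) % C.places`.
        have h2 := Nat.div_add_mod (j + 1) C.places
        have h3 := Nat.mod_lt (j + 1) hp
        have h4 : (j + 1) / C.places < 2 ^ w := Nat.div_lt_of_lt_mul (by omega)
        obtain ⟨b, hb⟩ : ∃ b, 2 ^ w = (j + 1) / C.places + 1 + b :=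
          ⟨2 ^ w - ((j + 1) / C.places + 1), by omega⟩
        rw [hb] at hJ ⊢
        rw [show (j + 1) / C.places + 1 + b - 1 - (j + 1) / C.places = b by omega]
        rw [mul_add, mul_add, mul_one] at hJ
        omega
    · rw [decide_eq_true_eq]
      rintro ⟨h2, h3⟩
      have h4 := Nat.div_add_mod (j + 1) C.places
      rw [h2, h3] at h4
      simp at h4

/-- The boundaries of the pairs cut across the rows: a group of letter rows belongs to the pair that
is closed by the row after it, entirely by the row of digits or by slot `0` of the next single row;
the remaining slots are pairs by themselves. -/
theorem block_symbols :
    ((List.range (Nat.card Γ + (1 + (Nat.card Γ + (1 + Nat.card Γ))))).flatMap fun t =>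
      (List.range (2 ^ w)).flatMap fun s => (List.range C.places).map fun m =>
        C.symbol y t m (decide (s = 0)) (C.scanAt w x s m)) =
      (C.block w x y).flatMap PowerFactor.symbols := by
  have hA := C.baseRows_eq w x y 0 (by
    intro t ht s m
    rw [zero_add, symbol, if_pos ht, baseWord, key_scanAt, baseWord])
  have hB := C.baseRows_eq w x y (Nat.card Γ + 1) (by
    intro t ht s m
    rw [symbol, if_neg (by omega), if_neg (by omega), if_pos (by omega), baseWord, key_scanAt,
      baseWord, Nat.add_sub_cancel_left])
  have hS : ∀ s, (List.range C.places).map (fun m =>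
      C.symbol y (Nat.card Γ + 1 + Nat.card Γ) m (decide (s = 0)) (C.scanAt w x s m)) =
      (slotPair (C.word none) true (decide (s = 0) && negOf x)).symbols := by
    intro s
    conv_rhs => rw [← List.map_getD_range _ (.bit false) _ (C.length_symbols_slotPair none true _)]
    refine List.map_congr_left fun m _ => ?_
    rw [symbol, if_neg (by omega), if_neg (by have := Nat.card_pos (α := Γ); omega),
      if_neg (by omega), if_pos rfl, neg_scanAt]
  have hC : ∀ t s, (List.range C.places).map (fun m =>
      C.symbol y (Nat.card Γ + 1 + Nat.card Γ + 1 + t) m (decide (s = 0)) (C.scanAt w x s m)) =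
      (slotPair (C.word (key t (C.scan x s))) false (decide (t < copiesOf x))).symbols := by
    intro t s
    conv_rhs => rw [← List.map_getD_range _ (.bit false) _ (C.length_symbols_slotPair _ false _)]
    refine List.map_congr_left fun m _ => ?_
    rw [symbol, if_neg (by omega), if_neg (by omega), if_neg (by omega), if_neg (by omega),
      Nat.add_sub_cancel_left, key_scanAt]
    rcases x with _ | x
    · simp [copiesOf, scanAt]
    · rfl
  simp only [List.range_add, List.flatMap_append, List.flatMap_map, List.range_one,
    List.flatMap_singleton, add_zero] at hA hB ⊢
  simp only [← add_assoc, zero_add] at hA hB ⊢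
  rw [hA, C.digitRow_eq, hB]
  simp only [hS, hC]
  rw [block, List.flatMap_cons, List.flatMap_append, List.flatMap_map, List.flatMap_assoc]
  -- Slot `0` is split off because the second base is attached to it.
  obtain ⟨l, hl⟩ : ∃ l : List ℕ, List.range (2 ^ w) = 0 :: l.map Nat.succ := by
    obtain ⟨k, hk⟩ := Nat.exists_eq_succ_of_ne_zero (Nat.two_pow_pos w).ne'
    exact ⟨List.range k, by rw [hk, List.range_succ_eq_map]⟩
  simp [hl, PowerFactor.symbols, slotPair, List.flatMap_map]

end CosetWords

/-! ### The value of the translated power word -/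

namespace CosetWords

variable {X Y G Γ : Type*} [Group G] [Group Γ] (C : CosetWords X Y G Γ)

/-- Schreier rewriting: slot `i + k` holds the word for the letter `k` of `u` in the coset reached
by the letters before it, so neighbouring representatives cancel. All slots outside `u` have the
value `1`. -/
theorem prod_slots (u : List (X × Bool)) (i : ℕ) (γ : Γ) (n : ℕ) (h : i + u.length ≤ n) :
    ((List.range n).map fun s => C.val (FreeGroup.mk (C.word
      ((slotAt C.toQuot s i u).map fun p => (γ * p.1, p.2))))).prod =
      C.rep γ * C.φ (FreeGroup.mk u) * (C.rep (γ * C.toQuot (FreeGroup.mk u)))⁻¹ := by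
  obtain ⟨n, rfl⟩ := Nat.exists_eq_add_of_le h
  have h1 : ∀ s < i, slotAt C.toQuot s i u = none := fun s hs => if_pos hs
  have h2 : ∀ s, i + u.length ≤ s → slotAt C.toQuot s i u = none := by
    intro s hs
    rw [slotAt, if_neg (by omega), List.getElem?_eq_none (by omega)]
    rfl
  have h3 : ∀ k, (hk : k ≤ u.length) → ((List.range' i k).map fun s => C.val (FreeGroup.mk (C.word
      ((slotAt C.toQuot s i u).map fun p => (γ * p.1, p.2))))).prod =
      C.rep γ * C.φ (FreeGroup.mk (u.take k)) *
        (C.rep (γ * C.toQuot (FreeGroup.mk (u.take k))))⁻¹ := by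
    intro k
    induction k with
    | zero => simp [← FreeGroup.one_eq_mk]
    | succ k ih =>
      intro hk
      have h4 : slotAt C.toQuot (i + k) i u =
          some (C.toQuot (FreeGroup.mk (u.take k)), u[k]) := by
        rw [slotAt, if_neg (by omega), Nat.add_sub_cancel_left, List.getElem?_eq_getElem hk]
        rfl
      rw [List.range'_1_concat, List.map_append, List.prod_append, ih (by omega),
        List.map_singleton, List.prod_singleton, h4, Option.map_some, C.val_some,
        List.take_succ_eq_append_getElem hk, FreeGroup.map_mk_append, FreeGroup.map_mk_append,
        mul_assoc γ]
      change _ * _ * _ * (_ * _ * (C.rep (γ * (_ * C.toQuot _)))⁻¹) = _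
      group
  have h4 : ∀ l : List ℕ, (∀ s ∈ l, slotAt C.toQuot s i u = none) →
      (l.map fun s => C.val (FreeGroup.mk (C.word
        ((slotAt C.toQuot s i u).map fun p => (γ * p.1, p.2))))).prod = 1 := by
    intro l hl
    refine List.prod_eq_one fun z hz => ?_
    obtain ⟨s, hs, rfl⟩ := List.mem_map.1 hz
    rw [hl s hs, Option.map_none, C.val_none]
  have h5 : List.range (i + u.length + n) =
      List.range' 0 i ++ (List.range' i u.length ++ List.range' (i + u.length) n) := by
    rw [List.range'_append_1, List.range_eq_range', add_assoc]
    have h6 := List.range'_append_1 (s := 0) (m := i) (n := u.length + n)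
    rw [zero_add] at h6
    exact h6.symm
  rw [h5, List.map_append, List.prod_append, List.map_append, List.prod_append, h3 _ le_rfl,
    List.take_length, h4 _ fun s hs => h1 s (by have := List.mem_range'_1.1 hs; omega),
    h4 _ fun s hs => h2 s (List.mem_range'_1.1 hs).1, one_mul, mul_one]

variable [Finite Γ] (y : Y) (w : ℕ)

theorem val_baseWord (t : ℕ) (F : Option (FactorScan X Γ)) :
    C.val (FreeGroup.mk (C.baseWord y t F)) = C.val (FreeGroup.mk (C.word (key t F))) := by
  have : FreeGroup.mk [(y, true), (y, false)] = 1 := by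
    rw [FreeGroup.one_eq_mk]
    exact Quot.sound FreeGroup.Red.Step.cons_not
  rw [baseWord, FreeGroup.map_mk_append, this, map_one, mul_one]

theorem prod_key (r : Γ) (i : ℕ) (f : PowerFactor X) (t : ℕ) (h : i + f.base.length ≤ 2 ^ w) :
    ((List.range (2 ^ w)).map fun s => C.val (FreeGroup.mk (C.word
      (key t (C.scan (some (r, i, f)) s))))).prod =
      C.rep (r * C.toQuot (FreeGroup.mk f.base) ^ t) * C.φ (FreeGroup.mk f.base) *
        (C.rep (r * C.toQuot (FreeGroup.mk f.base) ^ (t + 1)))⁻¹ := by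
  rw [pow_succ, ← mul_assoc r, ← C.prod_slots f.base i _ (2 ^ w) h]
  rfl

theorem prod_key_none (t : ℕ) :
    ((List.range (2 ^ w)).map fun s => C.val (FreeGroup.mk (C.word
      (key t (C.scan none s))))).prod = 1 := by
  refine List.prod_eq_one fun z hz => ?_
  obtain ⟨s, hs, rfl⟩ := List.mem_map.1 hz
  exact C.val_none

theorem prod_copies (r : Γ) (i : ℕ) (f : PowerFactor X) (h : i + f.base.length ≤ 2 ^ w) (m : ℕ)
    (hm : m ≤ Nat.card Γ) :
    ((List.range (Nat.card Γ)).map fun t => ((List.range (2 ^ w)).map fun s =>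
      C.val (FreeGroup.mk (C.word (key t (C.scan (some (r, i, f)) s)))) ^
        (if t < m then 1 else 0 : ℤ)).prod).prod =
      C.rep r * C.φ (FreeGroup.mk f.base) ^ m *
        (C.rep (r * C.toQuot (FreeGroup.mk f.base) ^ m))⁻¹ := by
  -- The factor `φ(u)⁻ᵗ` in the telescoping sequence makes consecutive quotients equal to the values
  -- of single copies; from `m` on the copies are switched off by the exponent `0`.
  rw [List.prod_map_range_telescope (fun t => C.rep (r * C.toQuot (FreeGroup.mk f.base) ^ t) *
    (C.φ (FreeGroup.mk f.base) ^ t)⁻¹) m]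
  · rw [min_eq_right hm, pow_zero, pow_zero, mul_one, inv_one, mul_one, mul_inv_rev, inv_inv,
      mul_assoc]
  · intro t ht
    simp only [if_pos ht, zpow_one]
    rw [C.prod_key w r i f t h, pow_succ (C.φ _)]
    group
  · intro t ht
    simp [if_neg (not_lt.2 ht)]

theorem val_baseOf (x : Option (Γ × ℕ × PowerFactor X)) :
    C.val (FreeGroup.mk (C.baseOf w x y)) = ((List.range (Nat.card Γ)).map fun t =>
      ((List.range (2 ^ w)).map fun s =>
        C.val (FreeGroup.mk (C.word (key t (C.scan x s))))).prod).prod := by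
  simp only [baseOf, FreeGroup.map_mk_flatMap, val_baseWord]

theorem value_block (x : Option (Γ × ℕ × PowerFactor X)) :
    powerWordValue C.val (C.block w x y) =
      C.val (FreeGroup.mk (C.baseOf w x y)) ^
        (if negOf x then -(binaryValue (C.digitsOf w x) : ℤ) else binaryValue (C.digitsOf w x)) *
      (C.val (FreeGroup.mk (C.baseOf w x y)) ^ (if negOf x then -1 else 0 : ℤ) *
      ((List.range (Nat.card Γ)).map fun t => ((List.range (2 ^ w)).map fun s =>
        C.val (FreeGroup.mk (C.word (key t (C.scan x s)))) ^
          (if t < copiesOf x then 1 else 0 : ℤ)).prod).prod) := by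
  have h1 : ∀ P : PowerFactor Y, powerWordValue C.val [P] = C.val (FreeGroup.mk P.base) ^ P.exponent :=
    fun P => by simp [powerWordValue]
  have hmap : ∀ (l : List ℕ) (P : ℕ → PowerFactor Y), powerWordValue C.val (l.map P) =
      (l.map fun i => C.val (FreeGroup.mk (P i).base) ^ (P i).exponent).prod := by
    intro l P
    simp [powerWordValue, Function.comp_def]
  obtain ⟨l, hl⟩ : ∃ l : List ℕ, List.range (2 ^ w) = 0 :: l.map Nat.succ := by
    obtain ⟨k, hk⟩ := Nat.exists_eq_succ_of_ne_zero (Nat.two_pow_pos w).ne'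
    exact ⟨List.range k, by rw [hk, List.range_succ_eq_map]⟩
  rw [block, ← List.singleton_append, powerWordValue_append, powerWordValue_append,
    powerWordValue_flatMap, h1]
  congr 1
  congr 1
  · rw [hmap, hl, List.map_cons, List.prod_cons, List.map_map, List.prod_eq_one (l := l.map _)]
    · rw [mul_one]
      simp only [slotPair, if_true, FreeGroup.map_mk_append, C.val_none, mul_one, PowerFactor.exponent]
      congr 1
      cases negOf x <;> simp [binaryValue]
    · intro z hz
      obtain ⟨s, hs, rfl⟩ := List.mem_map.1 hz
      simp [slotPair, C.val_none]
  · congr 2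
    funext t
    rw [hmap]
    congr 2
    funext s
    simp only [slotPair, PowerFactor.exponent]
    by_cases ht : t < copiesOf x <;> simp [ht, binaryValue]

theorem value_block_none : powerWordValue C.val (C.block w none y) = 1 := by
  have h1 : C.val (FreeGroup.mk (C.baseOf w none y)) = 1 := by
    rw [val_baseOf]
    refine List.prod_eq_one fun z hz => ?_
    obtain ⟨t, ht, rfl⟩ := List.mem_map.1 hz
    exact C.prod_key_none w t
  rw [value_block, h1, one_zpow, one_zpow, one_mul, one_mul]
  refine List.prod_eq_one fun z hz => ?_
  obtain ⟨t, ht, rfl⟩ := List.mem_map.1 hz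
  simp only [show copiesOf (none : Option (Γ × ℕ × PowerFactor X)) = 0 from rfl, not_lt_zero,
    if_false, zpow_zero]
  simp

/-- The row has room for more digits than the exponent has, so the quotient is only padded by
leading zeros. -/
theorem binaryValue_digitsOf (r : Γ) (i : ℕ) (f : PowerFactor X)
    (h : f.digits.length < 2 ^ w) :
    binaryValue (C.digitsOf w (some (r, i, f))) = binaryValue f.digits / Nat.card Γ := by
  have h1 : 2 * 2 ^ w ≤ C.places * 2 ^ w := Nat.mul_le_mul_right _ (by rw [places]; omega)
  rw [← binaryValue_quotientDigits Nat.card_pos, digitsOf]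
  change binaryValue ((List.range _).map fun j => List.getD (List.reverse _) _ false) = _
  rw [List.map_getD_reverse_range _ _ (by rw [length_quotientDigits]; simp only; omega),
    binaryValue_replicate_append]

/-- With `v = K * q + ρ`, a positive exponent splits as `K * q + ρ` and a negative one as `-K * q -
K + (K - ρ)`. Thus single copies occur only with positive exponents and no inverse of the base has
to be rewritten. For `ρ = 0` and a negative sign, all `K` copies are present and cancel the extra
`-K`. -/
theorem value_block_some (r : Γ) (i : ℕ) (f : PowerFactor X)
    (h : i + f.symbols.length ≤ 2 ^ w) :
    powerWordValue C.val (C.block w (some (r, i, f)) y) =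
      C.rep r * C.φ (FreeGroup.mk f.base) ^ f.exponent *
        (C.rep (r * C.toQuot (FreeGroup.mk f.base) ^ f.exponent))⁻¹ := by
  have hlen : f.symbols.length = f.base.length + (f.digits.length + 1) := by
    simp [PowerFactor.symbols]
  have hbase : i + f.base.length ≤ 2 ^ w := by omega
  have hK : 0 < Nat.card Γ := Nat.card_pos
  have hmod := Nat.mod_lt (binaryValue f.digits) hK
  have hdiv := Nat.div_add_mod (binaryValue f.digits) (Nat.card Γ)
  set g := C.φ (FreeGroup.mk f.base) with hg
  set u := C.toQuot (FreeGroup.mk f.base) with hu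
  -- The `K` copies return to the coset `r`; so their value is a conjugate, and `conj_zpow` takes
  -- its powers.
  have hone : u ^ Nat.card Γ = 1 := pow_card_eq_one'
  have hA : C.val (FreeGroup.mk (C.baseOf w (some (r, i, f)) y)) =
      C.rep r * g ^ Nat.card Γ * (C.rep r)⁻¹ := by
    have h1 := C.prod_copies w r i f hbase (Nat.card Γ) le_rfl
    rw [← hu, hone, mul_one] at h1
    rw [val_baseOf, ← h1]
    congr 1
    refine List.map_congr_left fun t ht => ?_
    simp only [if_pos (List.mem_range.1 ht), zpow_one]
  have hcopies : copiesOf (some (r, i, f)) =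
      copies (Γ := Γ) f.neg (binaryValue f.digits % Nat.card Γ) := rfl
  rw [value_block, hA, C.binaryValue_digitsOf w r i f (by omega), hcopies,
    C.prod_copies w r i f hbase _ (by rw [copies]; split_ifs <;> omega), ← hg, ← hu,
    conj_zpow, conj_zpow, PowerFactor.exponent, copies]
  change C.rep r * (g ^ Nat.card Γ) ^ (if f.neg then _ else _) * _ *
    (C.rep r * (g ^ Nat.card Γ) ^ (if f.neg then _ else _) * _ * _) = _
  have hdiv' : (binaryValue f.digits : ℤ) = Nat.card Γ * (binaryValue f.digits / Nat.card Γ : ℕ) +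
      (binaryValue f.digits % Nat.card Γ : ℕ) := by exact_mod_cast hdiv.symm
  generalize binaryValue f.digits = v at *
  rcases hneg : f.neg
  · have hu' : u ^ (v : ℤ) = u ^ (v % Nat.card Γ) := by rw [zpow_natCast, pow_mod_natCard]
    simp only [Bool.false_eq_true, if_false]
    have hg' : g ^ (v : ℤ) = (g ^ Nat.card Γ) ^ ((v / Nat.card Γ : ℕ) : ℤ) *
        g ^ (v % Nat.card Γ) := by
      rw [← zpow_natCast g (Nat.card Γ), ← zpow_mul, ← zpow_natCast, ← zpow_add, hdiv']
    rw [hu', hg', zpow_zero]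
    group
  · have hu' : u ^ (-(v : ℤ)) = u ^ (Nat.card Γ - v % Nat.card Γ) := by
      rw [zpow_neg, zpow_natCast, ← pow_mod_natCard, inv_eq_iff_mul_eq_one, ← pow_add,
        Nat.add_sub_cancel' hmod.le, hone]
    simp only [if_true]
    rw [hu']
    have hg' : g ^ (-(v : ℤ)) = (g ^ Nat.card Γ) ^ (-((v / Nat.card Γ : ℕ) : ℤ)) *
        (g ^ Nat.card Γ) ^ (-1 : ℤ) * g ^ (Nat.card Γ - v % Nat.card Γ) := by
      rw [← zpow_natCast g (Nat.card Γ), ← zpow_mul, ← zpow_mul, ← zpow_add, ← zpow_natCast,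
        ← zpow_add, Nat.cast_sub hmod.le]
      congr 1
      rw [hdiv']
      ring
    rw [hg']
    group

theorem exists_powerWord_layout (P : List (PowerFactor X))
    (hP : (P.flatMap PowerFactor.symbols).length < 2 ^ w) :
    ∃ Q : List (PowerFactor Y),
      layout (Nat.card Γ + (1 + (Nat.card Γ + (1 + Nat.card Γ)))) C.places w
        (fun e t s m => C.symbol y t m (decide (s = 0)) ((pairAt C.toQuot e 0 1 P).map
          (pairScan C.toQuot s (C.places * (2 ^ w - 1 - s) + (C.places - 1 - m))))) =
        Q.flatMap PowerFactor.symbols ∧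
      powerWordValue C.val Q =
        C.rep 1 * powerWordValue C.φ P * (C.rep (powerWordValue C.toQuot P))⁻¹ := by
  refine ⟨(List.range (2 ^ w)).flatMap fun e => C.block w (pairAt C.toQuot e 0 1 P) y, ?_, ?_⟩
  · rw [List.flatMap_assoc, layout]
    exact List.flatMap_congr fun e _ => C.block_symbols w _ y
  · rw [powerWordValue_flatMap, List.range_eq_range',
      List.prod_map_range_pairAt C.toQuot C.φ C.rep (2 ^ w)
        (fun x => powerWordValue C.val (C.block w x y)) (C.value_block_none y w)
        (C.value_block_some y w) P 0 (2 ^ w) 1 hP.le (by omega), one_mul]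

end CosetWords

/-! ### The reduction -/

theorem nc1ManyOneReducible_of_nonempty {X Y G : Type*} [Finite X] [Nonempty Y] [Group G]
    (H : Subgroup G) (hH : H.FiniteIndex) (φ : FreeGroup X →* G) (ψ : FreeGroup Y →* H)
    (hψ : Function.Surjective ψ) (c : BlockCode (PowerSymbol X)) (d : BlockCode (PowerSymbol Y)) :
    NC1ManyOneReducible (PowWP φ c) (PowWP ψ d) := by
  obtain ⟨N, _, _, C, rfl, hval⟩ := exists_cosetWords H hH φ ψ hψ
  obtain ⟨y⟩ := ‹Nonempty Y›
  obtain ⟨f, hf, hfx⟩ := exists_nc1Computable_scan C.toQuot c d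
    (Nat.card (G ⧸ N) + (1 + (Nat.card (G ⧸ N) + (1 + Nat.card (G ⧸ N))))) C.places (by omega)
    (Nat.succ_pos _) (C.symbol y)
  refine ⟨f, hf, fun x => ?_⟩
  rcases hfx x with ⟨P, w, rfl, hP, hlt, hx⟩ | ⟨hP, l, hx⟩
  · obtain ⟨Q, hQ, hQval⟩ := C.exists_powerWord_layout y w P hlt
    rw [hx, hQ, mem_PowWP_iff, mem_PowWP_iff]
    rw [hP, hval, powerWordValue_comp, Subgroup.subtype_apply] at hQval
    -- The two values are conjugate by `rep 1`, which need not be `1`.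
    rw [← OneMemClass.coe_eq_one, hQval, mul_inv_eq_one, mul_eq_left]
  · rw [hx]
    -- A power word with value `1` in `G` has value `1` in the quotient as well, so nothing is lost
    -- by rejecting the others.
    refine iff_of_false ?_ (not_mem_PowWP ψ d false l)
    rintro ⟨P, h1, h2⟩
    exact hP ⟨P, h1, by rw [CosetWords.toQuot, powerWordValue_comp, h2, map_one]⟩

/-- Without generators there is no letter for padding. But `H` is then trivial and `G` finite, so
`G` itself serves as the finite quotient: the automaton decides the problem, and positive instances
are sent to power words with empty bases. -/
theorem nc1ManyOneReducible_of_isEmpty {X Y G : Type*} [Finite X] [IsEmpty Y] [Group G]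
    (H : Subgroup G) (hH : H.FiniteIndex) (φ : FreeGroup X →* G) (ψ : FreeGroup Y →* H)
    (hψ : Function.Surjective ψ) (c : BlockCode (PowerSymbol X)) (d : BlockCode (PowerSymbol Y)) :
    NC1ManyOneReducible (PowWP φ c) (PowWP ψ d) := by
  have hsub : Subsingleton H := hψ.subsingleton
  have hbot : H = ⊥ := Subgroup.eq_bot_of_subsingleton H
  have hfin : Finite G := by
    subst hbot
    exact Nat.finite_of_card_ne_zero (Subgroup.index_bot (G := G) ▸ hH.index_ne_zero)
  obtain ⟨f, hf, hfx⟩ := exists_nc1Computable_scan φ c d 1 2 one_pos two_pos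
    (fun _ m _ _ => if m = 0 then .sign false else .bit false)
  refine ⟨f, hf, fun x => ?_⟩
  rcases hfx x with ⟨P, w, rfl, hP, -, hx⟩ | ⟨hP, l, hx⟩
  · have hQ : layout 1 2 w (fun _ _ _ m => if m = 0 then .sign false else .bit false) =
        ((List.range (2 ^ w)).flatMap fun _ => (List.range 1).flatMap fun _ =>
          (List.range (2 ^ w)).map fun _ => (⟨[], false, [false], by simp⟩ :
            PowerFactor Y)).flatMap PowerFactor.symbols := by
      simp only [layout, List.flatMap_assoc, List.flatMap_map]
      rfl
    rw [hx, hQ, mem_PowWP_iff, mem_PowWP_iff]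
    exact iff_of_true hP (Subsingleton.elim _ _)
  · rw [hx]
    refine iff_of_false ?_ (not_mem_PowWP ψ d false l)
    rintro ⟨P, h1, h2⟩
    exact hP ⟨P, h1, h2⟩

theorem mainTheorem6 {G : Type*} [Group G] (hG : Group.FG G) (H : Subgroup G)
    (hH : H.FiniteIndex) :
    Group.FG H ∧
      ∀ (X Y : Type*) [Finite X] [Finite Y]
        (φ : FreeGroup X →* G) (_ : Function.Surjective φ)
        (ψ : FreeGroup Y →* H) (_ : Function.Surjective ψ)
        (c : BlockCode (PowerSymbol X)) (d : BlockCode (PowerSymbol Y)),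
        NC1ManyOneReducible (PowWP φ c) (PowWP ψ d) := by
  -- The instance is Schreier's lemma.
  refine ⟨inferInstance, fun X Y _ _ φ _ ψ hψ c d => ?_⟩
  rcases isEmpty_or_nonempty Y with hY | hY
  · exact nc1ManyOneReducible_of_isEmpty H hH φ ψ hψ c d
  · exact nc1ManyOneReducible_of_nonempty H hH φ ψ hψ c d
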